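/- Let $G\subset\mathbb{R}^2$ be a finite set of $n$ points (guards) and let $0<\Theta<\pi$. A $\Theta$-cone is an open cone with apex angle $\Theta$; it is empty if it contains no point of $G$. The $\Theta$-region is the set of all points $p$ such that no $\Theta$-cone with apex $p$ is empty. For points $l,r$ let $C_{l,r}^{\Theta}$ be the circular arc running counterclockwise from $l$ to $r$ with inscribed angle $\Theta$ (the points $p$ with $\angle lpr=\Theta$ that see $l$ on the left and $r$ on the right, together with $l$ and $r$), and let $D_{l,r}^{\Theta}$ be the closed circular segment bounded by $C_{l,r}^{\Theta}$ and the chord $lr$. A tunnel arises as follows. Start with an empty $\Theta$-cone whose apex is not a guard and which has a guard on each of its two bounding rays. Rotate it continuously clockwise, moving its apex so that the cone always stays empty and always has a guard on each ray, until the apex reaches a guard $l_0$; likewise rotate the initial cone counterclockwise until the apex reaches a guard $r_0$. Let $L_i$ (resp. $R_i$) be the set of guards met by the left (resp. right) ray of the cone (the apex not being counted as a point of the ray) during the $i$-th such motion, together with $l_0$ (resp. $r_0$), and put $$U_i=\bigcap_{(l,r)\in L_i\times R_i}D_{l,r}^{\Theta}.$$ Let $\mathcal{C}$ be the set of all circular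 arcs that appear in the boundary of some $U_i$, that is, the connected components with more than one point of the sets $\partial U_i\cap C_{l,r}^{\Theta}$ with $(l,r)\in L_i\times R_i$, where $i$ ranges over all tunnels. The complexity of the $\Theta$-region is the number of vertices plus the number of edges of its boundary, where a vertex is a boundary point in no neighbourhood of which the boundary coincides with a circle, and the edges are the connected components of the boundary minus the vertices. Theorem. There is an absolute constant $C>0$ such that for every finite $G\subset\mathbb{R}^2$ with $n=|G|$ and every $0<\Theta<\pi$: 1. $\mathcal{C}$ is finite and $|\mathcal{C}|\le C\,\dfrac{n}{\Theta}$; 2. the boundary of the $\Theta$-region is contained in the union of the arcs in $\mathcal{C}$; 3. the $\Theta$-region has finitely many vertices and edges, and its complexity is at most $C\,\dfrac{n^2}{\Theta^2}$. -/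

import Mathlib

open scoped Topology

/-- The Euclidean plane. -/
abbrev Plane : Type := EuclideanSpace ℝ (Fin 2)

noncomputable section

namespace GuardedRegion

/-- The unit vector in direction `φ`. -/
def dir (φ : ℝ) : Plane := !₂[Real.cos φ, Real.sin φ]

/-- The two-dimensional cross product; `0 < cross u v` if `v` points to the left of `u`. -/
def cross (u v : Plane) : ℝ := u 0 * v 1 - u 1 * v 0

/-- The open cone with apex `p`, apex angle `Θ` and medial axis in direction `φ`. -/
def cone (Θ : ℝ) (p : Plane) (φ : ℝ) : Set Plane :=
  {x | ∃ s : ℝ, 0 < s ∧ ∃ ψ ∈ Set.Ioo (φ - Θ / 2) (φ + Θ / 2), x = p + s • dir ψ}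

/-- The left bounding ray of `cone Θ p φ`, as seen from the apex (without the apex). -/
def leftRay (Θ : ℝ) (p : Plane) (φ : ℝ) : Set Plane :=
  {x | ∃ s : ℝ, 0 < s ∧ x = p + s • dir (φ + Θ / 2)}

/-- The right bounding ray of `cone Θ p φ`, as seen from the apex (without the apex). -/
def rightRay (Θ : ℝ) (p : Plane) (φ : ℝ) : Set Plane :=
  {x | ∃ s : ℝ, 0 < s ∧ x = p + s • dir (φ - Θ / 2)}

/-- A cone is empty with respect to `G` if it contains no guard. -/
def IsEmptyCone (G : Finset Plane) (Θ : ℝ) (p : Plane) (φ : ℝ) : Prop :=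
  ∀ g ∈ G, g ∉ cone Θ p φ

/-- The `Θ`-guarded region: all points `p` such that no `Θ`-cone with apex `p` is empty. -/
def region (G : Finset Plane) (Θ : ℝ) : Set Plane :=
  {p | ∀ φ : ℝ, ¬ IsEmptyCone G Θ p φ}

/-- The circular arc from `l` to `r` (counterclockwise, end points included) with inscribed
angle `Θ`: the points that see the chord under the angle `Θ`, with `l` on the left-hand side and
`r` on the right-hand side. -/
def arc (Θ : ℝ) (l r : Plane) : Set Plane :=
  {p | p = l ∨ p = r ∨ (EuclideanGeometry.angle l p r = Θ ∧ 0 ≤ cross (r - p) (l - p))}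

/-- The closed circular segment bounded by `arc Θ l r` and the chord from `l` to `r`. -/
def segmentOf (Θ : ℝ) (l r : Plane) : Set Plane :=
  {p | p = l ∨ p = r ∨ (Θ ≤ EuclideanGeometry.angle l p r ∧ 0 ≤ cross (r - p) (l - p))}

/-- The full motion of a rotating cone that constructs one tunnel. The cone has apex `p φ` when
its medial axis points in direction `φ`; it is always empty and touches a guard on each of its two
bounding rays. The motion extends, clockwise (decreasing `φ`) and counterclockwise
(increasing `φ`), until the apex reaches the position of a guard. Any empty cone with a guard on
each ray that occurs for `φ` strictly between `α` and `β` serves as the starting position. -/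
structure IsTunnelMotion (G : Finset Plane) (Θ α β : ℝ) (p : ℝ → Plane) : Prop where
  lt : α < β
  continuousOn : ContinuousOn p (Set.Icc α β)
  isEmptyCone : ∀ φ ∈ Set.Icc α β, IsEmptyCone G Θ (p φ) φ
  touches_left : ∀ φ ∈ Set.Ioo α β, ∃ g ∈ G, g ∈ leftRay Θ (p φ) φ
  touches_right : ∀ φ ∈ Set.Ioo α β, ∃ g ∈ G, g ∈ rightRay Θ (p φ) φ
  apex_notMem : ∀ φ ∈ Set.Ioo α β, p φ ∉ G
  clockwise_end : p α ∈ G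
  counterclockwise_end : p β ∈ G

/-- The guards incident to the left ray during the motion. The guard `p α`, at which the clockwise
motion ends, belongs to them. -/
def leftGuards (G : Finset Plane) (Θ α β : ℝ) (p : ℝ → Plane) : Set Plane :=
  {g | g ∈ G ∧ (g = p α ∨ ∃ φ ∈ Set.Icc α β, g ∈ leftRay Θ (p φ) φ)}

/-- The guards incident to the right ray during the motion. The guard `p β`, at which the
counterclockwise motion ends, belongs to them. -/
def rightGuards (G : Finset Plane) (Θ α β : ℝ) (p : ℝ → Plane) : Set Plane :=
  {g | g ∈ G ∧ (g = p β ∨ ∃ φ ∈ Set.Icc α β, g ∈ rightRay Θ (p φ) φ)}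

/-- The set `U` of a tunnel: the intersection of the circular segments of all pairs consisting of
a left guard and a right guard. -/
def tunnelSet (Θ : ℝ) (L R : Set Plane) : Set Plane :=
  ⋂ l ∈ L, ⋂ r ∈ R, segmentOf Θ l r

/-- The circular arcs that appear in the boundary of the set `U` of a tunnel: the maximal
non-degenerate pieces that this boundary has in common with one of the arcs `arc Θ l r`. -/
def boundaryArcs (Θ : ℝ) (L R : Set Plane) : Set (Set Plane) :=
  {a | a.Nontrivial ∧ ∃ l ∈ L, ∃ r ∈ R,
    ∃ x ∈ frontier (tunnelSet Θ L R) ∩ arc Θ l r,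
      a = connectedComponentIn (frontier (tunnelSet Θ L R) ∩ arc Θ l r) x}

/-- The set of all circular arcs that appear in the boundary of the set `U` of some tunnel. -/
def arcs (G : Finset Plane) (Θ : ℝ) : Set (Set Plane) :=
  {a | ∃ (α β : ℝ) (p : ℝ → Plane), IsTunnelMotion G Θ α β p ∧
    a ∈ boundaryArcs Θ (leftGuards G Θ α β p) (rightGuards G Θ α β p)}

/-- The vertices of a plane set that is bounded by circular arcs: the boundary points near which
the boundary does not coincide with a circle. -/
def vertices (S : Set Plane) : Set Plane :=
  {x | x ∈ frontier S ∧
    ¬ ∃ (c : Plane) (ρ : ℝ), 0 < ρ ∧ ∃ V ∈ 𝓝 x, frontier S ∩ V = Metric.sphere c ρ ∩ V}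

/-- The edges of a plane set that is bounded by circular arcs: the connected components of the
boundary without the vertices. -/
def edges (S : Set Plane) : Set (Set Plane) :=
  {e | ∃ x ∈ frontier S \ vertices S, e = connectedComponentIn (frontier S \ vertices S) x}

end GuardedRegion

end

/-! A cone in direction `φ` is the intersection of two half-planes, so everything is measured by the
two linear coordinates `lc Θ φ` and `rc Θ φ` that vanish along its bounding rays. Passing from one
direction to another multiplies these coordinates by sines (`frame_lc`, `frame_rc`), hence rotation
arguments become sign arguments. Reflection swaps left with right and reverses the rotation, so half
of the statements follow from the other half.

Tunnels. Emptiness together with contact on both rays is rigid: a guard left of the right ray stays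
there as the cone turns counterclockwise, the total turn is at most `π - Θ` (`IsSweep.sub_le`), and
the apex runs on a convex curve. Consequently every intermediate apex sees each pair of a left and a
right guard under an angle between `Θ` and `π`, so the apex path lies in `U`
(`IsSweep.mem_segmentOf`). Conversely, a point of `U` on the arc of a pair `l`, `r` is an apex
position in contact with both, apart from at most four points
(`IsTunnelMotion.mem_tunnelSet_inter_arc`). Boundary arcs of `U` are therefore exactly pieces of the
apex path along which the pair in contact is fixed.

Counting. Each boundary arc is charged to the event at its counterclockwise end: the apex reaches a
guard, the left ray leaves a guard, or the right ray meets a guard. Kind, guard and direction of the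
event determine the arc (`IsTunnelArc.image_eq`), even across different tunnels. Two events of the
same kind at the same guard have directions at least `Θ` apart (`IsEndEvent.add_le`), because
otherwise a guard would be inside an empty cone. This leaves `O(1/Θ)` arcs for each guard and kind.

Boundary. At a boundary point that is not a guard, an empty cone can be turned until both rays touch
guards (`exists_touches_of_mem_frontier`). Such a cone extends in both senses to a full motion,
because a motion that never reaches a guard would turn too far. Guards on the boundary are limits of
other boundary points, and the union of the arcs is closed.

Complexity. The boundary of an open set covered by `N` circular arcs disjoint from the set is
locally a full circle away from `O(N²)` special points: end points of arcs and intersections of arcs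
on different circles. Vertices are special, and each edge contains a special point or follows one
along an arc. -/

namespace GuardedRegion

/-! ### Oblique coordinates along the bounding rays -/

/-- The coordinate of `x` that vanishes along the left bounding ray of a cone in direction `φ`. -/
noncomputable def lc (Θ φ : ℝ) (x : Plane) : ℝ := cross x (dir (φ + Θ / 2))

/-- The coordinate of `x` that vanishes along the right bounding ray of a cone in direction `φ`. -/
noncomputable def rc (Θ φ : ℝ) (x : Plane) : ℝ := cross (dir (φ - Θ / 2)) x

@[simp] theorem dir_zero (φ : ℝ) : dir φ 0 = Real.cos φ := by simp [dir]

@[simp] theorem dir_one (φ : ℝ) : dir φ 1 = Real.sin φ := by simp [dir]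

theorem plane_ext {x y : Plane} (h0 : x 0 = y 0) (h1 : x 1 = y 1) : x = y := by
  ext i; fin_cases i <;> assumption

theorem lc_sub (Θ φ : ℝ) (x y : Plane) : lc Θ φ (x - y) = lc Θ φ x - lc Θ φ y := by
  simp [lc, cross]; ring

theorem rc_sub (Θ φ : ℝ) (x y : Plane) : rc Θ φ (x - y) = rc Θ φ x - rc Θ φ y := by
  simp [rc, cross]; ring

theorem lc_add (Θ φ : ℝ) (x y : Plane) : lc Θ φ (x + y) = lc Θ φ x + lc Θ φ y := by
  simp [lc, cross]; ring

theorem rc_add (Θ φ : ℝ) (x y : Plane) : rc Θ φ (x + y) = rc Θ φ x + rc Θ φ y := by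
  simp [rc, cross]; ring

theorem lc_smul (Θ φ s : ℝ) (x : Plane) : lc Θ φ (s • x) = s * lc Θ φ x := by
  simp [lc, cross]; ring

theorem rc_smul (Θ φ s : ℝ) (x : Plane) : rc Θ φ (s • x) = s * rc Θ φ x := by
  simp [rc, cross]; ring

theorem cross_dir_dir (a b : ℝ) : cross (dir a) (dir b) = Real.sin (b - a) := by
  simp [cross, Real.sin_sub]; ring

theorem lc_dir (Θ φ ψ : ℝ) : lc Θ φ (dir ψ) = Real.sin (φ + Θ / 2 - ψ) := cross_dir_dir _ _

theorem rc_dir (Θ φ ψ : ℝ) : rc Θ φ (dir ψ) = Real.sin (ψ - (φ - Θ / 2)) := cross_dir_dir _ _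

/-- The expansion of a vector with respect to the two bounding rays. -/
theorem frame_expansion (Θ φ : ℝ) (v : Plane) :
    Real.sin Θ • v = rc Θ φ v • dir (φ + Θ / 2) + lc Θ φ v • dir (φ - Θ / 2) := by
  have h : Real.sin Θ = Real.sin (φ + Θ / 2) * Real.cos (φ - Θ / 2)
      - Real.cos (φ + Θ / 2) * Real.sin (φ - Θ / 2) := by
    rw [← Real.sin_sub]; congr 1; ring
  apply plane_ext <;> simp [lc, rc, cross, h] <;> ring

/-- Expand `v` along the two rays at `φ` and evaluate at `φ'`. When one coordinate of `v` at `φ` is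
zero, the sign at `φ'` is decided by a single sine; this and `frame_lc` drive all rotation
arguments. -/
theorem frame_rc (Θ φ φ' : ℝ) (v : Plane) :
    Real.sin Θ * rc Θ φ' v
      = rc Θ φ v * Real.sin (φ - φ' + Θ) + lc Θ φ v * Real.sin (φ - φ') := by
  rw [← rc_smul, frame_expansion Θ φ v, rc_add, rc_smul, rc_smul, rc_dir, rc_dir]
  congr 3 <;> ring

theorem frame_lc (Θ φ φ' : ℝ) (v : Plane) :
    Real.sin Θ * lc Θ φ' v
      = rc Θ φ v * Real.sin (φ' - φ) + lc Θ φ v * Real.sin (φ' - φ + Θ) := by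
  rw [← lc_smul, frame_expansion Θ φ v, lc_add, lc_smul, lc_smul, lc_dir, lc_dir]
  congr 3 <;> ring

theorem frame_cross (Θ φ : ℝ) (v w : Plane) :
    Real.sin Θ * cross v w = lc Θ φ v * rc Θ φ w - rc Θ φ v * lc Θ φ w := by
  have h : Real.sin Θ = Real.sin (φ + Θ / 2) * Real.cos (φ - Θ / 2)
      - Real.cos (φ + Θ / 2) * Real.sin (φ - Θ / 2) := by
    rw [← Real.sin_sub]; congr 1; ring
  simp [lc, rc, cross, h]; ring

theorem ext_of_lc_rc {Θ : ℝ} (h0 : 0 < Θ) (hπ : Θ < Real.pi) {φ : ℝ} {x y : Plane}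
    (hl : lc Θ φ x = lc Θ φ y) (hr : rc Θ φ x = rc Θ φ y) : x = y := by
  have h := frame_expansion Θ φ (x - y)
  rw [lc_sub, rc_sub, hl, hr, sub_self, sub_self, zero_smul, zero_smul, add_zero] at h
  rcases smul_eq_zero.1 h with h | h
  · exact absurd h (Real.sin_pos_of_pos_of_lt_pi h0 hπ).ne'
  · exact sub_eq_zero.1 h

theorem exists_eq_smul_dir_of_ne {v : Plane} (hv : v ≠ 0) (a : ℝ) :
    ∃ s : ℝ, 0 < s ∧ ∃ ψ ∈ Set.Ioc a (a + 2 * Real.pi), v = s • dir ψ := by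
  have hz : (⟨v 0, v 1⟩ : ℂ) ≠ 0 := by
    intro h
    apply hv
    have h0 := congrArg Complex.re h
    have h1 := congrArg Complex.im h
    exact plane_ext (by simpa using h0) (by simpa using h1)
  have hz0 : (⟨v 0, v 1⟩ : ℂ).re = v 0 := rfl
  have hz1 : (⟨v 0, v 1⟩ : ℂ).im = v 1 := rfl
  generalize (⟨v 0, v 1⟩ : ℂ) = z at *
  refine ⟨‖z‖, norm_pos_iff.2 hz, toIocMod Real.two_pi_pos a z.arg,
    toIocMod_mem_Ioc _ _ _, ?_⟩
  have hper := self_sub_toIocDiv_zsmul Real.two_pi_pos a z.arg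
  have hc : Real.cos (toIocMod Real.two_pi_pos a z.arg) = Real.cos z.arg := by
    rw [← hper, zsmul_eq_mul, Real.cos_sub_int_mul_two_pi]
  have hs : Real.sin (toIocMod Real.two_pi_pos a z.arg) = Real.sin z.arg := by
    rw [← hper, zsmul_eq_mul, Real.sin_sub_int_mul_two_pi]
  apply plane_ext
  · simp [hc, hz0]
  · simp [hs, hz1]

/-- As `Θ < π`, the open cone is the intersection of the open half-planes bounded by the lines
through its rays. -/
theorem mem_cone_iff {Θ : ℝ} (h0 : 0 < Θ) (hπ : Θ < Real.pi) {φ : ℝ} {p x : Plane} :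
    x ∈ cone Θ p φ ↔ lc Θ φ p < lc Θ φ x ∧ rc Θ φ p < rc Θ φ x := by
  constructor
  · rintro ⟨s, hs, ψ, ⟨h1, h2⟩, rfl⟩
    rw [lc_add, rc_add, lc_smul, rc_smul, lc_dir, rc_dir]
    have ha : 0 < Real.sin (φ + Θ / 2 - ψ) :=
      Real.sin_pos_of_pos_of_lt_pi (by linarith) (by linarith)
    have hb : 0 < Real.sin (ψ - (φ - Θ / 2)) :=
      Real.sin_pos_of_pos_of_lt_pi (by linarith) (by linarith)
    constructor <;> nlinarith [mul_pos hs ha, mul_pos hs hb]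
  · rintro ⟨hl, hr⟩
    have hne : x - p ≠ 0 := by
      intro h
      rw [sub_eq_zero.1 h] at hl
      exact lt_irrefl _ hl
    obtain ⟨s, hs, ψ, ⟨h1, h2⟩, h⟩ := exists_eq_smul_dir_of_ne hne (φ - Θ / 2)
    have hA : 0 < lc Θ φ (x - p) := by rw [lc_sub]; linarith
    have hB : 0 < rc Θ φ (x - p) := by rw [rc_sub]; linarith
    rw [h, lc_smul, lc_dir] at hA
    rw [h, rc_smul, rc_dir] at hB
    have hA' := (pos_iff_pos_of_mul_pos hA).1 hs
    have hB' := (pos_iff_pos_of_mul_pos hB).1 hs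
    -- The polar angle `ψ` is known only within a full turn; positivity of the two sines confines it
    -- to the cone.
    have h3 : ψ - (φ - Θ / 2) < Real.pi := by
      by_contra hcon
      have := Real.sin_nonpos_of_nonpos_of_neg_pi_le
        (x := ψ - (φ - Θ / 2) - 2 * Real.pi) (by linarith) (by linarith)
      rw [Real.sin_sub_two_pi] at this
      linarith
    have h4 : 0 < φ + Θ / 2 - ψ := by
      by_contra hcon
      have := Real.sin_nonpos_of_nonpos_of_neg_pi_le
        (x := φ + Θ / 2 - ψ) (by linarith) (by linarith)
      linarith
    exact ⟨s, hs, ψ, ⟨h1, by linarith⟩, by rw [← h]; abel⟩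

theorem mem_leftRay_iff {Θ : ℝ} (h0 : 0 < Θ) (hπ : Θ < Real.pi) {φ : ℝ} {p x : Plane} :
    x ∈ leftRay Θ p φ ↔ lc Θ φ x = lc Θ φ p ∧ rc Θ φ p < rc Θ φ x := by
  have hsin := Real.sin_pos_of_pos_of_lt_pi h0 hπ
  have e : φ + Θ / 2 - (φ - Θ / 2) = Θ := by ring
  constructor
  · rintro ⟨s, hs, rfl⟩
    rw [lc_add, rc_add, lc_smul, rc_smul, lc_dir, rc_dir, e]
    constructor
    · simp
    · nlinarith [mul_pos hs hsin]
  · rintro ⟨hl, hr⟩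
    refine ⟨(rc Θ φ x - rc Θ φ p) / Real.sin Θ, div_pos (by linarith) hsin, ?_⟩
    apply ext_of_lc_rc h0 hπ (φ := φ)
    · rw [lc_add, lc_smul, lc_dir, hl]; simp
    · rw [rc_add, rc_smul, rc_dir, e]; field_simp; ring

theorem mem_rightRay_iff {Θ : ℝ} (h0 : 0 < Θ) (hπ : Θ < Real.pi) {φ : ℝ} {p x : Plane} :
    x ∈ rightRay Θ p φ ↔ rc Θ φ x = rc Θ φ p ∧ lc Θ φ p < lc Θ φ x := by
  have hsin := Real.sin_pos_of_pos_of_lt_pi h0 hπ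
  have e : φ + Θ / 2 - (φ - Θ / 2) = Θ := by ring
  constructor
  · rintro ⟨s, hs, rfl⟩
    rw [lc_add, rc_add, lc_smul, rc_smul, lc_dir, rc_dir, e]
    constructor
    · simp
    · nlinarith [mul_pos hs hsin]
  · rintro ⟨hl, hr⟩
    refine ⟨(lc Θ φ x - lc Θ φ p) / Real.sin Θ, div_pos (by linarith) hsin, ?_⟩
    apply ext_of_lc_rc h0 hπ (φ := φ)
    · rw [lc_add, lc_smul, lc_dir, e]; field_simp; ring
    · rw [rc_add, rc_smul, rc_dir, hl]; simp

theorem isEmptyCone_iff {G : Finset Plane} {Θ : ℝ} (h0 : 0 < Θ) (hπ : Θ < Real.pi) {φ : ℝ}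
    {p : Plane} :
    IsEmptyCone G Θ p φ ↔ ∀ g ∈ G, lc Θ φ g ≤ lc Θ φ p ∨ rc Θ φ g ≤ rc Θ φ p := by
  simp only [IsEmptyCone, mem_cone_iff h0 hπ, not_and_or, not_lt]

theorem continuous_lc_const (Θ : ℝ) (x : Plane) : Continuous fun φ : ℝ => lc Θ φ x := by
  simp only [lc, cross, dir_zero, dir_one]; fun_prop

theorem continuous_rc_const (Θ : ℝ) (x : Plane) : Continuous fun φ : ℝ => rc Θ φ x := by
  simp only [rc, cross, dir_zero, dir_one]; fun_prop

theorem continuousOn_lc {Θ : ℝ} {s : Set ℝ} {p : ℝ → Plane} (hp : ContinuousOn p s) :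
    ContinuousOn (fun φ => lc Θ φ (p φ)) s := by
  have h0 : ContinuousOn (fun φ => p φ 0) s := by fun_prop
  have h1 : ContinuousOn (fun φ => p φ 1) s := by fun_prop
  simp only [lc, cross, dir_zero, dir_one]
  exact (h0.mul (by fun_prop)).sub (h1.mul (by fun_prop))

theorem continuousOn_rc {Θ : ℝ} {s : Set ℝ} {p : ℝ → Plane} (hp : ContinuousOn p s) :
    ContinuousOn (fun φ => rc Θ φ (p φ)) s := by
  have h0 : ContinuousOn (fun φ => p φ 0) s := by fun_prop
  have h1 : ContinuousOn (fun φ => p φ 1) s := by fun_prop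
  simp only [rc, cross, dir_zero, dir_one]
  exact (ContinuousOn.mul (by fun_prop) h1).sub (ContinuousOn.mul (by fun_prop) h0)

/-! ### Arcs and circular segments as polynomial conditions -/

/-- The function that vanishes on the circle that carries `arc Θ l r`. -/
noncomputable def pw (Θ : ℝ) (l r x : Plane) : ℝ :=
  Real.cos Θ * cross (r - x) (l - x)
    - Real.sin Θ * ((l - x) 0 * (r - x) 0 + (l - x) 1 * (r - x) 1)

theorem frame_inner (Θ φ : ℝ) (v w : Plane) :
    Real.sin Θ ^ 2 * (v 0 * w 0 + v 1 * w 1) = lc Θ φ v * lc Θ φ w + rc Θ φ v * rc Θ φ w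
      + Real.cos Θ * (lc Θ φ v * rc Θ φ w + rc Θ φ v * lc Θ φ w) := by
  have hc : Real.cos Θ = Real.cos (φ + Θ / 2) * Real.cos (φ - Θ / 2)
      + Real.sin (φ + Θ / 2) * Real.sin (φ - Θ / 2) := by
    rw [← Real.cos_sub]; congr 1; ring
  have h1 := Real.sin_sq_add_cos_sq (φ + Θ / 2)
  have h2 := Real.sin_sq_add_cos_sq (φ - Θ / 2)
  have hv := frame_expansion Θ φ v
  have hw := frame_expansion Θ φ w
  have hv0 := congrArg (fun x : Plane => x 0) hv
  have hv1 := congrArg (fun x : Plane => x 1) hv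
  have hw0 := congrArg (fun x : Plane => x 0) hw
  have hw1 := congrArg (fun x : Plane => x 1) hw
  simp only [PiLp.smul_apply, PiLp.add_apply, smul_eq_mul, dir_zero, dir_one] at hv0 hv1 hw0 hw1
  rw [show Real.sin Θ ^ 2 * (v 0 * w 0 + v 1 * w 1) = (Real.sin Θ * v 0) * (Real.sin Θ * w 0)
    + (Real.sin Θ * v 1) * (Real.sin Θ * w 1) by ring, hv0, hv1, hw0, hw1, hc]
  linear_combination rc Θ φ v * rc Θ φ w * h1 + lc Θ φ v * lc Θ φ w * h2

/-- `pw` is `-sin Θ` times the power of `x` with respect to the circle, so `0 ≤ pw` describes the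
closed disk. In this form, contact of `l` or `r` with a ray makes individual terms drop out. -/
theorem frame_pw (Θ φ : ℝ) (l r x : Plane) :
    Real.sin Θ * pw Θ l r x = -(lc Θ φ (l - x) * lc Θ φ (r - x))
      - rc Θ φ (l - x) * rc Θ φ (r - x)
      - 2 * Real.cos Θ * (lc Θ φ (l - x) * rc Θ φ (r - x)) := by
  have h1 := frame_inner Θ φ (l - x) (r - x)
  have h2 := frame_cross Θ φ (r - x) (l - x)
  rw [pw]
  linear_combination -h1 + Real.cos Θ * h2

theorem inner_eq (v w : Plane) : inner ℝ v w = v 0 * w 0 + v 1 * w 1 := by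
  simp [PiLp.inner_apply, Fin.sum_univ_two]; ring

theorem norm_sq_eq (v : Plane) : ‖v‖ ^ 2 = v 0 ^ 2 + v 1 ^ 2 := by
  rw [EuclideanSpace.norm_sq_eq]; simp [Fin.sum_univ_two]

theorem cross_eq_sin_of_nonneg {v w : Plane} (h : 0 ≤ cross w v) :
    cross w v = ‖v‖ * ‖w‖ * Real.sin (InnerProductGeometry.angle v w) := by
  have h1 := InnerProductGeometry.sin_angle_mul_norm_mul_norm v w
  have e : inner ℝ v v * inner ℝ w w - inner ℝ v w * inner ℝ v w = cross w v ^ 2 := by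
    simp only [inner_eq, cross]; ring
  rw [e, Real.sqrt_sq h] at h1
  linarith

/-- On the relevant side of the chord the sign of `pw` compares the angle `l x r` with `Θ`. -/
theorem pw_eq {Θ : ℝ} {l r x : Plane} (h : 0 ≤ cross (r - x) (l - x)) :
    pw Θ l r x = ‖l - x‖ * ‖r - x‖ * Real.sin (EuclideanGeometry.angle l x r - Θ) := by
  have h1 := cross_eq_sin_of_nonneg h
  have h2 := InnerProductGeometry.cos_angle_mul_norm_mul_norm (l - x) (r - x)
  rw [inner_eq] at h2
  rw [pw, ← h2, h1, EuclideanGeometry.angle, Real.sin_sub]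
  simp only [vsub_eq_sub]
  ring

/-- Both expressions vanish at `l` and at `r`, so the polynomial form needs no special treatment of
the end points. -/
theorem mem_segmentOf_iff {Θ : ℝ} (h0 : 0 < Θ) (hπ : Θ < Real.pi) {l r x : Plane} :
    x ∈ segmentOf Θ l r ↔ 0 ≤ cross (r - x) (l - x) ∧ 0 ≤ pw Θ l r x := by
  by_cases hl : x = l
  · subst hl; simp [segmentOf, pw, cross]
  by_cases hr : x = r
  · subst hr; simp [segmentOf, pw, cross]
  have hpos : 0 < ‖l - x‖ * ‖r - x‖ :=
    mul_pos (norm_pos_iff.2 (sub_ne_zero.2 (Ne.symm hl)))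
      (norm_pos_iff.2 (sub_ne_zero.2 (Ne.symm hr)))
  have hle := EuclideanGeometry.angle_le_pi l x r
  have hge := EuclideanGeometry.angle_nonneg l x r
  simp only [segmentOf, Set.mem_ofPred_eq, hl, hr, false_or]
  rw [and_comm]
  refine and_congr_right fun hc => ?_
  rw [pw_eq hc]
  constructor
  · intro h
    exact mul_nonneg hpos.le (Real.sin_nonneg_of_nonneg_of_le_pi (by linarith) (by linarith))
  · intro h
    by_contra hcon
    have := Real.sin_neg_of_neg_of_neg_pi_lt
      (x := EuclideanGeometry.angle l x r - Θ) (by linarith) (by linarith)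
    nlinarith

theorem mem_arc_iff {Θ : ℝ} (h0 : 0 < Θ) (hπ : Θ < Real.pi) {l r x : Plane} :
    x ∈ arc Θ l r ↔ 0 ≤ cross (r - x) (l - x) ∧ pw Θ l r x = 0 := by
  by_cases hl : x = l
  · subst hl; simp [arc, pw, cross]
  by_cases hr : x = r
  · subst hr; simp [arc, pw, cross]
  have hpos : 0 < ‖l - x‖ * ‖r - x‖ :=
    mul_pos (norm_pos_iff.2 (sub_ne_zero.2 (Ne.symm hl)))
      (norm_pos_iff.2 (sub_ne_zero.2 (Ne.symm hr)))
  have hle := EuclideanGeometry.angle_le_pi l x r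
  have hge := EuclideanGeometry.angle_nonneg l x r
  simp only [arc, Set.mem_ofPred_eq, hl, hr, false_or]
  rw [and_comm]
  refine and_congr_right fun hc => ?_
  rw [pw_eq hc]
  constructor
  · intro h
    rw [h, sub_self, Real.sin_zero, mul_zero]
  · intro h
    have := (Real.sin_eq_zero_iff_of_lt_of_lt (x := EuclideanGeometry.angle l x r - Θ)
      (by linarith) (by linarith)).1 ((mul_eq_zero.1 h).resolve_left hpos.ne')
    linarith

end GuardedRegion

/-! ### One-sided limits and first or last crossing times -/

namespace GuardedRegion

open Set

section Limits

variable {f g : ℝ → ℝ} {a b c s : ℝ}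

theorem le_of_forall_Ioo_left (hf : ContinuousOn f (Icc a b)) (hg : ContinuousOn g (Icc a b))
    (hac : a ≤ c) (hcs : c < s) (hsb : s ≤ b) (h : ∀ t ∈ Ioo c s, f t ≤ g t) : f s ≤ g s := by
  have hsub : Ioo c s ⊆ Icc a b := fun t ht => ⟨hac.trans ht.1.le, ht.2.le.trans hsb⟩
  have hs : s ∈ Icc a b := ⟨hac.trans hcs.le, hsb⟩
  exact ContinuousWithinAt.closure_le (by rw [closure_Ioo hcs.ne]; exact right_mem_Icc.2 hcs.le)
    ((hf s hs).mono hsub) ((hg s hs).mono hsub) h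

theorem le_of_forall_Ioo_right (hf : ContinuousOn f (Icc a b)) (hg : ContinuousOn g (Icc a b))
    (has : a ≤ s) (hsc : s < c) (hcb : c ≤ b) (h : ∀ t ∈ Ioo s c, f t ≤ g t) : f s ≤ g s := by
  have hsub : Ioo s c ⊆ Icc a b := fun t ht => ⟨has.trans ht.1.le, ht.2.le.trans hcb⟩
  have hs : s ∈ Icc a b := ⟨has, hsc.le.trans hcb⟩
  exact ContinuousWithinAt.closure_le (by rw [closure_Ioo hsc.ne]; exact left_mem_Icc.2 hsc.le)
    ((hf s hs).mono hsub) ((hg s hs).mono hsub) h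

theorem exists_forall_Ioc_lt (hf : ContinuousOn f (Icc a b)) (hg : ContinuousOn g (Icc a b))
    (has : a < s) (hsb : s ≤ b) (h : f s < g s) :
    ∃ c, a ≤ c ∧ c < s ∧ ∀ t ∈ Ioc c s, f t < g t := by
  have hs : s ∈ Icc a b := ⟨has.le, hsb⟩
  have hsub : Icc a s ⊆ Icc a b := Icc_subset_Icc_right hsb
  have h1 : ∀ᶠ t in 𝓝[Icc a s] s, f t < g t :=
    ((hf s hs).mono hsub).eventually_lt ((hg s hs).mono hsub) h
  rw [nhdsWithin_Icc_eq_nhdsLE has] at h1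
  obtain ⟨c, hc, hc'⟩ := (mem_nhdsLE_iff_exists_Ioc_subset' has).1 h1
  exact ⟨max a c, le_max_left _ _, max_lt has hc,
    fun t ht => hc' ⟨(le_max_right a c).trans_lt ht.1, ht.2⟩⟩

theorem exists_first_le (hf : ContinuousOn f (Icc a b)) (hg : ContinuousOn g (Icc a b))
    (hab : a ≤ b) (ha : f a < g a) (hb : g b ≤ f b) :
    ∃ s ∈ Ioc a b, g s ≤ f s ∧ ∀ t ∈ Ico a s, f t < g t := by
  have hcl : IsClosed {t ∈ Icc a b | g t ≤ f t} := isClosed_Icc.isClosed_le hg hf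
  have hcomp : IsCompact {t ∈ Icc a b | g t ≤ f t} :=
    isCompact_Icc.of_isClosed_subset hcl fun t ht => ht.1
  obtain ⟨s, hs, hs'⟩ := hcomp.exists_isLeast ⟨b, right_mem_Icc.2 hab, hb⟩
  refine ⟨s, ⟨lt_of_le_of_ne hs.1.1 ?_, hs.1.2⟩, hs.2, fun t ht => ?_⟩
  · rintro rfl; exact absurd hs.2 (not_le.2 ha)
  · by_contra hcon
    exact absurd (hs' ⟨⟨ht.1, ht.2.le.trans hs.1.2⟩, not_lt.1 hcon⟩) (not_le.2 ht.2)

theorem exists_last_le (hf : ContinuousOn f (Icc a b)) (hg : ContinuousOn g (Icc a b))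
    (hab : a ≤ b) (ha : g a ≤ f a) (hb : f b < g b) :
    ∃ s ∈ Ico a b, g s ≤ f s ∧ ∀ t ∈ Ioc s b, f t < g t := by
  have hcl : IsClosed {t ∈ Icc a b | g t ≤ f t} := isClosed_Icc.isClosed_le hg hf
  have hcomp : IsCompact {t ∈ Icc a b | g t ≤ f t} :=
    isCompact_Icc.of_isClosed_subset hcl fun t ht => ht.1
  obtain ⟨s, hs, hs'⟩ := hcomp.exists_isGreatest ⟨a, left_mem_Icc.2 hab, ha⟩
  refine ⟨s, ⟨hs.1.1, lt_of_le_of_ne hs.1.2 ?_⟩, hs.2, fun t ht => ?_⟩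
  · rintro rfl; exact absurd hs.2 (not_le.2 hb)
  · by_contra hcon
    exact absurd (hs' ⟨⟨hs.1.1.trans ht.1.le, ht.2⟩, not_lt.1 hcon⟩) (not_le.2 ht.1)

end Limits

/-! ### Sweeps: reflection, persistence of guards, bound on the rotation -/

/-- The motion of a rotating empty cone that touches a guard on each of its two bounding rays and
whose apex avoids the guards at intermediate times. -/
structure IsSweep (G : Finset Plane) (Θ α β : ℝ) (p : ℝ → Plane) : Prop where
  pos : 0 < Θ
  lt_pi : Θ < Real.pi
  cont : ContinuousOn p (Icc α β)
  empty : ∀ φ ∈ Icc α β, ∀ g ∈ G, lc Θ φ g ≤ lc Θ φ (p φ) ∨ rc Θ φ g ≤ rc Θ φ (p φ)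
  left : ∀ φ ∈ Ioo α β, ∃ g ∈ G, lc Θ φ g = lc Θ φ (p φ) ∧ rc Θ φ (p φ) < rc Θ φ g
  right : ∀ φ ∈ Ioo α β, ∃ g ∈ G, rc Θ φ g = rc Θ φ (p φ) ∧ lc Θ φ (p φ) < lc Θ φ g
  notMem : ∀ φ ∈ Ioo α β, p φ ∉ G

/-- The reflection of the plane in the horizontal axis. -/
noncomputable def mirror (x : Plane) : Plane := !₂[x 0, -x 1]

@[simp] theorem mirror_zero (x : Plane) : mirror x 0 = x 0 := by simp [mirror]

@[simp] theorem mirror_one (x : Plane) : mirror x 1 = -x 1 := by simp [mirror]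

@[simp] theorem mirror_mirror (x : Plane) : mirror (mirror x) = x := by
  apply plane_ext <;> simp

theorem lc_mirror (Θ φ : ℝ) (x : Plane) : lc Θ φ (mirror x) = rc Θ (-φ) x := by
  have e : -φ - Θ / 2 = -(φ + Θ / 2) := by ring
  simp only [lc, rc, cross, e, dir_zero, dir_one, mirror_zero, mirror_one, Real.cos_neg,
    Real.sin_neg]
  ring

theorem rc_mirror (Θ φ : ℝ) (x : Plane) : rc Θ φ (mirror x) = lc Θ (-φ) x := by
  have e : -φ + Θ / 2 = -(φ - Θ / 2) := by ring
  simp only [lc, rc, cross, e, dir_zero, dir_one, mirror_zero, mirror_one, Real.cos_neg,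
    Real.sin_neg]
  ring

theorem cross_mirror (x y : Plane) : cross (mirror x) (mirror y) = -cross x y := by
  simp [cross]; ring

theorem mirror_sub (x y : Plane) : mirror (x - y) = mirror x - mirror y := by
  apply plane_ext <;> simp; ring

theorem mirror_injective : Function.Injective mirror :=
  Function.LeftInverse.injective mirror_mirror

theorem continuousOn_mirror_comp_neg {p : ℝ → Plane} {α β : ℝ} (hp : ContinuousOn p (Icc α β)) :
    ContinuousOn (fun φ => mirror (p (-φ))) (Icc (-β) (-α)) := by
  have hq : ContinuousOn (fun φ => p (-φ)) (Icc (-β) (-α)) :=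
    hp.comp continuousOn_neg fun φ hφ => ⟨by linarith [hφ.2], by linarith [hφ.1]⟩
  have hm : Continuous mirror := by
    refine (PiLp.continuous_toLp 2 _).comp (continuous_pi fun i => ?_)
    fin_cases i
    · simp; fun_prop
    · simp; fun_prop
  exact hm.comp_continuousOn hq

theorem mem_image_mirror {G : Finset Plane} {x : Plane} :
    mirror x ∈ G.image mirror ↔ x ∈ G := by
  classical
  exact ⟨fun h => by
    obtain ⟨y, hy, hxy⟩ := Finset.mem_image.1 h
    rwa [← mirror_injective hxy], fun h => Finset.mem_image_of_mem _ h⟩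

namespace IsSweep

variable {G : Finset Plane} {Θ α β : ℝ} {p : ℝ → Plane}

/-- The reflected cone turns in the opposite sense with its rays exchanged. Each statement on the
left ray and later times thereby yields its dual for the right ray and earlier times. -/
theorem mirror (h : IsSweep G Θ α β p) :
    IsSweep (G.image mirror) Θ (-β) (-α) (fun φ => GuardedRegion.mirror (p (-φ))) where
  pos := h.pos
  lt_pi := h.lt_pi
  cont := continuousOn_mirror_comp_neg h.cont
  empty φ hφ g hg := by
    obtain ⟨x, hx, rfl⟩ := Finset.mem_image.1 hg
    rw [lc_mirror, rc_mirror, lc_mirror, rc_mirror]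
    exact (h.empty (-φ) ⟨by linarith [hφ.2], by linarith [hφ.1]⟩ x hx).symm
  left φ hφ := by
    obtain ⟨x, hx, h1, h2⟩ := h.right (-φ) ⟨by linarith [hφ.2], by linarith [hφ.1]⟩
    refine ⟨_, Finset.mem_image_of_mem _ hx, ?_⟩
    rw [lc_mirror, rc_mirror, lc_mirror, rc_mirror]
    exact ⟨h1, h2⟩
  right φ hφ := by
    obtain ⟨x, hx, h1, h2⟩ := h.left (-φ) ⟨by linarith [hφ.2], by linarith [hφ.1]⟩
    refine ⟨_, Finset.mem_image_of_mem _ hx, ?_⟩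
    rw [lc_mirror, rc_mirror, lc_mirror, rc_mirror]
    exact ⟨h1, h2⟩
  notMem φ hφ := by
    rw [mem_image_mirror]
    exact h.notMem (-φ) ⟨by linarith [hφ.2], by linarith [hφ.1]⟩

theorem lcCont (h : IsSweep G Θ α β p) : ContinuousOn (fun φ => lc Θ φ (p φ)) (Icc α β) :=
  continuousOn_lc h.cont

theorem rcCont (h : IsSweep G Θ α β p) : ContinuousOn (fun φ => rc Θ φ (p φ)) (Icc α β) :=
  continuousOn_rc h.cont

theorem sin_pos (h : IsSweep G Θ α β p) : 0 < Real.sin Θ :=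
  Real.sin_pos_of_pos_of_lt_pi h.pos h.lt_pi

theorem lc_le (h : IsSweep G Θ α β p) {φ : ℝ} (hφ : φ ∈ Icc α β) {g : Plane} (hg : g ∈ G)
    (hlt : rc Θ φ (p φ) < rc Θ φ g) : lc Θ φ g ≤ lc Θ φ (p φ) :=
  (h.empty φ hφ g hg).resolve_right (not_le.2 hlt)

theorem rc_le (h : IsSweep G Θ α β p) {φ : ℝ} (hφ : φ ∈ Icc α β) {g : Plane} (hg : g ∈ G)
    (hlt : lc Θ φ (p φ) < lc Θ φ g) : rc Θ φ g ≤ rc Θ φ (p φ) :=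
  (h.empty φ hφ g hg).resolve_left (not_le.2 hlt)

theorem lc_ne (h : IsSweep G Θ α β p) {φ : ℝ} (hφ : φ ∈ Ioo α β) {g : Plane} (hg : g ∈ G)
    (hr : rc Θ φ g = rc Θ φ (p φ)) : lc Θ φ g ≠ lc Θ φ (p φ) := fun hl =>
  h.notMem φ hφ (ext_of_lc_rc h.pos h.lt_pi hl hr ▸ hg)

/-- A guard to the left of the right ray remains there when the cone turns counterclockwise. -/
theorem rc_lt_of_le (h : IsSweep G Θ α β p) {g : Plane} (hg : g ∈ G) {φ' φ : ℝ} (h1 : α ≤ φ')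
    (h2 : φ' ≤ φ) (h3 : φ < β) (hlt : rc Θ φ' (p φ') < rc Θ φ' g) :
    rc Θ φ (p φ) < rc Θ φ g := by
  by_contra hcon
  have hsub : Icc φ' φ ⊆ Icc α β := Icc_subset_Icc h1 h3.le
  obtain ⟨s, ⟨hs1, hs2⟩, hs3, hs4⟩ := exists_first_le (h.rcCont.mono hsub)
    (continuous_rc_const Θ g).continuousOn h2 hlt (not_lt.1 hcon)
  have hsm : s ∈ Ioo α β := ⟨h1.trans_lt hs1, hs2.trans_lt h3⟩
  have hrc : rc Θ s g = rc Θ s (p s) := le_antisymm hs3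
    (le_of_forall_Ioo_left h.rcCont (continuous_rc_const Θ g).continuousOn h1 hs1 hsm.2.le
      fun t ht => (hs4 t ⟨ht.1.le, ht.2⟩).le)
  -- When `g` first reaches the line of the right ray, it lies strictly behind the apex, since
  -- before that it could not be right of the left ray.
  have hlc : lc Θ s g < lc Θ s (p s) := lt_of_le_of_ne
    (le_of_forall_Ioo_left (continuous_lc_const Θ g).continuousOn h.lcCont h1 hs1 hsm.2.le
      fun t ht => h.lc_le ⟨h1.trans ht.1.le, ht.2.le.trans hsm.2.le⟩ hg (hs4 t ⟨ht.1.le, ht.2⟩))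
    (h.lc_ne hsm hg hrc)
  -- A guard `r` on the right ray is ahead of `g` on the same line. Slightly earlier it is left of
  -- `g`, hence left of the right ray, so emptiness keeps it off the right side of the left ray; the
  -- limit at `s` contradicts contact.
  obtain ⟨r, hr, hr1, hr2⟩ := h.right s hsm
  refine absurd (le_of_forall_Ioo_left (continuous_lc_const Θ r).continuousOn h.lcCont
    (c := max φ' (s - Real.pi)) (h1.trans (le_max_left _ _))
    (max_lt hs1 (by linarith [Real.pi_pos])) hsm.2.le fun t ht => ?_) (not_le.2 hr2)
  have ht1 := (le_max_left _ _).trans_lt ht.1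
  have ht2 := (le_max_right _ _).trans_lt ht.1
  refine h.lc_le ⟨h1.trans ht1.le, ht.2.le.trans hsm.2.le⟩ hr ?_
  refine (hs4 t ⟨ht1.le, ht.2⟩).trans ?_
  have hf := frame_rc Θ s t (r - g)
  rw [rc_sub, rc_sub, lc_sub, hrc, hr1, sub_self, zero_mul, zero_add] at hf
  have hsin := Real.sin_pos_of_pos_of_lt_pi (x := s - t) (by linarith [ht.2]) (by linarith)
  have := mul_pos (show 0 < lc Θ s r - lc Θ s g by linarith) hsin
  rw [← hf] at this
  linarith [(pos_iff_pos_of_mul_pos this).1 h.sin_pos]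

theorem lc_lt_of_le (h : IsSweep G Θ α β p) {g : Plane} (hg : g ∈ G) {φ' φ : ℝ} (h1 : φ' ≤ β)
    (h2 : φ ≤ φ') (h3 : α < φ) (hlt : lc Θ φ' (p φ') < lc Θ φ' g) :
    lc Θ φ (p φ) < lc Θ φ g := by
  have := h.mirror.rc_lt_of_le (mem_image_mirror.2 hg) (neg_le_neg h1) (neg_le_neg h2)
    (neg_lt_neg h3) (by simpa [rc_mirror] using hlt)
  simpa [rc_mirror] using this

/-- As long as `g` is left of the right ray, emptiness keeps it from being right of the left ray; a
limit covers `φ = β`. -/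
theorem lc_le_of_rc_lt (h : IsSweep G Θ α β p) {g : Plane} (hg : g ∈ G) {φ' φ : ℝ}
    (h1 : α ≤ φ') (h2 : φ' < φ) (h3 : φ ≤ β) (hlt : rc Θ φ' (p φ') < rc Θ φ' g) :
    lc Θ φ g ≤ lc Θ φ (p φ) := by
  refine le_of_forall_Ioo_left (continuous_lc_const Θ g).continuousOn h.lcCont h1 h2 h3
    fun t ht => ?_
  exact h.lc_le ⟨h1.trans ht.1.le, ht.2.le.trans h3⟩ hg
    (h.rc_lt_of_le hg h1 ht.1.le (ht.2.trans_le h3) hlt)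

/-- A guard that is met by the left ray is to the left of the right ray at all earlier times
within an angle of `π - Θ`. -/
theorem rc_lt_of_touches_left_aux (h : IsSweep G Θ α β p) {l : Plane} (hl : l ∈ G) {φ φ' : ℝ}
    (h1 : α < φ) (h2 : φ < φ') (h3 : φ' ≤ β) (h4 : φ' - φ ≤ Real.pi - Θ)
    (hl1 : lc Θ φ' l = lc Θ φ' (p φ')) (hl2 : rc Θ φ' (p φ') < rc Θ φ' l) :
    rc Θ φ (p φ) < rc Θ φ l := by
  by_contra hcon
  have hsub : Icc φ φ' ⊆ Icc α β := Icc_subset_Icc h1.le h3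
  obtain ⟨s, ⟨hs1, hs2⟩, hs3, hs4⟩ := exists_last_le (h.rcCont.mono hsub)
    (continuous_rc_const Θ l).continuousOn h2.le (not_lt.1 hcon) hl2
  have hsm : s ∈ Ioo α β := ⟨h1.trans_le hs1, hs2.trans_le h3⟩
  have hlc : lc Θ s l ≤ lc Θ s (p s) :=
    le_of_forall_Ioo_right (continuous_lc_const Θ l).continuousOn h.lcCont hsm.1.le hs2 h3
      fun t ht => h.lc_le ⟨hsm.1.le.trans ht.1.le, ht.2.le.trans h3⟩ hl (hs4 t ⟨ht.1, ht.2.le⟩)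
  -- At the last bad time `s` the guard `k` is on the left ray, while `l` is behind it in both
  -- coordinates. Turning to `φ'` leaves `l` strictly to the left of `k`, which is itself not right
  -- of the left ray, so `l` cannot be on that ray.
  obtain ⟨k, hk, hk1, hk2⟩ := h.left s hsm
  have hk3 := h.lc_le_of_rc_lt hk hsm.1.le hs2 h3 hk2
  have hf := frame_lc Θ s φ' (l - k)
  rw [lc_sub, lc_sub, rc_sub] at hf
  have hsin1 := Real.sin_pos_of_pos_of_lt_pi (x := φ' - s) (by linarith) (by linarith [h.pos])
  -- The bound `φ' - φ ≤ π - Θ` is needed for this sign; it is removed once `sub_le` is available.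
  have hsin2 := Real.sin_nonneg_of_nonneg_of_le_pi (x := φ' - s + Θ) (by linarith [h.pos])
    (by linarith)
  have e1 := mul_pos (show 0 < rc Θ s k - rc Θ s l by linarith) hsin1
  have e2 := mul_nonneg (show 0 ≤ lc Θ s k - lc Θ s l by linarith) hsin2
  have e3 := mul_nonneg h.sin_pos.le (show 0 ≤ lc Θ φ' l - lc Θ φ' k by linarith)
  linarith

theorem lc_lt_of_touches_right_aux (h : IsSweep G Θ α β p) {r : Plane} (hr : r ∈ G) {φ φ' : ℝ}
    (h1 : φ < β) (h2 : φ' < φ) (h3 : α ≤ φ') (h4 : φ - φ' ≤ Real.pi - Θ)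
    (hr1 : rc Θ φ' r = rc Θ φ' (p φ')) (hr2 : lc Θ φ' (p φ') < lc Θ φ' r) :
    lc Θ φ (p φ) < lc Θ φ r := by
  have := h.mirror.rc_lt_of_touches_left_aux (mem_image_mirror.2 hr) (neg_lt_neg h1)
    (neg_lt_neg h2) (neg_le_neg h3) (by linarith) (by simpa [lc_mirror] using hr1)
    (by simpa [rc_mirror] using hr2)
  simpa [rc_mirror] using this

/-- After a turn by `π - Θ` the left ray points opposite to the old right ray. -/
theorem lc_add_pi_sub (Θ φ : ℝ) (x : Plane) : lc Θ (φ + (Real.pi - Θ)) x = rc Θ φ x := by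
  have e : φ + (Real.pi - Θ) + Θ / 2 = (φ - Θ / 2) + Real.pi := by ring
  simp [lc, rc, cross, e, Real.cos_add_pi, Real.sin_add_pi]; ring

/-- The total rotation of a sweep is bounded. -/
theorem sub_lt (h : IsSweep G Θ α β p) {φ₁ φ₂ : ℝ} (h1 : α < φ₁) (h2 : φ₂ < β)
    (h12 : φ₁ < φ₂) : φ₂ - φ₁ < Real.pi - Θ := by
  by_contra hcon
  have hφ : φ₁ < φ₁ + (Real.pi - Θ) := by linarith [h.lt_pi]
  have hle : φ₁ + (Real.pi - Θ) ≤ φ₂ := by linarith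
  obtain ⟨l, hl, hl1, hl2⟩ := h.left φ₁ ⟨h1, h12.trans h2⟩
  obtain ⟨r, hr, hr1, hr2⟩ := h.right φ₁ ⟨h1, h12.trans h2⟩
  have e1 := h.lc_le_of_rc_lt hl h1.le hφ (hle.trans h2.le) hl2
  have e2 := h.lc_lt_of_touches_right_aux hr (hle.trans_lt h2) hφ h1.le (by linarith) hr1 hr2
  -- In terms of `rc` at `φ₁`, the value of `l` is at most the coordinate of the later apex, which
  -- is below the value of `r`. But initially `r` is on the right ray and `l` strictly left of it.
  rw [lc_add_pi_sub] at e1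
  rw [lc_add_pi_sub Θ φ₁ r] at e2
  linarith

theorem sub_le (h : IsSweep G Θ α β p) {φ₁ φ₂ : ℝ} (h1 : α ≤ φ₁) (h2 : φ₂ ≤ β)
    (h12 : φ₁ < φ₂) : φ₂ - φ₁ ≤ Real.pi - Θ := by
  by_contra hcon
  -- Cutting `ε` off both ends moves into the open interval, keeps the order of the ends and loses
  -- at most half of the excess over `π - Θ`.
  set ε := min ((φ₂ - φ₁) - (Real.pi - Θ)) (φ₂ - φ₁) / 4 with hε
  have e0 : 0 < min ((φ₂ - φ₁) - (Real.pi - Θ)) (φ₂ - φ₁) := lt_min (by linarith) (by linarith)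
  have e1 := min_le_left ((φ₂ - φ₁) - (Real.pi - Θ)) (φ₂ - φ₁)
  have e2 := min_le_right ((φ₂ - φ₁) - (Real.pi - Θ)) (φ₂ - φ₁)
  have := h.sub_lt (φ₁ := φ₁ + ε) (φ₂ := φ₂ - ε) (by linarith) (by linarith) (by linarith)
  linarith

theorem rc_lt_of_touches_left (h : IsSweep G Θ α β p) {l : Plane} (hl : l ∈ G) {φ φ' : ℝ}
    (h1 : α < φ) (h2 : φ < φ') (h3 : φ' ≤ β)
    (hl1 : lc Θ φ' l = lc Θ φ' (p φ')) (hl2 : rc Θ φ' (p φ') < rc Θ φ' l) :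
    rc Θ φ (p φ) < rc Θ φ l :=
  h.rc_lt_of_touches_left_aux hl h1 h2 h3 (h.sub_le h1.le h3 h2) hl1 hl2

end IsSweep

end GuardedRegion

/-! ### The apex path lies in the set of its tunnel -/

namespace GuardedRegion

open Set

theorem pw_mirror (Θ : ℝ) (l r x : Plane) :
    pw Θ (mirror l) (mirror r) (mirror x) = pw Θ r l x := by
  simp [pw, cross]; ring

/-- If `l` is on or beyond the left ray and `r` on or beyond the right ray of a cone with apex `x`,
then the angle `l x r` is at least `Θ`, provided it does not exceed `π`; the proviso is the sign of
`cross`. -/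
theorem pw_nonneg_of_cross_nonneg {Θ φ : ℝ} (h0 : 0 < Θ) (hπ : Θ < Real.pi) {l r x : Plane}
    (h1 : lc Θ φ l ≤ lc Θ φ x) (h2 : rc Θ φ r ≤ rc Θ φ x) (h3 : lc Θ φ x ≤ lc Θ φ r)
    (h4 : rc Θ φ x ≤ rc Θ φ l) (h5 : 0 ≤ cross (r - x) (l - x)) : 0 ≤ pw Θ l r x := by
  have hs := Real.sin_pos_of_pos_of_lt_pi h0 hπ
  have e1 := frame_pw Θ φ l r x
  have e2 := frame_cross Θ φ (r - x) (l - x)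
  have e3 := mul_nonneg hs.le h5
  simp only [lc_sub, rc_sub] at e1 e2
  have hc := Real.cos_le_one Θ
  obtain ⟨a, ha⟩ : ∃ a, a = lc Θ φ x - lc Θ φ l := ⟨_, rfl⟩
  obtain ⟨b, hb⟩ : ∃ b, b = rc Θ φ x - rc Θ φ r := ⟨_, rfl⟩
  obtain ⟨A, hA⟩ : ∃ A, A = lc Θ φ r - lc Θ φ x := ⟨_, rfl⟩
  obtain ⟨B, hB⟩ : ∃ B, B = rc Θ φ l - rc Θ φ x := ⟨_, rfl⟩
  rw [← hA, ← hB, show lc Θ φ l - lc Θ φ x = -a by rw [ha]; ring,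
    show rc Θ φ r - rc Θ φ x = -b by rw [hb]; ring] at e1 e2
  have ha0 : 0 ≤ a := by linarith
  have hb0 : 0 ≤ b := by linarith
  have hA0 : 0 ≤ A := by linarith
  have hB0 : 0 ≤ B := by linarith
  have hab : 0 ≤ a * b := mul_nonneg ha0 hb0
  have e4 : a * b ≤ A * B := by linarith
  -- The arithmetic-geometric mean inequality for `a * A` and `b * B`, combined with `a * b ≤ A *
  -- B`.
  have e5 : 2 * (a * b) ≤ a * A + B * b := by
    apply le_of_sq_le_sq _ (by positivity)
    nlinarith [sq_nonneg (a * A - B * b), mul_le_mul_of_nonneg_left e4 hab]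
  have e6 : 0 ≤ Real.sin Θ * pw Θ l r x := by
    rw [e1]; nlinarith [mul_nonneg hab (sub_nonneg.2 hc)]
  exact nonneg_of_mul_nonneg_right e6 hs

namespace IsSweep

variable {G : Finset Plane} {Θ α β : ℝ} {p : ℝ → Plane}

/-- Since `G` is finite, one guard is touched at times accumulating at `s`. Contact passes to the
limit, but only weakly: at `s = α` the guard may coincide with the apex. -/
theorem exists_frequently_left_nhdsGT (h : IsSweep G Θ α β p) {s : ℝ} (h1 : α ≤ s)
    (h2 : s < β) : ∃ g ∈ G, (∃ᶠ φ in 𝓝[>] s, φ ∈ Ioo s β ∧ lc Θ φ g = lc Θ φ (p φ) ∧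
      rc Θ φ (p φ) < rc Θ φ g) ∧ lc Θ s g = lc Θ s (p s) ∧ rc Θ s (p s) ≤ rc Θ s g := by
  have hIoo : ∀ᶠ φ in 𝓝[>] s, φ ∈ Ioo s β := Ioo_mem_nhdsGT h2
  obtain ⟨g, hg, hf⟩ : ∃ g ∈ G, ∃ᶠ φ in 𝓝[>] s, φ ∈ Ioo s β ∧ lc Θ φ g = lc Θ φ (p φ) ∧
      rc Θ φ (p φ) < rc Θ φ g := by
    by_contra hcon
    push Not at hcon
    have := (Filter.eventually_all_finset G).2 fun g hg => hcon g hg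
    obtain ⟨φ, h3, h4⟩ := (this.and hIoo).exists
    obtain ⟨g, hg, hg1, hg2⟩ := h.left φ ⟨h1.trans_lt h4.1, h4.2⟩
    exact absurd hg2 (not_lt.2 (h3 g hg h4 hg1))
  have hle : 𝓝[>] s ≤ 𝓝[Icc α β] s := by
    rw [← nhdsWithin_Ioo_eq_nhdsGT h2]
    exact nhdsWithin_mono _ fun t ht => ⟨h1.trans ht.1.le, ht.2.le⟩
  have hsm : s ∈ Icc α β := ⟨h1, h2.le⟩
  refine ⟨g, hg, hf, tendsto_nhds_unique_of_frequently_eq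
    (((continuous_lc_const Θ g).tendsto s).mono_left nhdsWithin_le_nhds)
    ((h.lcCont s hsm).mono_left hle) (hf.mono fun φ hφ => hφ.2.1), ?_⟩
  exact le_of_tendsto_of_tendsto_of_frequently ((h.rcCont s hsm).mono_left hle)
    (((continuous_rc_const Θ g).tendsto s).mono_left nhdsWithin_le_nhds)
    (hf.mono fun φ hφ => hφ.2.2.le)

theorem exists_frequently_right_nhdsGT (h : IsSweep G Θ α β p) {s : ℝ} (h1 : α ≤ s)
    (h2 : s < β) : ∃ g ∈ G, (∃ᶠ φ in 𝓝[>] s, φ ∈ Ioo s β ∧ rc Θ φ g = rc Θ φ (p φ) ∧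
      lc Θ φ (p φ) < lc Θ φ g) ∧ rc Θ s g = rc Θ s (p s) ∧ lc Θ s (p s) ≤ lc Θ s g := by
  have hIoo : ∀ᶠ φ in 𝓝[>] s, φ ∈ Ioo s β := Ioo_mem_nhdsGT h2
  obtain ⟨g, hg, hf⟩ : ∃ g ∈ G, ∃ᶠ φ in 𝓝[>] s, φ ∈ Ioo s β ∧ rc Θ φ g = rc Θ φ (p φ) ∧
      lc Θ φ (p φ) < lc Θ φ g := by
    by_contra hcon
    push Not at hcon
    have := (Filter.eventually_all_finset G).2 fun g hg => hcon g hg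
    obtain ⟨φ, h3, h4⟩ := (this.and hIoo).exists
    obtain ⟨g, hg, hg1, hg2⟩ := h.right φ ⟨h1.trans_lt h4.1, h4.2⟩
    exact absurd hg2 (not_lt.2 (h3 g hg h4 hg1))
  have hle : 𝓝[>] s ≤ 𝓝[Icc α β] s := by
    rw [← nhdsWithin_Ioo_eq_nhdsGT h2]
    exact nhdsWithin_mono _ fun t ht => ⟨h1.trans ht.1.le, ht.2.le⟩
  have hsm : s ∈ Icc α β := ⟨h1, h2.le⟩
  refine ⟨g, hg, hf, tendsto_nhds_unique_of_frequently_eq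
    (((continuous_rc_const Θ g).tendsto s).mono_left nhdsWithin_le_nhds)
    ((h.rcCont s hsm).mono_left hle) (hf.mono fun φ hφ => hφ.2.1), ?_⟩
  exact le_of_tendsto_of_tendsto_of_frequently ((h.lcCont s hsm).mono_left hle)
    (((continuous_lc_const Θ g).tendsto s).mono_left nhdsWithin_le_nhds)
    (hf.mono fun φ hφ => hφ.2.2.le)

/-- A guard right of the left ray at `φ` was so at all earlier times. But just after `α` the left
ray touches a guard `l` that was ahead of `p α` on the initial left ray, and the turn puts `p α` to
the left of `l`. -/
theorem lc_start_le (h : IsSweep G Θ α β p) (hα : p α ∈ G) {φ : ℝ} (hφ : φ ∈ Ioo α β) :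
    lc Θ φ (p α) ≤ lc Θ φ (p φ) := by
  by_contra hcon
  obtain ⟨l, hl, hf, hl1, hl2⟩ := h.exists_frequently_left_nhdsGT le_rfl (hφ.1.trans hφ.2)
  have hev : ∀ᶠ t in 𝓝[>] α, t ∈ Ioo α (min φ (α + Real.pi)) :=
    Ioo_mem_nhdsGT (lt_min hφ.1 (by linarith [Real.pi_pos]))
  obtain ⟨t, ⟨ht1, ht2, ht3⟩, ht4⟩ := (hf.and_eventually hev).exists
  have ht5 := ht4.2.trans_le (min_le_left _ _)
  have ht6 := ht4.2.trans_le (min_le_right _ _)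
  have e1 := h.lc_lt_of_le hα hφ.2.le ht5.le ht4.1 (not_le.1 hcon)
  have hne : rc Θ α (p α) < rc Θ α l := by
    refine lt_of_le_of_ne hl2 fun he => ?_
    rw [ext_of_lc_rc h.pos h.lt_pi hl1 he.symm] at ht2
    linarith
  have e2 := frame_lc Θ α t (l - p α)
  rw [lc_sub, lc_sub, rc_sub, hl1, sub_self, zero_mul, add_zero] at e2
  have e3 := mul_pos (sub_pos.2 hne)
    (Real.sin_pos_of_pos_of_lt_pi (x := t - α) (by linarith [ht4.1]) (by linarith))
  have e4 := mul_pos h.sin_pos (show 0 < lc Θ t (p α) - lc Θ t l by linarith)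
  linarith

/-- The guard at which the clockwise motion ends lies to the left of the right ray. -/
theorem rc_lt_start (h : IsSweep G Θ α β p) (hα : p α ∈ G) {φ : ℝ} (hφ : φ ∈ Ioo α β) :
    rc Θ φ (p φ) < rc Θ φ (p α) := by
  by_contra hcon
  obtain ⟨r, hr, hf, hr1, hr2⟩ := h.exists_frequently_right_nhdsGT le_rfl (hφ.1.trans hφ.2)
  have hev : ∀ᶠ t in 𝓝[>] α, t ∈ Ioo α (min φ (α + Real.pi)) :=
    Ioo_mem_nhdsGT (lt_min hφ.1 (by linarith [Real.pi_pos]))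
  obtain ⟨t, ⟨ht1, ht2, ht3⟩, ht4⟩ := (hf.and_eventually hev).exists
  have ht5 := ht4.2.trans_le (min_le_left _ _)
  have ht6 := ht4.2.trans_le (min_le_right _ _)
  have e0 := h.lc_start_le hα ht1
  have e1 : rc Θ t (p α) ≤ rc Θ t (p t) := by
    by_contra hc
    exact hcon (h.rc_lt_of_le hα ht4.1.le ht5.le hφ.2 (not_le.1 hc))
  have hne : lc Θ α (p α) < lc Θ α r := by
    refine lt_of_le_of_ne hr2 fun he => ?_
    rw [ext_of_lc_rc h.pos h.lt_pi he.symm hr1] at ht3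
    linarith
  have e2 := frame_rc Θ α t (r - p α)
  rw [lc_sub, rc_sub, rc_sub, hr1, sub_self, zero_mul, zero_add] at e2
  have e3 := mul_pos (sub_pos.2 hne)
    (Real.sin_pos_of_pos_of_lt_pi (x := t - α) (by linarith [ht4.1]) (by linarith))
  rw [show α - t = -(t - α) by ring, Real.sin_neg] at e2
  have e4 := mul_nonneg h.sin_pos.le (show 0 ≤ rc Θ t r - rc Θ t (p α) by linarith)
  linarith

/-- A guard touched by the left ray at `φ₁` separates the two apexes: the turn gives it a larger
`lc` than the old apex, and emptiness gives it at most the `lc` of the new one. -/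
theorem lc_apex_lt (h : IsSweep G Θ α β p) {φ₁ φ₂ : ℝ} (h1 : α < φ₁) (h12 : φ₁ < φ₂)
    (h2 : φ₂ ≤ β) : lc Θ φ₂ (p φ₁) < lc Θ φ₂ (p φ₂) := by
  obtain ⟨l, hl, hl1, hl2⟩ := h.left φ₁ ⟨h1, h12.trans_le h2⟩
  have e1 := h.lc_le_of_rc_lt hl h1.le h12 h2 hl2
  have e2 := frame_lc Θ φ₁ φ₂ (l - p φ₁)
  rw [lc_sub, lc_sub, rc_sub, hl1, sub_self, zero_mul, add_zero] at e2
  have e3 := mul_pos (sub_pos.2 hl2) (Real.sin_pos_of_pos_of_lt_pi (x := φ₂ - φ₁)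
    (by linarith) (by linarith [h.sub_le h1.le h2 h12, h.pos]))
  rw [← e2] at e3
  linarith [(pos_iff_pos_of_mul_pos e3).1 h.sin_pos]

theorem rc_apex_lt (h : IsSweep G Θ α β p) {φ₁ φ₂ : ℝ} (h1 : α ≤ φ₁) (h12 : φ₁ < φ₂)
    (h2 : φ₂ < β) : rc Θ φ₁ (p φ₂) < rc Θ φ₁ (p φ₁) := by
  simpa [lc_mirror] using h.mirror.lc_apex_lt (neg_lt_neg h2) (neg_lt_neg h12) (neg_le_neg h1)

theorem continuousOn_lc_apex (h : IsSweep G Θ α β p) (φ : ℝ) :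
    ContinuousOn (fun t => lc Θ φ (p t)) (Icc α β) := by
  have h0 : ContinuousOn (fun φ => p φ 0) (Icc α β) := by have := h.cont; fun_prop
  have h1 : ContinuousOn (fun φ => p φ 1) (Icc α β) := by have := h.cont; fun_prop
  simp only [lc, cross, dir_zero, dir_one]
  exact (h0.mul continuousOn_const).sub (h1.mul continuousOn_const)

theorem lc_apex_le (h : IsSweep G Θ α β p) {φ₁ φ₂ : ℝ} (h1 : α ≤ φ₁) (h12 : φ₁ < φ₂)
    (h2 : φ₂ ≤ β) : lc Θ φ₂ (p φ₁) ≤ lc Θ φ₂ (p φ₂) :=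
  le_of_forall_Ioo_right (h.continuousOn_lc_apex φ₂) continuousOn_const h1 h12 h2
    fun _ ht => (h.lc_apex_lt (h1.trans_lt ht.1) ht.2 h2).le

theorem rc_apex_le (h : IsSweep G Θ α β p) {φ₁ φ₂ : ℝ} (h1 : α ≤ φ₁) (h12 : φ₁ < φ₂)
    (h2 : φ₂ ≤ β) : rc Θ φ₁ (p φ₂) ≤ rc Θ φ₁ (p φ₁) := by
  simpa [lc_mirror] using h.mirror.lc_apex_le (neg_le_neg h2) (neg_lt_neg h12) (neg_le_neg h1)

/-- The same displacement of the apex, read in the frame of the earlier direction. -/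
theorem lc_apex_lt' (h : IsSweep G Θ α β p) {φ₁ φ₂ : ℝ} (h1 : α < φ₁) (h12 : φ₁ < φ₂)
    (h2 : φ₂ ≤ β) : lc Θ φ₁ (p φ₁) < lc Θ φ₁ (p φ₂) := by
  have e1 := h.lc_apex_lt h1 h12 h2
  have e2 := h.rc_apex_le h1.le h12 h2
  have e3 := frame_lc Θ φ₁ φ₂ (p φ₂ - p φ₁)
  rw [lc_sub, lc_sub, rc_sub] at e3
  have hle := h.sub_le h1.le h2 h12
  have e4 := mul_nonneg (sub_nonneg.2 e2) (Real.sin_pos_of_pos_of_lt_pi (x := φ₂ - φ₁)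
    (by linarith) (by linarith [h.pos])).le
  have e5 := mul_pos h.sin_pos (sub_pos.2 e1)
  have e6 : 0 < (lc Θ φ₁ (p φ₂) - lc Θ φ₁ (p φ₁)) * Real.sin (φ₂ - φ₁ + Θ) := by linarith
  have e7 := Real.sin_nonneg_of_nonneg_of_le_pi (x := φ₂ - φ₁ + Θ) (by linarith [h.pos])
    (by linarith)
  linarith [pos_of_mul_pos_left e6 e7]

theorem rc_apex_lt' (h : IsSweep G Θ α β p) {φ₁ φ₂ : ℝ} (h1 : α ≤ φ₁) (h12 : φ₁ < φ₂)
    (h2 : φ₂ < β) : rc Θ φ₂ (p φ₂) < rc Θ φ₂ (p φ₁) := by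
  simpa [lc_mirror] using h.mirror.lc_apex_lt' (neg_lt_neg h2) (neg_lt_neg h12) (neg_le_neg h1)

theorem lc_apex_le' (h : IsSweep G Θ α β p) {φ₁ φ₂ : ℝ} (h1 : α ≤ φ₁) (h12 : φ₁ < φ₂)
    (h2 : φ₂ ≤ β) : lc Θ φ₁ (p φ₁) ≤ lc Θ φ₁ (p φ₂) :=
  le_of_forall_Ioo_right h.lcCont (continuous_lc_const Θ _).continuousOn h1 h12 h2
    fun _ ht => (h.lc_apex_lt' (h1.trans_lt ht.1) ht.2 h2).le

theorem injOn (h : IsSweep G Θ α β p) : InjOn p (Ioo α β) := by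
  intro s hs t ht he
  by_contra hne
  rcases lt_or_gt_of_ne hne with hlt | hlt
  · exact absurd (h.lc_apex_lt hs.1 hlt ht.2.le) (by rw [he]; exact lt_irrefl _)
  · exact absurd (h.lc_apex_lt ht.1 hlt hs.2.le) (by rw [he]; exact lt_irrefl _)

/-- The apex lies below the line through a guard on the left ray at a later time and a guard on
the right-hand side. -/
theorem cross_nonneg_before (h : IsSweep G Θ α β p) {l r : Plane} (hl : l ∈ G) {φ φ' : ℝ}
    (h1 : α < φ) (h2 : φ < φ') (h3 : φ' ≤ β) (hl1 : lc Θ φ' l = lc Θ φ' (p φ'))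
    (hl2 : rc Θ φ' (p φ') < rc Θ φ' l) (hr1 : lc Θ φ (p φ) < lc Θ φ r)
    (hr2 : lc Θ φ' (p φ') ≤ lc Θ φ' r) : 0 ≤ cross (r - p φ) (l - p φ) := by
  by_contra hcon
  have hs := h.sin_pos
  have e0 := h.lc_le ⟨h1.le, h2.le.trans h3⟩ hl (h.rc_lt_of_touches_left hl h1 h2 h3 hl1 hl2)
  have e1 := h.lc_apex_lt h1 h2 h3
  have e2 := h.lc_apex_lt' h1 h2 h3
  have f1 := frame_cross Θ φ' (p φ' - p φ) (l - p φ')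
  have f2 := frame_cross Θ φ' (r - p φ') (l - p φ')
  simp only [lc_sub, rc_sub, hl1, sub_self, mul_zero, sub_zero] at f1 f2
  have g1 : 0 < cross (p φ' - p φ) (l - p φ') := by
    have := mul_pos (sub_pos.2 e1) (sub_pos.2 hl2)
    rw [← f1] at this
    exact (pos_iff_pos_of_mul_pos this).1 hs
  have g2 : 0 ≤ cross (r - p φ') (l - p φ') := by
    have := mul_nonneg (sub_nonneg.2 hr2) (sub_pos.2 hl2).le
    rw [← f2] at this
    exact nonneg_of_mul_nonneg_right this hs
  have g3 : cross (p φ' - p φ) (l - p φ') = cross (p φ' - p φ) (l - p φ) := by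
    simp [cross]; ring
  have g4 : cross (r - p φ') (l - p φ') = cross (r - p φ) (l - p φ)
      + cross (p φ' - p φ) (r - p φ) - cross (p φ' - p φ) (l - p φ) := by
    simp [cross]; ring
  -- The linear relation between the vectors from `p φ` to `p φ'`, `l` and `r`, evaluated by `lc`.
  -- Its left side is nonpositive and its right side positive.
  have g5 : cross (p φ' - p φ) (r - p φ) * lc Θ φ (l - p φ)
      = -cross (r - p φ) (l - p φ) * lc Θ φ (p φ' - p φ)
        + cross (p φ' - p φ) (l - p φ) * lc Θ φ (r - p φ) := by
    simp [cross, lc]; ring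
  rw [lc_sub, lc_sub, lc_sub] at g5
  have g6 : 0 < cross (p φ' - p φ) (r - p φ) := by linarith
  have g7 := mul_nonneg g6.le (sub_nonneg.2 e0)
  have g8 := mul_pos (show 0 < -cross (r - p φ) (l - p φ) by linarith) (sub_pos.2 e2)
  have g9 := mul_pos (g3 ▸ g1) (sub_pos.2 hr1)
  linarith

theorem cross_nonneg_after (h : IsSweep G Θ α β p) {l r : Plane} (hr : r ∈ G) {φ φ' : ℝ}
    (h1 : φ < β) (h2 : φ' < φ) (h3 : α ≤ φ') (hr1 : rc Θ φ' r = rc Θ φ' (p φ'))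
    (hr2 : lc Θ φ' (p φ') < lc Θ φ' r) (hl1 : rc Θ φ (p φ) < rc Θ φ l)
    (hl2 : rc Θ φ' (p φ') ≤ rc Θ φ' l) : 0 ≤ cross (r - p φ) (l - p φ) := by
  have := h.mirror.cross_nonneg_before (r := GuardedRegion.mirror l) (mem_image_mirror.2 hr)
    (neg_lt_neg h1) (neg_lt_neg h2) (neg_le_neg h3) (by simpa [lc_mirror] using hr1)
    (by simpa [rc_mirror] using hr2) (by simpa [lc_mirror] using hl1)
    (by simpa [lc_mirror] using hl2)
  simp only [neg_neg, ← mirror_sub, cross_mirror] at this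
  refine this.trans_eq ?_
  simp [cross]; ring

/-- For a pair in contact at `φ'` this says that the earlier apex lies inside the circle on which a
cone turning about that pair would move; `pw_nonneg_after` treats later apexes. -/
theorem pw_nonneg_before (h : IsSweep G Θ α β p) {l r : Plane} (hl : l ∈ G) (hr : r ∈ G)
    {φ φ' : ℝ} (h1 : α < φ) (h2 : φ < φ') (h3 : φ' < β) (hl1 : lc Θ φ' l = lc Θ φ' (p φ'))
    (hl2 : rc Θ φ' (p φ') < rc Θ φ' l) (hr2 : lc Θ φ' (p φ') < lc Θ φ' r) :
    0 ≤ pw Θ l r (p φ) := by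
  have hφ : φ ∈ Icc α β := ⟨h1.le, (h2.trans h3).le⟩
  have e1 := h.lc_lt_of_le hr h3.le h2.le h1 hr2
  have e2 := h.rc_lt_of_touches_left hl h1 h2 h3.le hl1 hl2
  exact pw_nonneg_of_cross_nonneg h.pos h.lt_pi (h.lc_le hφ hl e2) (h.rc_le hφ hr e1) e1.le e2.le
    (h.cross_nonneg_before hl h1 h2 h3.le hl1 hl2 e1 hr2.le)

theorem pw_nonneg_after (h : IsSweep G Θ α β p) {l r : Plane} (hl : l ∈ G) (hr : r ∈ G)
    {φ φ' : ℝ} (h1 : φ < β) (h2 : φ' < φ) (h3 : α < φ') (hr1 : rc Θ φ' r = rc Θ φ' (p φ'))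
    (hr2 : lc Θ φ' (p φ') < lc Θ φ' r) (hl2 : rc Θ φ' (p φ') < rc Θ φ' l) :
    0 ≤ pw Θ l r (p φ) := by
  have := h.mirror.pw_nonneg_before (mem_image_mirror.2 hr) (mem_image_mirror.2 hl)
    (neg_lt_neg h1) (neg_lt_neg h2) (neg_lt_neg h3) (by simpa [lc_mirror] using hr1)
    (by simpa [rc_mirror] using hr2) (by simpa [lc_mirror] using hl2)
  simpa [pw_mirror] using this

/-- The apex runs on a convex curve. -/
theorem cross_apex_nonneg_of_mem_Ioo (h : IsSweep G Θ α β p) {φ₁ φ φ₂ : ℝ} (h1 : α < φ₁)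
    (h2 : φ₁ < φ) (h3 : φ < φ₂) (h4 : φ₂ < β) : 0 ≤ cross (p φ₂ - p φ) (p φ₁ - p φ) := by
  have hs := h.sin_pos
  obtain ⟨l, hl, hl1, hl2⟩ := h.left φ ⟨h1.trans h2, h3.trans h4⟩
  obtain ⟨r, hr, hr1, hr2⟩ := h.right φ ⟨h1.trans h2, h3.trans h4⟩
  -- A point of the disk lies on the inner side of the tangent at `p φ`. The linear form is that of
  -- the tangent; the discarded quadratic part of `pw` is a positive semidefinite form.
  have key : ∀ q, 0 ≤ pw Θ l r q → 0 ≤ (lc Θ φ r - lc Θ φ (p φ)) * (lc Θ φ q - lc Θ φ (p φ))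
      + (rc Θ φ l - rc Θ φ (p φ)) * (rc Θ φ q - rc Θ φ (p φ)) := by
    intro q hq
    have e1 := frame_pw Θ φ l r q
    have e2 := mul_nonneg hs.le hq
    simp only [lc_sub, rc_sub, hl1, hr1] at e1
    have hc1 := Real.cos_le_one Θ
    have hc2 := Real.neg_one_le_cos Θ
    obtain ⟨A, hA⟩ : ∃ A, A = lc Θ φ q - lc Θ φ (p φ) := ⟨_, rfl⟩
    obtain ⟨B, hB⟩ : ∃ B, B = rc Θ φ q - rc Θ φ (p φ) := ⟨_, rfl⟩
    have e3 : 0 ≤ A ^ 2 + B ^ 2 + 2 * Real.cos Θ * (A * B) := by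
      nlinarith [mul_nonneg (sub_nonneg.2 hc1) (sq_nonneg (A - B)),
        mul_nonneg (show 0 ≤ 1 + Real.cos Θ by linarith) (sq_nonneg (A + B))]
    rw [← hA, ← hB]
    rw [hA, hB] at e3 ⊢
    nlinarith
  have k1 := key _ (h.pw_nonneg_before hl hr h1 h2 (h3.trans h4) hl1 hl2 hr2)
  have k2 := key _ (h.pw_nonneg_after hl hr h4 h3 (h1.trans h2) hr1 hr2 hl2)
  have f := frame_cross Θ φ (p φ₂ - p φ) (p φ₁ - p φ)
  simp only [lc_sub, rc_sub] at f
  have a1 := h.rc_apex_lt' h1.le h2 (h3.trans h4)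
  have a3 := h.rc_apex_lt (h1.trans h2).le h3 h4
  have m1 := mul_nonneg k1 (sub_pos.2 a3).le
  have m2 := mul_nonneg k2 (sub_pos.2 a1).le
  have m3 : 0 ≤ (lc Θ φ r - lc Θ φ (p φ)) * (Real.sin Θ * cross (p φ₂ - p φ) (p φ₁ - p φ)) := by
    rw [f]; nlinarith
  exact nonneg_of_mul_nonneg_right (nonneg_of_mul_nonneg_right m3 (sub_pos.2 hr2)) hs

theorem continuousOn_cross_left (h : IsSweep G Θ α β p) (u v w : Plane) :
    ContinuousOn (fun t => cross (p t - u) (v - w)) (Icc α β) := by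
  have h0 : ContinuousOn (fun φ => p φ 0) (Icc α β) := by have := h.cont; fun_prop
  have h1 : ContinuousOn (fun φ => p φ 1) (Icc α β) := by have := h.cont; fun_prop
  simp only [cross, PiLp.sub_apply]
  fun_prop

theorem continuousOn_cross_right (h : IsSweep G Θ α β p) (u v w : Plane) :
    ContinuousOn (fun t => cross (v - w) (p t - u)) (Icc α β) := by
  have h0 : ContinuousOn (fun φ => p φ 0) (Icc α β) := by have := h.cont; fun_prop
  have h1 : ContinuousOn (fun φ => p φ 1) (Icc α β) := by have := h.cont; fun_prop
  simp only [cross, PiLp.sub_apply]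
  fun_prop

theorem cross_apex_nonneg (h : IsSweep G Θ α β p) {φ₁ φ φ₂ : ℝ} (h1 : α ≤ φ₁)
    (h2 : φ₁ < φ) (h3 : φ < φ₂) (h4 : φ₂ ≤ β) : 0 ≤ cross (p φ₂ - p φ) (p φ₁ - p φ) := by
  refine le_of_forall_Ioo_right (f := fun _ => 0) (g := fun t => cross (p φ₂ - p φ) (p t - p φ))
    continuousOn_const (h.continuousOn_cross_right _ _ _) h1 h2 (h3.le.trans h4) fun t ht => ?_
  refine le_of_forall_Ioo_left (f := fun _ => 0) (g := fun s => cross (p s - p φ) (p t - p φ))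
    continuousOn_const (h.continuousOn_cross_left _ _ _) (h1.trans h2.le) h3 h4 fun s hs => ?_
  exact h.cross_apex_nonneg_of_mem_Ioo (h1.trans_lt ht.1) ht.2 hs.1 (hs.2.trans_le h4)

/-- The guard `l` is met by the left ray at time `φ`. The guard at the clockwise end is included. -/
def MeetsLeft (Θ α : ℝ) (p : ℝ → Plane) (φ : ℝ) (l : Plane) : Prop :=
  (φ = α ∧ l = p α) ∨ (lc Θ φ l = lc Θ φ (p φ) ∧ rc Θ φ (p φ) < rc Θ φ l)

/-- The guard `r` is met by the right ray at time `φ`. The guard at the counterclockwise end is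
included. -/
def MeetsRight (Θ β : ℝ) (p : ℝ → Plane) (φ : ℝ) (r : Plane) : Prop :=
  (φ = β ∧ r = p β) ∨ (rc Θ φ r = rc Θ φ (p φ) ∧ lc Θ φ (p φ) < lc Θ φ r)

theorem MeetsRight.mirror {r : Plane} {φ : ℝ} (hr : MeetsRight Θ β p φ r) :
    MeetsLeft Θ (-β) (fun φ => GuardedRegion.mirror (p (-φ))) (-φ) (GuardedRegion.mirror r) := by
  rcases hr with ⟨rfl, rfl⟩ | hr
  · left; simp
  · right; simpa [lc_mirror, rc_mirror] using hr

/-- Earlier contacts persist, later contacts are anticipated, and `rc_lt_start` covers the guard at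
the clockwise end. From here on the time of contact no longer matters. -/
theorem rc_lt_of_meetsLeft (h : IsSweep G Θ α β p) {l : Plane} (hl : l ∈ G) {φ' φ : ℝ}
    (hφ' : φ' ∈ Icc α β) (hm : MeetsLeft Θ α p φ' l) (hφ : φ ∈ Ioo α β) :
    rc Θ φ (p φ) < rc Θ φ l := by
  rcases hm with ⟨-, rfl⟩ | ⟨h1, h2⟩
  · exact h.rc_lt_start hl hφ
  · rcases le_or_gt φ' φ with hle | hlt
    · exact h.rc_lt_of_le hl hφ'.1 hle hφ.2 h2
    · exact h.rc_lt_of_touches_left hl hφ.1 hlt hφ'.2 h1 h2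

theorem lc_lt_of_meetsRight (h : IsSweep G Θ α β p) {r : Plane} (hr : r ∈ G) {φ' φ : ℝ}
    (hφ' : φ' ∈ Icc α β) (hm : MeetsRight Θ β p φ' r) (hφ : φ ∈ Ioo α β) :
    lc Θ φ (p φ) < lc Θ φ r := by
  have := h.mirror.rc_lt_of_meetsLeft (mem_image_mirror.2 hr) (φ' := -φ') (φ := -φ)
    ⟨neg_le_neg hφ'.2, neg_le_neg hφ'.1⟩ hm.mirror ⟨neg_lt_neg hφ.2, neg_lt_neg hφ.1⟩
  simpa [rc_mirror] using this

theorem rc_le_of_meetsLeft (h : IsSweep G Θ α β p) {l : Plane} (hl : l ∈ G) {φ' φ : ℝ}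
    (hφ' : φ' ∈ Icc α β) (hm : MeetsLeft Θ α p φ' l) (hαβ : α < β) (hφ : φ ∈ Icc α β) :
    rc Θ φ (p φ) ≤ rc Θ φ l := by
  rcases eq_or_lt_of_le hφ.1 with rfl | h1
  · exact le_of_forall_Ioo_right h.rcCont (continuous_rc_const Θ l).continuousOn le_rfl hαβ le_rfl
      fun t ht => (h.rc_lt_of_meetsLeft hl hφ' hm ht).le
  · exact le_of_forall_Ioo_left h.rcCont (continuous_rc_const Θ l).continuousOn le_rfl h1 hφ.2
      fun t ht => (h.rc_lt_of_meetsLeft hl hφ' hm ⟨ht.1, ht.2.trans_le hφ.2⟩).le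

theorem lc_le_of_meetsLeft (h : IsSweep G Θ α β p) {l : Plane} (hl : l ∈ G) {φ' φ : ℝ}
    (hφ' : φ' ∈ Icc α β) (hm : MeetsLeft Θ α p φ' l) (hαβ : α < β) (hφ : φ ∈ Icc α β) :
    lc Θ φ l ≤ lc Θ φ (p φ) := by
  have key : ∀ t ∈ Ioo α β, lc Θ t l ≤ lc Θ t (p t) := fun t ht =>
    h.lc_le (Ioo_subset_Icc_self ht) hl (h.rc_lt_of_meetsLeft hl hφ' hm ht)
  rcases eq_or_lt_of_le hφ.1 with rfl | h1
  · exact le_of_forall_Ioo_right (continuous_lc_const Θ l).continuousOn h.lcCont le_rfl hαβ le_rfl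
      key
  · exact le_of_forall_Ioo_left (continuous_lc_const Θ l).continuousOn h.lcCont le_rfl h1 hφ.2
      fun t ht => key t ⟨ht.1, ht.2.trans_le hφ.2⟩

theorem lc_le_of_meetsRight (h : IsSweep G Θ α β p) {r : Plane} (hr : r ∈ G) {φ' φ : ℝ}
    (hφ' : φ' ∈ Icc α β) (hm : MeetsRight Θ β p φ' r) (hαβ : α < β) (hφ : φ ∈ Icc α β) :
    lc Θ φ (p φ) ≤ lc Θ φ r := by
  have := h.mirror.rc_le_of_meetsLeft (mem_image_mirror.2 hr) (φ' := -φ') (φ := -φ)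
    ⟨neg_le_neg hφ'.2, neg_le_neg hφ'.1⟩ hm.mirror (neg_lt_neg hαβ)
    ⟨neg_le_neg hφ.2, neg_le_neg hφ.1⟩
  simpa [rc_mirror] using this

theorem rc_le_of_meetsRight (h : IsSweep G Θ α β p) {r : Plane} (hr : r ∈ G) {φ' φ : ℝ}
    (hφ' : φ' ∈ Icc α β) (hm : MeetsRight Θ β p φ' r) (hαβ : α < β) (hφ : φ ∈ Icc α β) :
    rc Θ φ r ≤ rc Θ φ (p φ) := by
  have := h.mirror.lc_le_of_meetsLeft (mem_image_mirror.2 hr) (φ' := -φ') (φ := -φ)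
    ⟨neg_le_neg hφ'.2, neg_le_neg hφ'.1⟩ hm.mirror (neg_lt_neg hαβ)
    ⟨neg_le_neg hφ.2, neg_le_neg hφ.1⟩
  simpa [lc_mirror] using this

theorem cross_meetsLeft_nonneg (h : IsSweep G Θ α β p) {l : Plane} {φ' φ : ℝ}
    (h1 : α ≤ φ') (h2 : φ' < φ) (h3 : φ ≤ β) (hm : MeetsLeft Θ α p φ' l) :
    0 ≤ cross (l - p φ) (p φ' - p φ) := by
  rcases hm with ⟨rfl, rfl⟩ | ⟨e1, e2⟩
  · refine le_of_eq ?_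
    simp [cross]; ring
  · have f := frame_cross Θ φ' (l - p φ') (p φ' - p φ)
    simp only [lc_sub, rc_sub, e1, sub_self, zero_mul, zero_sub] at f
    have g : cross (l - p φ') (p φ' - p φ) = cross (l - p φ) (p φ' - p φ) := by
      simp [cross]; ring
    rw [← g]
    refine nonneg_of_mul_nonneg_right ?_ h.sin_pos
    rw [f]
    have := mul_nonneg (sub_pos.2 e2).le (sub_nonneg.2 (h.lc_apex_le' h1 h2 h3))
    linarith

theorem cross_meetsRight_nonneg (h : IsSweep G Θ α β p) {r : Plane} {φ' φ : ℝ}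
    (h1 : α ≤ φ) (h2 : φ < φ') (h3 : φ' ≤ β) (hm : MeetsRight Θ β p φ' r) :
    0 ≤ cross (p φ' - p φ) (r - p φ) := by
  have := h.mirror.cross_meetsLeft_nonneg (neg_le_neg h3) (neg_lt_neg h2) (neg_le_neg h1) hm.mirror
  simp only [neg_neg, ← mirror_sub, cross_mirror] at this
  refine this.trans_eq ?_
  simp [cross]; ring

/-- The apex sees `l` and `r` under an angle of at most `π`. The one-sided lemmas apply while `l` is
still to be met or after `r` has been met; in between, convexity of the apex path is needed. -/
theorem cross_nonneg (h : IsSweep G Θ α β p) {l r : Plane} (hl : l ∈ G) (hr : r ∈ G)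
    {φl φr φ : ℝ} (hφl : φl ∈ Icc α β) (hφr : φr ∈ Icc α β) (hml : MeetsLeft Θ α p φl l)
    (hmr : MeetsRight Θ β p φr r) (hφ : φ ∈ Ioo α β) : 0 ≤ cross (r - p φ) (l - p φ) := by
  have hαβ := hφ.1.trans hφ.2
  have hs := h.sin_pos
  have l1 := h.rc_lt_of_meetsLeft hl hφl hml hφ
  have r1 := h.lc_lt_of_meetsRight hr hφr hmr hφ
  have f := frame_cross Θ φ (r - p φ) (l - p φ)
  simp only [lc_sub, rc_sub] at f
  have m0 := mul_pos (sub_pos.2 r1) (sub_pos.2 l1)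
  rcases lt_trichotomy φ φl with hlt | rfl | hgt
  · rcases hml with ⟨rfl, -⟩ | ⟨e1, e2⟩
    · exact absurd hφ.1 (not_lt.2 hlt.le)
    · exact h.cross_nonneg_before hl hφ.1 hlt hφl.2 e1 e2 r1
        (h.lc_le_of_meetsRight hr hφr hmr hαβ hφl)
  · rcases hml with ⟨rfl, -⟩ | ⟨e1, e2⟩
    · exact absurd hφ.1 (lt_irrefl _)
    · rw [e1, sub_self, mul_zero, sub_zero] at f
      exact nonneg_of_mul_nonneg_right (f ▸ m0.le) hs
  rcases lt_trichotomy φr φ with hlt' | rfl | hgt'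
  · rcases hmr with ⟨rfl, -⟩ | ⟨e1, e2⟩
    · exact absurd hφ.2 (not_lt.2 hlt'.le)
    · exact h.cross_nonneg_after hr hφ.2 hlt' hφr.1 e1 e2 l1
        (h.rc_le_of_meetsLeft hl hφl hml hαβ hφr)
  · rcases hmr with ⟨rfl, -⟩ | ⟨e1, e2⟩
    · exact absurd hφ.2 (lt_irrefl _)
    · rw [e1, sub_self, zero_mul, sub_zero] at f
      exact nonneg_of_mul_nonneg_right (f ▸ m0.le) hs
  -- Now `φl < φ < φr`, and the apexes at `φl` and `φr` serve as intermediate points between the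
  -- directions to `l` and to `r`.
  have c1 := mul_nonneg hs.le (h.cross_apex_nonneg hφl.1 hgt hgt' hφr.2)
  have c2 := mul_nonneg hs.le (h.cross_meetsLeft_nonneg hφl.1 hgt hφ.2.le hml)
  have c3 := mul_nonneg hs.le (h.cross_meetsRight_nonneg hφ.1.le hgt' hφr.2 hmr)
  rw [frame_cross Θ φ] at c1 c2 c3
  simp only [lc_sub, rc_sub] at c1 c2 c3
  have d1 := h.rc_apex_lt' hφl.1 hgt hφ.2
  have d2 := h.lc_apex_lt' hφ.1 hgt' hφr.2
  have d3 := h.lc_le_of_meetsLeft hl hφl hml hαβ (Ioo_subset_Icc_self hφ)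
  have d4 := h.rc_le_of_meetsRight hr hφr hmr hαβ (Ioo_subset_Icc_self hφ)
  have d5 := h.lc_apex_le hφl.1 hgt hφ.2.le
  have d6 := h.rc_apex_le hφ.1.le hgt' hφr.2
  refine nonneg_of_mul_nonneg_right ?_ hs
  rw [f]
  obtain ⟨a, ha⟩ : ∃ a, a = lc Θ φ (p φ) - lc Θ φ l := ⟨_, rfl⟩
  obtain ⟨b, hb⟩ : ∃ b, b = rc Θ φ (p φ) - rc Θ φ r := ⟨_, rfl⟩
  obtain ⟨A, hA⟩ : ∃ A, A = lc Θ φ r - lc Θ φ (p φ) := ⟨_, rfl⟩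
  obtain ⟨B, hB⟩ : ∃ B, B = rc Θ φ l - rc Θ φ (p φ) := ⟨_, rfl⟩
  obtain ⟨a₁, ha₁⟩ : ∃ a, a = lc Θ φ (p φ) - lc Θ φ (p φl) := ⟨_, rfl⟩
  obtain ⟨b₂, hb₂⟩ : ∃ b, b = rc Θ φ (p φ) - rc Θ φ (p φr) := ⟨_, rfl⟩
  obtain ⟨A₂, hA₂⟩ : ∃ A, A = lc Θ φ (p φr) - lc Θ φ (p φ) := ⟨_, rfl⟩
  obtain ⟨B₁, hB₁⟩ : ∃ B, B = rc Θ φ (p φl) - rc Θ φ (p φ) := ⟨_, rfl⟩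
  have ha0 : 0 ≤ a := by linarith
  have hb0 : 0 ≤ b := by linarith
  have hA0 : 0 < A := by linarith
  have hB0 : 0 < B := by linarith
  have ha₁0 : 0 ≤ a₁ := by linarith
  have hb₂0 : 0 ≤ b₂ := by linarith
  have hA₂0 : 0 < A₂ := by linarith
  have hB₁0 : 0 < B₁ := by linarith
  have i1 : a * B₁ ≤ a₁ * B := by rw [ha, hB₁, ha₁, hB]; linarith
  have i2 : b * A₂ ≤ b₂ * A := by rw [hb, hA₂, hb₂, hA]; linarith
  have i3 : b₂ * a₁ ≤ A₂ * B₁ := by rw [hb₂, ha₁, hA₂, hB₁]; linarith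
  -- Multiply the three slope comparisons and cancel `A₂ * B₁ > 0`.
  have i4 : a * b ≤ A * B := by
    have j1 := mul_le_mul i1 i2 (by positivity) (by positivity)
    have j2 := mul_le_mul_of_nonneg_right i3 (mul_pos hA0 hB0).le
    refine le_of_mul_le_mul_right ?_ (mul_pos hA₂0 hB₁0)
    linarith
  rw [ha, hb, hA, hB] at i4
  linarith

/-- The apex belongs to the circular segments of all pairs of a left guard and a right guard. -/
theorem mem_segmentOf (h : IsSweep G Θ α β p) {l r : Plane} (hl : l ∈ G) (hr : r ∈ G)
    {φl φr φ : ℝ} (hφl : φl ∈ Icc α β) (hφr : φr ∈ Icc α β) (hml : MeetsLeft Θ α p φl l)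
    (hmr : MeetsRight Θ β p φr r) (hφ : φ ∈ Ioo α β) : p φ ∈ segmentOf Θ l r := by
  have hαβ := hφ.1.trans hφ.2
  have hφ' := Ioo_subset_Icc_self hφ
  have hc := h.cross_nonneg hl hr hφl hφr hml hmr hφ
  exact (mem_segmentOf_iff h.pos h.lt_pi).2 ⟨hc, pw_nonneg_of_cross_nonneg h.pos h.lt_pi
    (h.lc_le_of_meetsLeft hl hφl hml hαβ hφ') (h.rc_le_of_meetsRight hr hφr hmr hαβ hφ')
    (h.lc_le_of_meetsRight hr hφr hmr hαβ hφ') (h.rc_le_of_meetsLeft hl hφl hml hαβ hφ') hc⟩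

end IsSweep

end GuardedRegion

/-! ### Points of the tunnel set on the arcs of its guards -/

namespace GuardedRegion

open Set

theorem IsTunnelMotion.isSweep {G : Finset Plane} {Θ α β : ℝ} {p : ℝ → Plane} (h0 : 0 < Θ)
    (hπ : Θ < Real.pi) (h : IsTunnelMotion G Θ α β p) : IsSweep G Θ α β p where
  pos := h0
  lt_pi := hπ
  cont := h.continuousOn
  empty φ hφ := (isEmptyCone_iff h0 hπ).1 (h.isEmptyCone φ hφ)
  left φ hφ := by simpa only [mem_leftRay_iff h0 hπ] using h.touches_left φ hφ
  right φ hφ := by simpa only [mem_rightRay_iff h0 hπ] using h.touches_right φ hφ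
  notMem := h.apex_notMem

theorem IsSweep.isTunnelMotion {G : Finset Plane} {Θ α β : ℝ} {p : ℝ → Plane}
    (h : IsSweep G Θ α β p) (hαβ : α < β) (hα : p α ∈ G) (hβ : p β ∈ G) :
    IsTunnelMotion G Θ α β p where
  lt := hαβ
  continuousOn := h.cont
  isEmptyCone φ hφ := (isEmptyCone_iff h.pos h.lt_pi).2 (h.empty φ hφ)
  touches_left φ hφ := by
    simpa only [mem_leftRay_iff h.pos h.lt_pi] using h.left φ hφ
  touches_right φ hφ := by
    simpa only [mem_rightRay_iff h.pos h.lt_pi] using h.right φ hφ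
  apex_notMem := h.notMem
  clockwise_end := hα
  counterclockwise_end := hβ

theorem mem_leftGuards_iff {G : Finset Plane} {Θ α β : ℝ} {p : ℝ → Plane} (h0 : 0 < Θ)
    (hπ : Θ < Real.pi) (hαβ : α ≤ β) {l : Plane} :
    l ∈ leftGuards G Θ α β p ↔ l ∈ G ∧ ∃ φ ∈ Icc α β, IsSweep.MeetsLeft Θ α p φ l := by
  simp only [leftGuards, mem_leftRay_iff h0 hπ, IsSweep.MeetsLeft, Set.mem_ofPred_eq]
  refine and_congr_right fun _ => ⟨?_, ?_⟩
  · rintro (h | ⟨φ, hφ, h⟩)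
    · exact ⟨α, left_mem_Icc.2 hαβ, Or.inl ⟨rfl, h⟩⟩
    · exact ⟨φ, hφ, Or.inr h⟩
  · rintro ⟨φ, hφ, ⟨-, h⟩ | h⟩
    · exact Or.inl h
    · exact Or.inr ⟨φ, hφ, h⟩

theorem mem_rightGuards_iff {G : Finset Plane} {Θ α β : ℝ} {p : ℝ → Plane} (h0 : 0 < Θ)
    (hπ : Θ < Real.pi) (hαβ : α ≤ β) {r : Plane} :
    r ∈ rightGuards G Θ α β p ↔ r ∈ G ∧ ∃ φ ∈ Icc α β, IsSweep.MeetsRight Θ β p φ r := by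
  simp only [rightGuards, mem_rightRay_iff h0 hπ, IsSweep.MeetsRight, Set.mem_ofPred_eq]
  refine and_congr_right fun _ => ⟨?_, ?_⟩
  · rintro (h | ⟨φ, hφ, h⟩)
    · exact ⟨β, right_mem_Icc.2 hαβ, Or.inl ⟨rfl, h⟩⟩
    · exact ⟨φ, hφ, Or.inr h⟩
  · rintro ⟨φ, hφ, ⟨-, h⟩ | h⟩
    · exact Or.inl h
    · exact Or.inr ⟨φ, hφ, h⟩

theorem continuous_pw (Θ : ℝ) (l r : Plane) : Continuous (pw Θ l r) := by
  unfold pw cross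
  simp only [PiLp.sub_apply]
  fun_prop

theorem continuous_cross_sub (l r : Plane) : Continuous fun x => cross (r - x) (l - x) := by
  simp only [cross, PiLp.sub_apply]
  fun_prop

theorem isClosed_segmentOf {Θ : ℝ} (h0 : 0 < Θ) (hπ : Θ < Real.pi) (l r : Plane) :
    IsClosed (segmentOf Θ l r) := by
  have e : segmentOf Θ l r = {x | 0 ≤ cross (r - x) (l - x)} ∩ {x | 0 ≤ pw Θ l r x} := by
    ext x; exact mem_segmentOf_iff h0 hπ
  rw [e]
  exact (isClosed_le continuous_const (continuous_cross_sub l r)).inter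
    (isClosed_le continuous_const (continuous_pw Θ l r))

theorem isClosed_tunnelSet {Θ : ℝ} (h0 : 0 < Θ) (hπ : Θ < Real.pi) (L R : Set Plane) :
    IsClosed (tunnelSet Θ L R) :=
  isClosed_biInter fun l _ => isClosed_biInter fun r _ => isClosed_segmentOf h0 hπ l r

theorem tunnelSet_subset_segmentOf {Θ : ℝ} {L R : Set Plane} {l r : Plane} (hl : l ∈ L)
    (hr : r ∈ R) : tunnelSet Θ L R ⊆ segmentOf Θ l r :=
  (biInter_subset_of_mem hl).trans (biInter_subset_of_mem hr)

/-- Along a horizontal line `pw` is a quadratic with leading coefficient `-sin Θ`. Vanishing at `x`,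
it is negative on at least one side of `x`. -/
theorem arc_disjoint_interior_segmentOf {Θ : ℝ} (h0 : 0 < Θ) (hπ : Θ < Real.pi) {l r x : Plane}
    (hx : x ∈ arc Θ l r) : x ∉ interior (segmentOf Θ l r) := by
  intro hint
  have hs := Real.sin_pos_of_pos_of_lt_pi h0 hπ
  have hpw := ((mem_arc_iff h0 hπ).1 hx).2
  obtain ⟨v, hv, hv'⟩ : ∃ v : Plane, 0 < v 0 ^ 2 + v 1 ^ 2 ∧ ∀ t : ℝ, 0 ≤ t →
      pw Θ l r (x + t • v) ≤ -Real.sin Θ * (t ^ 2 * (v 0 ^ 2 + v 1 ^ 2)) := by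
    -- As `pw` vanishes at `x`, its slope there is read off from the value at distance one; its sign
    -- selects the side.
    set k := pw Θ l r (x + (1 : ℝ) • !₂[1, 0]) + Real.sin Θ with hk
    rcases le_or_gt k 0 with hk0 | hk0
    · refine ⟨!₂[1, 0], by simp, fun t ht => ?_⟩
      have : pw Θ l r (x + t • !₂[1, 0]) = pw Θ l r x + t * (k - pw Θ l r x)
          - Real.sin Θ * t ^ 2 := by
        simp [hk, pw, cross]; ring
      rw [this, hpw]
      simp
      nlinarith
    · refine ⟨!₂[-1, 0], by simp, fun t ht => ?_⟩
      have : pw Θ l r (x + t • !₂[-1, 0]) = pw Θ l r x - t * (k - pw Θ l r x)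
          - Real.sin Θ * t ^ 2 := by
        simp [hk, pw, cross]; ring
      rw [this, hpw]
      simp
      nlinarith
  have hc : Filter.Tendsto (fun t : ℝ => x + t • v) (𝓝[>] 0) (𝓝 x) := by
    have : Continuous fun t : ℝ => x + t • v := by fun_prop
    have h := (this.tendsto 0).mono_left (nhdsWithin_le_nhds (s := Ioi 0))
    simpa using h
  have hev := hc.eventually (mem_interior_iff_mem_nhds.1 hint)
  obtain ⟨t, ht1, ht2⟩ := (hev.and self_mem_nhdsWithin).exists
  have e1 := ((mem_segmentOf_iff h0 hπ).1 ht1).2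
  have e2 := hv' t (le_of_lt ht2)
  have ht3 : 0 < t := ht2
  have := mul_pos hs (mul_pos (pow_pos ht3 2) hv)
  linarith

theorem frontier_tunnelSet_inter_arc {Θ : ℝ} (h0 : 0 < Θ) (hπ : Θ < Real.pi) {L R : Set Plane}
    {l r : Plane} (hl : l ∈ L) (hr : r ∈ R) :
    frontier (tunnelSet Θ L R) ∩ arc Θ l r = tunnelSet Θ L R ∩ arc Θ l r := by
  ext x
  rw [(isClosed_tunnelSet h0 hπ L R).frontier_eq]
  refine ⟨fun h => ⟨h.1.1, h.2⟩, fun h => ⟨⟨h.1, fun hint => ?_⟩, h.2⟩⟩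
  exact arc_disjoint_interior_segmentOf h0 hπ h.2
    (interior_mono (tunnelSet_subset_segmentOf hl hr) hint)

/-- The inscribed angle in terms of cones: aim the left ray from `x` at `l`; the vanishing of `pw`
then forces `r` onto the right ray. -/
theorem exists_frame_of_mem_arc {Θ : ℝ} (h0 : 0 < Θ) (hπ : Θ < Real.pi) {l r x : Plane}
    (hx : x ∈ arc Θ l r) (hl : x ≠ l) (hr : x ≠ r) (a : ℝ) :
    ∃ φ ∈ Ioc a (a + 2 * Real.pi), lc Θ φ l = lc Θ φ x ∧ rc Θ φ x < rc Θ φ l ∧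
      rc Θ φ r = rc Θ φ x ∧ lc Θ φ x < lc Θ φ r := by
  have hs := Real.sin_pos_of_pos_of_lt_pi h0 hπ
  obtain ⟨s, hs0, ψ, hψ, he⟩ := exists_eq_smul_dir_of_ne (sub_ne_zero.2 hl.symm) (a + Θ / 2)
  obtain ⟨hc, hpw⟩ := (mem_arc_iff h0 hπ).1 hx
  refine ⟨ψ - Θ / 2, ⟨by linarith [hψ.1], by linarith [hψ.2]⟩, ?_⟩
  generalize hφ : ψ - Θ / 2 = φ
  have e1 : lc Θ φ (l - x) = 0 := by
    rw [he, lc_smul, lc_dir, ← hφ]; simp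
  have e2 : 0 < rc Θ φ (l - x) := by
    rw [he, rc_smul, rc_dir, ← hφ, show ψ - (ψ - Θ / 2 - Θ / 2) = Θ by ring]
    exact mul_pos hs0 hs
  have f1 := frame_pw Θ φ l r x
  rw [hpw, e1] at f1
  have e3 : rc Θ φ (r - x) = 0 := by
    have : rc Θ φ (l - x) * rc Θ φ (r - x) = 0 := by linarith
    exact (mul_eq_zero.1 this).resolve_left e2.ne'
  have f2 := frame_cross Θ φ (r - x) (l - x)
  rw [e1, mul_zero, sub_zero] at f2
  have f3 := mul_nonneg hs.le hc
  rw [f2] at f3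
  have e4 := nonneg_of_mul_nonneg_left f3 e2
  rw [lc_sub] at e1 e4
  rw [rc_sub] at e2 e3
  refine ⟨by linarith, by linarith, by linarith, lt_of_le_of_ne (by linarith) fun h => hr ?_⟩
  exact ext_of_lc_rc h0 hπ h (by linarith)

theorem eq_zero_of_quadratic_nonpos {c A B : ℝ} (hc : c ^ 2 < 1)
    (h : A ^ 2 + B ^ 2 + 2 * c * (A * B) ≤ 0) : A = 0 ∧ B = 0 := by
  have hB : B = 0 := by
    have h1 : (1 - c ^ 2) * B ^ 2 ≤ 0 := by nlinarith [sq_nonneg (A + c * B)]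
    have h2 : B ^ 2 ≤ 0 := nonpos_of_mul_nonpos_right h1 (by linarith)
    exact pow_eq_zero_iff two_ne_zero |>.1 (le_antisymm h2 (sq_nonneg B))
  subst hB
  refine ⟨pow_eq_zero_iff two_ne_zero |>.1 (le_antisymm ?_ (sq_nonneg A)), rfl⟩
  linarith

theorem cos_sq_lt_one {Θ : ℝ} (h0 : 0 < Θ) (hπ : Θ < Real.pi) : Real.cos Θ ^ 2 < 1 := by
  have hs := Real.sin_pos_of_pos_of_lt_pi h0 hπ
  have := Real.sin_sq_add_cos_sq Θ
  have := pow_pos hs 2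
  linarith

namespace IsSweep

variable {G : Finset Plane} {Θ α β : ℝ} {p : ℝ → Plane}

/-- For a point behind both rays, membership in the disk of the pair in contact bounds a positive
definite form in its offsets from the apex above by zero. -/
theorem eq_apex_of_pw_nonneg (h : IsSweep G Θ α β p) {φ : ℝ} {l r x : Plane}
    (hl1 : lc Θ φ l = lc Θ φ (p φ)) (hl2 : rc Θ φ (p φ) < rc Θ φ l)
    (hr1 : rc Θ φ r = rc Θ φ (p φ)) (hr2 : lc Θ φ (p φ) < lc Θ φ r)
    (hx1 : lc Θ φ x ≤ lc Θ φ (p φ)) (hx2 : rc Θ φ x ≤ rc Θ φ (p φ))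
    (hpw : 0 ≤ pw Θ l r x) : x = p φ := by
  have f := frame_pw Θ φ l r x
  have hm := mul_nonneg h.sin_pos.le hpw
  simp only [lc_sub, rc_sub, hl1, hr1] at f
  have m1 := mul_nonneg (sub_nonneg.2 hx1) (sub_pos.2 hr2).le
  have m2 := mul_nonneg (sub_nonneg.2 hx2) (sub_pos.2 hl2).le
  obtain ⟨e1, e2⟩ := eq_zero_of_quadratic_nonpos (A := lc Θ φ (p φ) - lc Θ φ x)
    (B := rc Θ φ (p φ) - rc Θ φ x) (cos_sq_lt_one h.pos h.lt_pi) (by nlinarith)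
  exact ext_of_lc_rc h.pos h.lt_pi (by linarith) (by linarith)

/-- Covers cones whose direction precedes the motion. Turning forward to `α` shows that `x` is not
right of the left ray there; the pair of `p α` and a right guard touched just after `α` then forces
`x = p α`. -/
theorem eq_start_of_pw_nonneg (h : IsSweep G Θ α β p) (hαβ : α < β) {φ : ℝ} {l x : Plane}
    (hφ : φ ≤ α) (hφ' : α - φ < Real.pi) (hl1 : lc Θ φ l = lc Θ φ x)
    (hl2 : rc Θ φ x ≤ rc Θ φ l) (hl3 : lc Θ α l ≤ lc Θ α (p α))
    (hpw : ∀ r ∈ G, ∀ ψ ∈ Icc α β, MeetsRight Θ β p ψ r → 0 ≤ pw Θ (p α) r x) : x = p α := by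
  obtain ⟨r, hr, hf, hr1, hr2⟩ := h.exists_frequently_right_nhdsGT le_rfl hαβ
  obtain ⟨t, ht1, ht2, ht3⟩ := hf.exists
  have hm := mul_nonneg h.sin_pos.le (hpw r hr t (Ioo_subset_Icc_self ht1) (Or.inr ⟨ht2, ht3⟩))
  have f := frame_pw Θ α (p α) r x
  have g := frame_lc Θ φ α (l - x)
  simp only [lc_sub, rc_sub, hl1, hr1, sub_self, zero_mul, add_zero] at f g
  have m1 := mul_nonneg (sub_nonneg.2 hl2)
    (Real.sin_nonneg_of_nonneg_of_le_pi (x := α - φ) (by linarith) (by linarith))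
  rw [← g] at m1
  have m2 := nonneg_of_mul_nonneg_right m1 h.sin_pos
  have m3 : 0 ≤ (lc Θ α (p α) - lc Θ α x) * (lc Θ α r - lc Θ α (p α)) :=
    mul_nonneg (by linarith) (by linarith)
  obtain ⟨e1, e2⟩ := eq_zero_of_quadratic_nonpos (A := lc Θ α (p α) - lc Θ α x)
    (B := rc Θ α (p α) - rc Θ α x) (cos_sq_lt_one h.pos h.lt_pi) (by nlinarith)
  exact ext_of_lc_rc h.pos h.lt_pi (by linarith) (by linarith)

theorem meetsRight_mirror_iff {r : Plane} {φ : ℝ} :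
    MeetsRight Θ (-α) (fun φ => GuardedRegion.mirror (p (-φ))) φ (GuardedRegion.mirror r) ↔
      MeetsLeft Θ α p (-φ) r := by
  simp only [MeetsRight, MeetsLeft, lc_mirror, rc_mirror, neg_neg, mirror_injective.eq_iff,
    neg_eq_iff_eq_neg]

theorem eq_end_of_pw_nonneg (h : IsSweep G Θ α β p) (hαβ : α < β) {φ : ℝ} {r x : Plane}
    (hφ : β ≤ φ) (hφ' : φ - β < Real.pi) (hr1 : rc Θ φ r = rc Θ φ x)
    (hr2 : lc Θ φ x ≤ lc Θ φ r) (hr3 : rc Θ β r ≤ rc Θ β (p β))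
    (hpw : ∀ l ∈ G, ∀ ψ ∈ Icc α β, MeetsLeft Θ α p ψ l → 0 ≤ pw Θ l (p β) x) : x = p β := by
  have := h.mirror.eq_start_of_pw_nonneg (neg_lt_neg hαβ) (l := GuardedRegion.mirror r)
    (x := GuardedRegion.mirror x) (φ := -φ) (neg_le_neg hφ) (by linarith)
    (by simpa [lc_mirror] using hr1) (by simpa [rc_mirror] using hr2)
    (by simpa [lc_mirror] using hr3) ?_
  · simpa [mirror_injective.eq_iff] using this
  · intro l' hl' ψ hψ hm
    obtain ⟨l, hl, rfl⟩ := Finset.mem_image.1 hl'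
    simp only [neg_neg, pw_mirror]
    exact hpw l hl (-ψ) ⟨by linarith [hψ.2], by linarith [hψ.1]⟩ (meetsRight_mirror_iff.1 hm)

/-- `lc` is sinusoidal in the direction, so over less than half a turn intermediate values are
nonnegative combinations of the end values. -/
theorem interp_lc (Θ φ₁ φ φ₂ : ℝ) (v : Plane) :
    Real.sin (φ₂ - φ₁) * lc Θ φ v
      = Real.sin (φ₂ - φ) * lc Θ φ₁ v + Real.sin (φ - φ₁) * lc Θ φ₂ v := by
  have e1 : φ₂ - φ₁ = (φ₂ + Θ / 2) - (φ₁ + Θ / 2) := by ring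
  have e2 : φ₂ - φ = (φ₂ + Θ / 2) - (φ + Θ / 2) := by ring
  have e3 : φ - φ₁ = (φ + Θ / 2) - (φ₁ + Θ / 2) := by ring
  rw [e1, e2, e3, Real.sin_sub, Real.sin_sub, Real.sin_sub]
  simp only [lc, cross, dir_zero, dir_one]
  ring

/-- A guard `k` in contact at `φ` is not ahead of `l` at `φ₁` or `φ₂`, where `l` is on the line of
the left ray; by interpolation it is not ahead at `φ` either. -/
theorem lc_eq_of_between (h : IsSweep G Θ α β p) {l : Plane} (hl : l ∈ G) {φ' φ₁ φ φ₂ : ℝ}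
    (hφ' : φ' ∈ Icc α β) (hm : MeetsLeft Θ α p φ' l) (h1 : α < φ₁) (h12 : φ₁ ≤ φ) (h23 : φ ≤ φ₂)
    (h3 : φ₂ < β) (e1 : lc Θ φ₁ l = lc Θ φ₁ (p φ₁)) (e2 : lc Θ φ₂ l = lc Θ φ₂ (p φ₂)) :
    lc Θ φ l = lc Θ φ (p φ) := by
  rcases eq_or_lt_of_le (h12.trans h23) with he | hlt
  · obtain rfl : φ = φ₁ := by linarith
    exact e1
  have hφ : φ ∈ Ioo α β := ⟨by linarith, by linarith⟩
  have hφ1 : φ₁ ∈ Ioo α β := ⟨h1, by linarith⟩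
  have hφ2 : φ₂ ∈ Ioo α β := ⟨by linarith, h3⟩
  have hαβ := hφ.1.trans hφ.2
  obtain ⟨k, hk, hk1, hk2⟩ := h.left φ hφ
  have hmk : MeetsLeft Θ α p φ k := Or.inr ⟨hk1, hk2⟩
  have k1 := h.lc_le_of_meetsLeft hk (Ioo_subset_Icc_self hφ) hmk hαβ (Ioo_subset_Icc_self hφ1)
  have k2 := h.lc_le_of_meetsLeft hk (Ioo_subset_Icc_self hφ) hmk hαβ (Ioo_subset_Icc_self hφ2)
  refine le_antisymm (h.lc_le_of_meetsLeft hl hφ' hm hαβ (Ioo_subset_Icc_self hφ)) ?_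
  have hi := interp_lc Θ φ₁ φ φ₂ (l - k)
  simp only [lc_sub, hk1, e1, e2] at hi
  have hle := h.sub_le h1.le h3.le hlt
  have hp := h.pos
  have s0 := Real.sin_pos_of_pos_of_lt_pi (x := φ₂ - φ₁) (by linarith) (by linarith)
  have s1 := Real.sin_nonneg_of_nonneg_of_le_pi (x := φ₂ - φ) (by linarith) (by linarith)
  have s2 := Real.sin_nonneg_of_nonneg_of_le_pi (x := φ - φ₁) (by linarith) (by linarith)
  have m := add_nonneg (mul_nonneg s1 (sub_nonneg.2 k1)) (mul_nonneg s2 (sub_nonneg.2 k2))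
  rw [← hi] at m
  linarith [nonneg_of_mul_nonneg_right m s0]

theorem rc_eq_of_between (h : IsSweep G Θ α β p) {r : Plane} (hr : r ∈ G) {φ' φ₁ φ φ₂ : ℝ}
    (hφ' : φ' ∈ Icc α β) (hm : MeetsRight Θ β p φ' r) (h1 : α < φ₁) (h12 : φ₁ ≤ φ) (h23 : φ ≤ φ₂)
    (h3 : φ₂ < β) (e1 : rc Θ φ₁ r = rc Θ φ₁ (p φ₁)) (e2 : rc Θ φ₂ r = rc Θ φ₂ (p φ₂)) :
    rc Θ φ r = rc Θ φ (p φ) := by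
  have := h.mirror.lc_eq_of_between (mem_image_mirror.2 hr) (φ' := -φ')
    ⟨neg_le_neg hφ'.2, neg_le_neg hφ'.1⟩ hm.mirror (neg_lt_neg h3) (neg_le_neg h23)
    (neg_le_neg h12) (neg_lt_neg h1) (by simpa [lc_mirror] using e2)
    (by simpa [lc_mirror] using e1)
  simpa [lc_mirror] using this

end IsSweep

end GuardedRegion

/-! ### Boundary arcs as pieces of the apex path -/

namespace GuardedRegion

open Set

/-- The part of a tunnel motion from direction `φ₁` to direction `φ₂` during which the cone
touches the guards `l` and `r`. -/
structure IsTunnelArc (G : Finset Plane) (Θ α β : ℝ) (p : ℝ → Plane) (l r : Plane)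
    (φ₁ φ₂ : ℝ) : Prop where
  motion : IsTunnelMotion G Θ α β p
  left_mem : l ∈ leftGuards G Θ α β p
  right_mem : r ∈ rightGuards G Θ α β p
  le_left : α ≤ φ₁
  lt : φ₁ < φ₂
  le_right : φ₂ ≤ β
  touches_iff : ∀ φ ∈ Ioo α β,
    (lc Θ φ l = lc Θ φ (p φ) ∧ rc Θ φ r = rc Θ φ (p φ)) ↔ φ ∈ Icc φ₁ φ₂

section

variable {G : Finset Plane} {Θ α β : ℝ} {p : ℝ → Plane}

theorem IsTunnelMotion.apex_mem_tunnelSet (h0 : 0 < Θ) (hπ : Θ < Real.pi)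
    (h : IsTunnelMotion G Θ α β p) {φ : ℝ} (hφ : φ ∈ Icc α β) :
    p φ ∈ tunnelSet Θ (leftGuards G Θ α β p) (rightGuards G Θ α β p) := by
  have hs := h.isSweep h0 hπ
  have hmaps : MapsTo p (Ioo α β)
      (tunnelSet Θ (leftGuards G Θ α β p) (rightGuards G Θ α β p)) := by
    intro t ht
    refine mem_iInter₂.2 fun l hl => mem_iInter₂.2 fun r hr => ?_
    obtain ⟨hlG, φl, hφl, hml⟩ := (mem_leftGuards_iff h0 hπ h.lt.le).1 hl
    obtain ⟨hrG, φr, hφr, hmr⟩ := (mem_rightGuards_iff h0 hπ h.lt.le).1 hr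
    exact hs.mem_segmentOf hlG hrG hφl hφr hml hmr ht
  have hcl := hmaps.closure_of_continuousOn (by rw [closure_Ioo h.lt.ne]; exact h.continuousOn)
  rw [closure_Ioo h.lt.ne, (isClosed_tunnelSet h0 hπ _ _).closure_eq] at hcl
  exact hcl hφ

/-- A point of the arc other than `l` and `r` is the apex of a cone touching both, in some direction
`φ`. If `φ` occurs in the motion, membership in `U` identifies the point with `p φ`; otherwise it is
`p α` or `p β`. -/
theorem IsTunnelMotion.mem_tunnelSet_inter_arc (h0 : 0 < Θ) (hπ : Θ < Real.pi)
    (h : IsTunnelMotion G Θ α β p) {l r x : Plane} (hl : l ∈ leftGuards G Θ α β p)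
    (hr : r ∈ rightGuards G Θ α β p)
    (hx : x ∈ tunnelSet Θ (leftGuards G Θ α β p) (rightGuards G Θ α β p) ∩ arc Θ l r) :
    x ∈ ({l, r, p α, p β} : Set Plane) ∪ p '' {φ | φ ∈ Ioo α β ∧ lc Θ φ l = lc Θ φ (p φ) ∧
      rc Θ φ r = rc Θ φ (p φ)} := by
  have hs := h.isSweep h0 hπ
  have hpw : ∀ l' ∈ leftGuards G Θ α β p, ∀ r' ∈ rightGuards G Θ α β p, 0 ≤ pw Θ l' r' x :=
    fun l' hl' r' hr' => ((mem_segmentOf_iff h0 hπ).1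
      (tunnelSet_subset_segmentOf hl' hr' hx.1)).2
  obtain ⟨hlG, φl, hφl, hml⟩ := (mem_leftGuards_iff h0 hπ h.lt.le).1 hl
  obtain ⟨hrG, φr, hφr, hmr⟩ := (mem_rightGuards_iff h0 hπ h.lt.le).1 hr
  have hα : p α ∈ leftGuards G Θ α β p := ⟨h.clockwise_end, Or.inl rfl⟩
  have hβ : p β ∈ rightGuards G Θ α β p := ⟨h.counterclockwise_end, Or.inl rfl⟩
  by_cases hxl : x = l
  · left; simp [hxl]
  by_cases hxr : x = r
  · left; simp [hxr]
  -- The window from `α - π` to `α + π` makes `φ` less than `π` away from `α` when `φ ≤ α`, and less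
  -- than `π` away from `β` when `β ≤ φ`.
  obtain ⟨φ, ⟨hφ1, hφ2⟩, e1, e2, e3, e4⟩ :=
    exists_frame_of_mem_arc h0 hπ hx.2 hxl hxr (α - Real.pi)
  rcases le_or_gt φ α with hle | hgt
  · left
    have := hs.eq_start_of_pw_nonneg h.lt hle (by linarith) e1 e2.le
      (hs.lc_le_of_meetsLeft hlG hφl hml h.lt (left_mem_Icc.2 h.lt.le)) fun r' hr' ψ hψ hm =>
        hpw _ hα _ ((mem_rightGuards_iff h0 hπ h.lt.le).2 ⟨hr', ψ, hψ, hm⟩)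
    simp [this]
  rcases le_or_gt β φ with hle | hlt
  · left
    have := hs.eq_end_of_pw_nonneg h.lt hle (by linarith [h.lt]) e3 e4.le
      (hs.rc_le_of_meetsRight hrG hφr hmr h.lt (right_mem_Icc.2 h.lt.le)) fun l' hl' ψ hψ hm =>
        hpw _ ((mem_leftGuards_iff h0 hπ h.lt.le).2 ⟨hl', ψ, hψ, hm⟩) _ hβ
    simp [this]
  right
  have hφ : φ ∈ Ioo α β := ⟨hgt, hlt⟩
  have hφc := Ioo_subset_Icc_self hφ
  obtain ⟨l', hl', a1, a2⟩ := hs.left φ hφ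
  obtain ⟨r', hr', b1, b2⟩ := hs.right φ hφ
  have c1 := hs.lc_le_of_meetsLeft hlG hφl hml h.lt hφc
  have c2 := hs.rc_le_of_meetsRight hrG hφr hmr h.lt hφc
  have := hs.eq_apex_of_pw_nonneg a1 a2 b1 b2 (e1 ▸ c1) (e3 ▸ c2)
    (hpw _ ((mem_leftGuards_iff h0 hπ h.lt.le).2 ⟨hl', φ, hφc, Or.inr ⟨a1, a2⟩⟩) _
      ((mem_rightGuards_iff h0 hπ h.lt.le).2 ⟨hr', φ, hφc, Or.inr ⟨b1, b2⟩⟩))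
  exact ⟨φ, ⟨hφ, this ▸ e1, this ▸ e3⟩, this.symm⟩

theorem mem_arc_of_touches (h0 : 0 < Θ) (hπ : Θ < Real.pi) {φ : ℝ} {l r x : Plane}
    (hl : lc Θ φ l = lc Θ φ x) (hr : rc Θ φ r = rc Θ φ x) (hx : x ∈ segmentOf Θ l r) :
    x ∈ arc Θ l r := by
  refine (mem_arc_iff h0 hπ).2 ⟨((mem_segmentOf_iff h0 hπ).1 hx).1, ?_⟩
  have f := frame_pw Θ φ l r x
  simp only [lc_sub, rc_sub, hl, hr, sub_self, zero_mul, mul_zero] at f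
  have hs := Real.sin_pos_of_pos_of_lt_pi h0 hπ
  exact (mul_eq_zero.1 (f.trans (by ring))).resolve_left hs.ne'

theorem IsTunnelMotion.touches_Icc (h0 : 0 < Θ) (hπ : Θ < Real.pi)
    (h : IsTunnelMotion G Θ α β p) {l r : Plane} {φ₁ φ₂ : ℝ} (h1 : α ≤ φ₁) (h12 : φ₁ < φ₂)
    (h2 : φ₂ ≤ β) (ht : ∀ t ∈ Ioo φ₁ φ₂, lc Θ t l = lc Θ t (p t) ∧ rc Θ t r = rc Θ t (p t)) :
    ∀ t ∈ Icc φ₁ φ₂, lc Θ t l = lc Θ t (p t) ∧ rc Θ t r = rc Θ t (p t) := by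
  have hs := h.isSweep h0 hπ
  have hsub : Icc φ₁ φ₂ ⊆ Icc α β := Icc_subset_Icc h1 h2
  have hcl : Icc φ₁ φ₂ ⊆ closure (Ioo φ₁ φ₂) := by rw [closure_Ioo h12.ne]
  have e1 : EqOn (fun t => lc Θ t l) (fun t => lc Θ t (p t)) (Icc φ₁ φ₂) :=
    EqOn.of_subset_closure (fun t h => (ht t h).1) (continuous_lc_const Θ l).continuousOn
      (hs.lcCont.mono hsub) Ioo_subset_Icc_self hcl
  have e2 : EqOn (fun t => rc Θ t r) (fun t => rc Θ t (p t)) (Icc φ₁ φ₂) :=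
    EqOn.of_subset_closure (fun t h => (ht t h).2) (continuous_rc_const Θ r).continuousOn
      (hs.rcCont.mono hsub) Ioo_subset_Icc_self hcl
  exact fun t ht => ⟨e1 ht, e2 ht⟩

theorem IsTunnelMotion.apex_mem_inter_arc (h0 : 0 < Θ) (hπ : Θ < Real.pi)
    (h : IsTunnelMotion G Θ α β p) {l r : Plane} (hl : l ∈ leftGuards G Θ α β p)
    (hr : r ∈ rightGuards G Θ α β p) {φ : ℝ} (hφ : φ ∈ Icc α β)
    (ht : lc Θ φ l = lc Θ φ (p φ) ∧ rc Θ φ r = rc Θ φ (p φ)) :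
    p φ ∈ tunnelSet Θ (leftGuards G Θ α β p) (rightGuards G Θ α β p) ∩ arc Θ l r := by
  have hU := h.apex_mem_tunnelSet h0 hπ hφ
  exact ⟨hU, mem_arc_of_touches h0 hπ ht.1 ht.2 (tunnelSet_subset_segmentOf hl hr hU)⟩

/-- The left guards and right guards touched together form a closed interval of directions. -/
theorem IsTunnelMotion.ordConnected_touches (h0 : 0 < Θ) (hπ : Θ < Real.pi)
    (h : IsTunnelMotion G Θ α β p) {l r : Plane} (hl : l ∈ leftGuards G Θ α β p)
    (hr : r ∈ rightGuards G Θ α β p) :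
    OrdConnected {φ | φ ∈ Ioo α β ∧ lc Θ φ l = lc Θ φ (p φ) ∧ rc Θ φ r = rc Θ φ (p φ)} := by
  have hs := h.isSweep h0 hπ
  obtain ⟨hlG, φl, hφl, hml⟩ := (mem_leftGuards_iff h0 hπ h.lt.le).1 hl
  obtain ⟨hrG, φr, hφr, hmr⟩ := (mem_rightGuards_iff h0 hπ h.lt.le).1 hr
  refine ⟨fun s hs1 t ht1 φ hφ => ⟨⟨hs1.1.1.trans_le hφ.1, hφ.2.trans_lt ht1.1.2⟩, ?_, ?_⟩⟩
  · exact hs.lc_eq_of_between hlG hφl hml hs1.1.1 hφ.1 hφ.2 ht1.1.2 hs1.2.1 ht1.2.1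
  · exact hs.rc_eq_of_between hrG hφr hmr hs1.1.1 hφ.1 hφ.2 ht1.1.2 hs1.2.2 ht1.2.2

/-- A boundary arc of the set of a tunnel is the path of the apex while the cone touches a fixed
pair of guards. -/
theorem IsTunnelMotion.exists_isTunnelArc (h0 : 0 < Θ) (hπ : Θ < Real.pi)
    (h : IsTunnelMotion G Θ α β p) {a : Set Plane}
    (ha : a ∈ boundaryArcs Θ (leftGuards G Θ α β p) (rightGuards G Θ α β p)) :
    ∃ l r φ₁ φ₂, IsTunnelArc G Θ α β p l r φ₁ φ₂ ∧ a = p '' Icc φ₁ φ₂ := by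
  obtain ⟨hnt, l, hl, r, hr, x, hx, hax⟩ := ha
  rw [frontier_tunnelSet_inter_arc h0 hπ hl hr] at hx hax
  set S := tunnelSet Θ (leftGuards G Θ α β p) (rightGuards G Θ α β p) ∩ arc Θ l r with hS
  set J := {φ | φ ∈ Ioo α β ∧ lc Θ φ l = lc Θ φ (p φ) ∧ rc Θ φ r = rc Θ φ (p φ)} with hJ
  have haS : a ⊆ S := hax ▸ connectedComponentIn_subset S x
  have hac : IsPreconnected a := hax ▸ isPreconnected_connectedComponentIn
  have hainf : a.Infinite := hac.infinite_of_nontrivial hnt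
  have hSsub : S ⊆ ({l, r, p α, p β} : Set Plane) ∪ p '' J :=
    fun y hy => h.mem_tunnelSet_inter_arc h0 hπ hl hr hy
  have hTfin : ({l, r, p α, p β} : Set Plane).Finite := by simp
  -- A nontrivial connected set in the plane is infinite, so the four exceptional points cannot make
  -- it up.
  have hJinf : J.Infinite := by
    intro hfin
    exact hainf ((hTfin.union (hfin.image p)).subset (haS.trans hSsub))
  have hord : OrdConnected J := h.ordConnected_touches h0 hπ hl hr
  obtain ⟨s, hsJ, t, htJ, hst⟩ := hJinf.nontrivial.exists_lt
  have hbb : BddBelow J := ⟨α, fun φ hφ => hφ.1.1.le⟩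
  have hba : BddAbove J := ⟨β, fun φ hφ => hφ.1.2.le⟩
  have hne : J.Nonempty := ⟨s, hsJ⟩
  have h1 : α ≤ sInf J := le_csInf hne fun φ hφ => hφ.1.1.le
  have h2 : sSup J ≤ β := csSup_le hne fun φ hφ => hφ.1.2.le
  have h12 : sInf J < sSup J := (csInf_le hbb hsJ).trans_lt (hst.trans_le (le_csSup hba htJ))
  have hIoo : ∀ φ ∈ Ioo (sInf J) (sSup J), φ ∈ J := by
    intro φ hφ
    obtain ⟨u, hu, hu'⟩ := exists_lt_of_csInf_lt hne hφ.1
    obtain ⟨v, hv, hv'⟩ := exists_lt_of_lt_csSup hne hφ.2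
    exact hord.out hu hv ⟨hu'.le, hv'.le⟩
  have htouch := h.touches_Icc h0 hπ h1 h12 h2 fun φ hφ => (hIoo φ hφ).2
  have harc : IsTunnelArc G Θ α β p l r (sInf J) (sSup J) :=
    ⟨h, hl, hr, h1, h12, h2, fun φ hφ => ⟨fun ht =>
      ⟨csInf_le hbb ⟨hφ, ht⟩, le_csSup hba ⟨hφ, ht⟩⟩, fun hm => htouch φ hm⟩⟩
  refine ⟨l, r, sInf J, sSup J, harc, ?_⟩
  have hcont : ContinuousOn p (Icc (sInf J) (sSup J)) :=
    h.continuousOn.mono (Icc_subset_Icc h1 h2)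
  have hIS : p '' Icc (sInf J) (sSup J) ⊆ S := by
    rintro _ ⟨φ, hφ, rfl⟩
    exact h.apex_mem_inter_arc h0 hπ hl hr ⟨h1.trans hφ.1, hφ.2.trans h2⟩ (htouch φ hφ)
  have hJI : p '' J ⊆ p '' Icc (sInf J) (sSup J) :=
    image_mono fun φ hφ => ⟨csInf_le hbb hφ, le_csSup hba hφ⟩
  have hIc : IsPreconnected (p '' Icc (sInf J) (sSup J)) := isPreconnected_Icc.image p hcont
  obtain ⟨y, hya, hyT⟩ := hainf.exists_notMem_finite hTfin
  have hyI : y ∈ p '' Icc (sInf J) (sSup J) := hJI ((hSsub (haS hya)).resolve_left hyT)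
  apply subset_antisymm
  · have hcl1 : IsClosed (p '' Icc (sInf J) (sSup J)) :=
      (isCompact_Icc.image_of_continuousOn hcont).isClosed
    have hcl2 : IsClosed (({l, r, p α, p β} : Set Plane) \ p '' Icc (sInf J) (sSup J)) :=
      (hTfin.subset sdiff_subset).isClosed
    have hcov : a ⊆ p '' Icc (sInf J) (sSup J) ∪
        (({l, r, p α, p β} : Set Plane) \ p '' Icc (sInf J) (sSup J)) := by
      intro z hz
      by_cases hzI : z ∈ p '' Icc (sInf J) (sSup J)
      · exact Or.inl hzI
      · exact Or.inr ⟨(hSsub (haS hz)).resolve_right fun hzJ => hzI (hJI hzJ), hzI⟩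
    rcases isPreconnected_iff_subset_of_disjoint_closed.1 hac _ _ hcl1 hcl2 hcov
      (by rw [inter_sdiff_self, inter_empty]) with hsub | hsub
    · exact hsub
    · exact absurd (hsub hya).1 hyT
  · rw [hax]
    have hya' := hya
    rw [hax] at hya'
    rw [connectedComponentIn_eq hya']
    exact hIc.subset_connectedComponentIn hyI hIS

/-- Every intermediate position of the apex lies on a boundary arc. -/
theorem IsTunnelMotion.exists_mem_boundaryArcs (h0 : 0 < Θ) (hπ : Θ < Real.pi)
    (h : IsTunnelMotion G Θ α β p) {φ : ℝ} (hφ : φ ∈ Ioo α β) :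
    ∃ a ∈ boundaryArcs Θ (leftGuards G Θ α β p) (rightGuards G Θ α β p), p φ ∈ a := by
  have hs := h.isSweep h0 hπ
  obtain ⟨l, hl, hfl, hl1, hl2⟩ := hs.exists_frequently_left_nhdsGT hφ.1.le hφ.2
  obtain ⟨r, hr, hfr, hr1, hr2⟩ := hs.exists_frequently_right_nhdsGT hφ.1.le hφ.2
  obtain ⟨s, hs1, hs2, hs3⟩ := hfl.exists
  obtain ⟨t, ht1, ht2, ht3⟩ := hfr.exists
  have hsI : s ∈ Ioo α β := ⟨hφ.1.trans hs1.1, hs1.2⟩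
  have htI : t ∈ Ioo α β := ⟨hφ.1.trans ht1.1, ht1.2⟩
  have hml : IsSweep.MeetsLeft Θ α p s l := Or.inr ⟨hs2, hs3⟩
  have hmr : IsSweep.MeetsRight Θ β p t r := Or.inr ⟨ht2, ht3⟩
  have hlL := (mem_leftGuards_iff h0 hπ h.lt.le).2 ⟨hl, s, Ioo_subset_Icc_self hsI, hml⟩
  have hrR := (mem_rightGuards_iff h0 hπ h.lt.le).2 ⟨hr, t, Ioo_subset_Icc_self htI, hmr⟩
  -- Contact with `l` at `φ` and `s`, and with `r` at `φ` and `t`, persists in between; up to the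
  -- smaller time both are in contact.
  set u := min s t with hu
  have hφu : φ < u := lt_min hs1.1 ht1.1
  have huβ : u < β := (min_le_left s t).trans_lt hs1.2
  have htouch : ∀ ψ ∈ Icc φ u, lc Θ ψ l = lc Θ ψ (p ψ) ∧ rc Θ ψ r = rc Θ ψ (p ψ) := by
    intro ψ hψ
    exact ⟨hs.lc_eq_of_between hl (Ioo_subset_Icc_self hsI) hml hφ.1 hψ.1
        (hψ.2.trans (min_le_left s t)) hsI.2 hl1 hs2,
      hs.rc_eq_of_between hr (Ioo_subset_Icc_self htI) hmr hφ.1 hψ.1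
        (hψ.2.trans (min_le_right s t)) htI.2 hr1 ht2⟩
  set S := tunnelSet Θ (leftGuards G Θ α β p) (rightGuards G Θ α β p) ∩ arc Θ l r with hS
  have hsub : Icc φ u ⊆ Ioo α β := fun ψ hψ => ⟨hφ.1.trans_le hψ.1, hψ.2.trans_lt huβ⟩
  have hIS : p '' Icc φ u ⊆ S := by
    rintro _ ⟨ψ, hψ, rfl⟩
    exact h.apex_mem_inter_arc h0 hπ hlL hrR (Ioo_subset_Icc_self (hsub hψ)) (htouch ψ hψ)
  have hIc : IsPreconnected (p '' Icc φ u) :=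
    isPreconnected_Icc.image p (h.continuousOn.mono (hsub.trans Ioo_subset_Icc_self))
  have hmem : p φ ∈ p '' Icc φ u := mem_image_of_mem p (left_mem_Icc.2 hφu.le)
  have hcomp := hIc.subset_connectedComponentIn hmem hIS
  refine ⟨connectedComponentIn S (p φ), ⟨⟨p φ, hcomp hmem, p u,
    hcomp (mem_image_of_mem p (right_mem_Icc.2 hφu.le)), fun he => ?_⟩, l, hlL, r, hrR, p φ, ?_, ?_⟩,
    hcomp hmem⟩
  · exact hφu.ne (hs.injOn hφ (hsub (right_mem_Icc.2 hφu.le)) he)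
  · rw [frontier_tunnelSet_inter_arc h0 hπ hlL hrR]
    exact hIS hmem
  · rw [frontier_tunnelSet_inter_arc h0 hπ hlL hrR]

end

end GuardedRegion

/-! ### Charging arcs to the events at their counterclockwise ends -/

namespace GuardedRegion

open Set

theorem lc_sub_of_lc_eq {Θ φ : ℝ} {x y : Plane} (h : lc Θ φ x = lc Θ φ y) (t : ℝ) :
    Real.sin Θ * (lc Θ t x - lc Θ t y) = (rc Θ φ x - rc Θ φ y) * Real.sin (t - φ) := by
  have := frame_lc Θ φ t (x - y)
  simpa only [lc_sub, rc_sub, h, sub_self, zero_mul, add_zero] using this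

theorem rc_sub_of_lc_eq {Θ φ : ℝ} {x y : Plane} (h : lc Θ φ x = lc Θ φ y) (t : ℝ) :
    Real.sin Θ * (rc Θ t x - rc Θ t y) = (rc Θ φ x - rc Θ φ y) * Real.sin (φ - t + Θ) := by
  have := frame_rc Θ φ t (x - y)
  simpa only [lc_sub, rc_sub, h, sub_self, zero_mul, add_zero] using this

theorem rc_sub_of_rc_eq {Θ φ : ℝ} {x y : Plane} (h : rc Θ φ x = rc Θ φ y) (t : ℝ) :
    Real.sin Θ * (rc Θ t x - rc Θ t y) = (lc Θ φ x - lc Θ φ y) * Real.sin (φ - t) := by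
  have := frame_rc Θ φ t (x - y)
  simpa only [lc_sub, rc_sub, h, sub_self, zero_mul, zero_add] using this

theorem lc_sub_of_rc_eq {Θ φ : ℝ} {x y : Plane} (h : rc Θ φ x = rc Θ φ y) (t : ℝ) :
    Real.sin Θ * (lc Θ t x - lc Θ t y) = (lc Θ φ x - lc Θ φ y) * Real.sin (t - φ + Θ) := by
  have := frame_lc Θ φ t (x - y)
  simpa only [lc_sub, rc_sub, h, sub_self, zero_mul, zero_add] using this

namespace IsSweep

variable {G : Finset Plane} {Θ α β : ℝ} {p : ℝ → Plane}

theorem exists_touches_left_before (h : IsSweep G Θ α β p) {s : ℝ} (h1 : α < s) (h2 : s ≤ β) :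
    ∃ g ∈ G, (∃ t ∈ Ioo α s, lc Θ t g = lc Θ t (p t) ∧ rc Θ t (p t) < rc Θ t g) ∧
      lc Θ s g = lc Θ s (p s) := by
  obtain ⟨g', hg', hf, e1, -⟩ :=
    h.mirror.exists_frequently_right_nhdsGT (neg_le_neg h2) (neg_lt_neg h1)
  obtain ⟨g, hg, rfl⟩ := Finset.mem_image.1 hg'
  obtain ⟨t, ht1, ht2, ht3⟩ := hf.exists
  rw [rc_mirror, rc_mirror, neg_neg] at e1
  rw [rc_mirror, rc_mirror] at ht2
  rw [lc_mirror, lc_mirror] at ht3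
  exact ⟨g, hg, ⟨-t, ⟨by linarith [ht1.2], by linarith [ht1.1]⟩, ht2, ht3⟩, e1⟩

theorem exists_touches_right_before (h : IsSweep G Θ α β p) {s : ℝ} (h1 : α < s) (h2 : s ≤ β) :
    ∃ g ∈ G, (∃ t ∈ Ioo α s, rc Θ t g = rc Θ t (p t) ∧ lc Θ t (p t) < lc Θ t g) ∧
      rc Θ s g = rc Θ s (p s) := by
  obtain ⟨g', hg', hf, e1, -⟩ :=
    h.mirror.exists_frequently_left_nhdsGT (neg_le_neg h2) (neg_lt_neg h1)
  obtain ⟨g, hg, rfl⟩ := Finset.mem_image.1 hg'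
  obtain ⟨t, ht1, ht2, ht3⟩ := hf.exists
  rw [lc_mirror, lc_mirror, neg_neg] at e1
  rw [lc_mirror, lc_mirror] at ht2
  rw [rc_mirror, rc_mirror] at ht3
  exact ⟨g, hg, ⟨-t, ⟨by linarith [ht1.2], by linarith [ht1.1]⟩, ht2, ht3⟩, e1⟩

end IsSweep

/-- The event that ends a boundary arc with apex `x` in direction `φ`: the apex reaches a guard
(`i = 0`), the left ray leaves the guard `g` (`i = 1`) or the right ray meets the guard `g`
(`i = 2`). -/
def IsEndEvent (G : Finset Plane) (Θ φ : ℝ) (x : Plane) (i : Fin 3) (g : Plane) : Prop :=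
  (i = 0 ∧ g = x ∧ ∃ l ∈ G, lc Θ φ l = lc Θ φ g ∧ rc Θ φ g < rc Θ φ l) ∨
  (i = 1 ∧ (lc Θ φ g = lc Θ φ x ∧ rc Θ φ x < rc Θ φ g) ∧
    (∃ r ∈ G, rc Θ φ r = rc Θ φ x ∧ lc Θ φ x < lc Θ φ r) ∧
    ∃ l ∈ G, lc Θ φ l = lc Θ φ g ∧ rc Θ φ g < rc Θ φ l) ∨
  (i = 2 ∧ (rc Θ φ g = rc Θ φ x ∧ lc Θ φ x < lc Θ φ g) ∧
    (∃ l ∈ G, lc Θ φ l = lc Θ φ x ∧ rc Θ φ x < rc Θ φ l) ∧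
    ∃ r ∈ G, rc Θ φ r = rc Θ φ g ∧ lc Θ φ g < lc Θ φ r)

/-- In the last two kinds, `g` fixes the line of one ray. The guard on the other ray of each cone
must not lie in the other cone, which fixes the position of the apex on this line. -/
theorem IsEndEvent.apex_eq {G : Finset Plane} {Θ φ : ℝ} {x x' g : Plane} {i : Fin 3}
    (h0 : 0 < Θ) (hπ : Θ < Real.pi) (h : IsEndEvent G Θ φ x i g) (h' : IsEndEvent G Θ φ x' i g)
    (he : IsEmptyCone G Θ x φ) (he' : IsEmptyCone G Θ x' φ) : x = x' := by
  rw [isEmptyCone_iff h0 hπ] at he he'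
  rcases h with ⟨rfl, rfl, -⟩ | ⟨rfl, ⟨a1, a2⟩, ⟨r, hr, b1, b2⟩, -⟩ |
    ⟨rfl, ⟨a1, a2⟩, ⟨r, hr, b1, b2⟩, -⟩
  · rcases h' with ⟨-, rfl, -⟩ | ⟨h, -⟩ | ⟨h, -⟩
    · rfl
    · exact absurd h (by decide)
    · exact absurd h (by decide)
  · rcases h' with ⟨h, -⟩ | ⟨-, ⟨c1, c2⟩, ⟨r', hr', d1, d2⟩, -⟩ | ⟨h, -⟩
    · exact absurd h (by decide)
    · refine ext_of_lc_rc h0 hπ (a1.symm.trans c1) (le_antisymm ?_ ?_)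
      · rcases he' r hr with h | h <;> linarith
      · rcases he r' hr' with h | h <;> linarith
    · exact absurd h (by decide)
  · rcases h' with ⟨h, -⟩ | ⟨h, -⟩ | ⟨-, ⟨c1, c2⟩, ⟨r', hr', d1, d2⟩, -⟩
    · exact absurd h (by decide)
    · exact absurd h (by decide)
    · refine ext_of_lc_rc h0 hπ (le_antisymm ?_ ?_) (a1.symm.trans c1)
      · rcases he' r hr with h | h <;> linarith
      · rcases he r' hr' with h | h <;> linarith

/-- The directions of the end events of one kind at one guard differ by at least `Θ`. -/
theorem IsEndEvent.add_le {G : Finset Plane} {Θ φ φ' : ℝ} {x x' g : Plane} {i : Fin 3}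
    (h0 : 0 < Θ) (hπ : Θ < Real.pi) (h : IsEndEvent G Θ φ x i g) (h' : IsEndEvent G Θ φ' x' i g)
    (he : IsEmptyCone G Θ x φ) (he' : IsEmptyCone G Θ x' φ') (hlt : φ < φ') : φ + Θ ≤ φ' := by
  by_contra hcon
  have hs := Real.sin_pos_of_pos_of_lt_pi h0 hπ
  have s1 := Real.sin_pos_of_pos_of_lt_pi (x := φ' - φ) (by linarith) (by linarith)
  have s2 := Real.sin_pos_of_pos_of_lt_pi (x := φ - φ' + Θ) (by linarith) (by linarith)
  rw [isEmptyCone_iff h0 hπ] at he he'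
  -- A guard farther out than `g` on the left ray is inside the cone at `g` turned counterclockwise
  -- by less than `Θ`. That cone lies in the empty cone at `x'`.
  have left : ∀ l ∈ G, lc Θ φ l = lc Θ φ g → rc Θ φ g < rc Θ φ l → lc Θ φ' x' ≤ lc Θ φ' g →
      rc Θ φ' x' ≤ rc Θ φ' g → False := by
    intro l hl e1 e2 e3 e4
    have f1 := lc_sub_of_lc_eq e1 φ'
    have f2 := rc_sub_of_lc_eq e1 φ'
    have m1 := mul_pos (sub_pos.2 e2) s1
    have m2 := mul_pos (sub_pos.2 e2) s2
    rw [← f1] at m1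
    rw [← f2] at m2
    have n1 := (pos_iff_pos_of_mul_pos m1).1 hs
    have n2 := (pos_iff_pos_of_mul_pos m2).1 hs
    rcases he' l hl with h | h <;> linarith
  rcases h with ⟨rfl, rfl, l, hl, b1, b2⟩ | ⟨rfl, ⟨a1, a2⟩, -, l, hl, b1, b2⟩ |
    ⟨rfl, ⟨a1, a2⟩, -, -⟩
  · rcases h' with ⟨-, rfl, -⟩ | ⟨h, -⟩ | ⟨h, -⟩
    · exact left l hl b1 b2 le_rfl le_rfl
    · exact absurd h (by decide)
    · exact absurd h (by decide)
  · rcases h' with ⟨h, -⟩ | ⟨-, ⟨c1, c2⟩, -, -⟩ | ⟨h, -⟩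
    · exact absurd h (by decide)
    · exact left l hl b1 b2 c1.ge c2.le
    · exact absurd h (by decide)
  · rcases h' with ⟨h, -⟩ | ⟨h, -⟩ | ⟨-, -, -, r, hr, b1, b2⟩
    · exact absurd h (by decide)
    · exact absurd h (by decide)
    -- For the right ray, time is reversed: the farther guard `r` at the later event is inside the
    -- cone of the earlier one.
    · have f1 := rc_sub_of_rc_eq b1 φ
      have f2 := lc_sub_of_rc_eq b1 φ
      have m1 := mul_pos (sub_pos.2 b2) s1
      have m2 := mul_pos (sub_pos.2 b2) s2
      rw [← f1] at m1
      rw [← f2] at m2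
      have n1 := (pos_iff_pos_of_mul_pos m1).1 hs
      have n2 := (pos_iff_pos_of_mul_pos m2).1 hs
      rcases he r hr with h | h <;> linarith

namespace IsTunnelArc

variable {G : Finset Plane} {Θ α β α' β' : ℝ} {p p' : ℝ → Plane} {l r l' r' : Plane}
  {φ₁ φ₂ φ₁' : ℝ}

theorem left_mem_guards (h : IsTunnelArc G Θ α β p l r φ₁ φ₂) : l ∈ G := h.left_mem.1

theorem right_mem_guards (h : IsTunnelArc G Θ α β p l r φ₁ φ₂) : r ∈ G := h.right_mem.1

theorem touches (h0 : 0 < Θ) (hπ : Θ < Real.pi) (h : IsTunnelArc G Θ α β p l r φ₁ φ₂) :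
    ∀ t ∈ Icc φ₁ φ₂, lc Θ t l = lc Θ t (p t) ∧ rc Θ t r = rc Θ t (p t) :=
  h.motion.touches_Icc h0 hπ h.le_left h.lt h.le_right fun t ht =>
    (h.touches_iff t ⟨h.le_left.trans_lt ht.1, ht.2.trans_le h.le_right⟩).2
      (Ioo_subset_Icc_self ht)

theorem rc_lt (h0 : 0 < Θ) (hπ : Θ < Real.pi) (h : IsTunnelArc G Θ α β p l r φ₁ φ₂) {φ : ℝ}
    (hφ : φ ∈ Ioo α β) : rc Θ φ (p φ) < rc Θ φ l := by
  obtain ⟨hl, ψ, hψ, hm⟩ := (mem_leftGuards_iff h0 hπ h.motion.lt.le).1 h.left_mem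
  exact (h.motion.isSweep h0 hπ).rc_lt_of_meetsLeft hl hψ hm hφ

theorem lc_lt (h0 : 0 < Θ) (hπ : Θ < Real.pi) (h : IsTunnelArc G Θ α β p l r φ₁ φ₂) {φ : ℝ}
    (hφ : φ ∈ Ioo α β) : lc Θ φ (p φ) < lc Θ φ r := by
  obtain ⟨hr, ψ, hψ, hm⟩ := (mem_rightGuards_iff h0 hπ h.motion.lt.le).1 h.right_mem
  exact (h.motion.isSweep h0 hπ).lc_lt_of_meetsRight hr hψ hm hφ

theorem lc_le (h0 : 0 < Θ) (hπ : Θ < Real.pi) (h : IsTunnelArc G Θ α β p l r φ₁ φ₂) {φ : ℝ}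
    (hφ : φ ∈ Icc α β) : lc Θ φ l ≤ lc Θ φ (p φ) := by
  obtain ⟨hl, ψ, hψ, hm⟩ := (mem_leftGuards_iff h0 hπ h.motion.lt.le).1 h.left_mem
  exact (h.motion.isSweep h0 hπ).lc_le_of_meetsLeft hl hψ hm h.motion.lt hφ

theorem rc_le (h0 : 0 < Θ) (hπ : Θ < Real.pi) (h : IsTunnelArc G Θ α β p l r φ₁ φ₂) {φ : ℝ}
    (hφ : φ ∈ Icc α β) : rc Θ φ r ≤ rc Θ φ (p φ) := by
  obtain ⟨hr, ψ, hψ, hm⟩ := (mem_rightGuards_iff h0 hπ h.motion.lt.le).1 h.right_mem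
  exact (h.motion.isSweep h0 hπ).rc_le_of_meetsRight hr hψ hm h.motion.lt hφ

/-- Even at `φ₂ = β` the left guard is not the apex: `p β` is strictly right of the left ray at
earlier times, whereas `l` is on it. -/
theorem rc_lt_end (h0 : 0 < Θ) (hπ : Θ < Real.pi) (h : IsTunnelArc G Θ α β p l r φ₁ φ₂) :
    rc Θ φ₂ (p φ₂) < rc Θ φ₂ l := by
  have hs := h.motion.isSweep h0 hπ
  rcases eq_or_lt_of_le h.le_right with rfl | hlt
  · obtain ⟨hl, ψ, hψ, hm⟩ := (mem_leftGuards_iff h0 hπ h.motion.lt.le).1 h.left_mem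
    refine lt_of_le_of_ne (hs.rc_le_of_meetsLeft hl hψ hm h.motion.lt
      (right_mem_Icc.2 h.motion.lt.le)) fun he => ?_
    have heq : l = p φ₂ := ext_of_lc_rc h0 hπ
      (h.touches h0 hπ φ₂ (right_mem_Icc.2 h.lt.le)).1 he.symm
    obtain ⟨t, ht1, ht2⟩ := exists_between h.lt
    have htI : t ∈ Ioo α φ₂ := ⟨h.le_left.trans_lt ht1, ht2⟩
    have e1 := hs.lc_lt_of_meetsRight h.motion.counterclockwise_end
      (right_mem_Icc.2 h.motion.lt.le) (Or.inl ⟨rfl, rfl⟩) htI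
    have e2 := (h.touches h0 hπ t ⟨ht1.le, ht2.le⟩).1
    rw [heq] at e2
    linarith
  · exact h.rc_lt h0 hπ ⟨h.le_left.trans_lt h.lt, hlt⟩

theorem lc_le_end (h0 : 0 < Θ) (hπ : Θ < Real.pi) (h : IsTunnelArc G Θ α β p l r φ₁ φ₂) :
    lc Θ φ₂ (p φ₂) ≤ lc Θ φ₂ r := by
  obtain ⟨hr, ψ, hψ, hm⟩ := (mem_rightGuards_iff h0 hπ h.motion.lt.le).1 h.right_mem
  exact (h.motion.isSweep h0 hπ).lc_le_of_meetsRight hr hψ hm h.motion.lt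
    ⟨h.le_left.trans h.lt.le, h.le_right⟩

/-- Just before the end, the left ray can only rest on the nearest guard of the final left ray: if
it rested on a farther one, the nearer would be inside the cone. On the right ray it is the
farthest. -/
theorem left_rc_le (h0 : 0 < Θ) (hπ : Θ < Real.pi) (h : IsTunnelArc G Θ α β p l r φ₁ φ₂)
    (h' : IsTunnelArc G Θ α' β' p' l' r' φ₁' φ₂) (he : p φ₂ = p' φ₂) :
    rc Θ φ₂ l' ≤ rc Θ φ₂ l := by
  by_contra hcon
  have hs' := h'.motion.isSweep h0 hπ
  obtain ⟨c, hc1, hc2, hc3⟩ := exists_forall_Ioc_lt hs'.rcCont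
    (continuous_rc_const Θ l).continuousOn (h'.le_left.trans_lt h'.lt) h'.le_right
    (he ▸ h.rc_lt_end h0 hπ)
  obtain ⟨t, ht1, ht2⟩ := exists_between (max_lt (max_lt hc2 h'.lt)
    (show φ₂ - Real.pi < φ₂ by linarith))
  have t1 := ((le_max_left _ _).trans (le_max_left _ _)).trans_lt ht1
  have t2 := ((le_max_right _ _).trans (le_max_left _ _)).trans_lt ht1
  have t3 := (le_max_right _ _).trans_lt ht1
  have e1 := hs'.lc_le ⟨hc1.trans t1.le, ht2.le.trans h'.le_right⟩ h.left_mem_guards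
    (hc3 t ⟨t1, ht2.le⟩)
  have e2 := (h'.touches h0 hπ t ⟨t2.le, ht2.le⟩).1
  have e3 := (h.touches h0 hπ φ₂ (right_mem_Icc.2 h.lt.le)).1
  have e4 := (h'.touches h0 hπ φ₂ (right_mem_Icc.2 h'.lt.le)).1
  have f := lc_sub_of_lc_eq ((e4.trans (he ▸ rfl)).trans e3.symm) t
  rw [← neg_sub φ₂ t, Real.sin_neg] at f
  have m := mul_pos (sub_pos.2 (not_le.1 hcon))
    (Real.sin_pos_of_pos_of_lt_pi (x := φ₂ - t) (by linarith) (by linarith))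
  have n := mul_nonneg hs'.sin_pos.le (show 0 ≤ lc Θ t l' - lc Θ t l by linarith)
  linarith

theorem right_lc_le (h0 : 0 < Θ) (hπ : Θ < Real.pi) (h : IsTunnelArc G Θ α β p l r φ₁ φ₂)
    (h' : IsTunnelArc G Θ α' β' p' l' r' φ₁' φ₂) (he : p φ₂ = p' φ₂) :
    lc Θ φ₂ r' ≤ lc Θ φ₂ r := by
  by_contra hcon
  have hs := h.motion.isSweep h0 hπ
  obtain ⟨c, hc1, hc2, hc3⟩ := exists_forall_Ioc_lt hs.lcCont
    (continuous_lc_const Θ r').continuousOn (h.le_left.trans_lt h.lt) h.le_right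
    ((h.lc_le_end h0 hπ).trans_lt (not_le.1 hcon))
  obtain ⟨t, ht1, ht2⟩ := exists_between (max_lt (max_lt hc2 h.lt)
    (show φ₂ - Real.pi < φ₂ by linarith))
  have t1 := ((le_max_left _ _).trans (le_max_left _ _)).trans_lt ht1
  have t2 := ((le_max_right _ _).trans (le_max_left _ _)).trans_lt ht1
  have t3 := (le_max_right _ _).trans_lt ht1
  have e1 := hs.rc_le ⟨hc1.trans t1.le, ht2.le.trans h.le_right⟩ h'.right_mem_guards
    (hc3 t ⟨t1, ht2.le⟩)
  have e2 := (h.touches h0 hπ t ⟨t2.le, ht2.le⟩).2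
  have e3 := (h.touches h0 hπ φ₂ (right_mem_Icc.2 h.lt.le)).2
  have e4 := (h'.touches h0 hπ φ₂ (right_mem_Icc.2 h'.lt.le)).2
  have f := rc_sub_of_rc_eq ((e4.trans (he ▸ rfl)).trans e3.symm) t
  have m := mul_pos (sub_pos.2 (not_le.1 hcon))
    (Real.sin_pos_of_pos_of_lt_pi (x := φ₂ - t) (by linarith) (by linarith))
  have n := mul_nonneg hs.sin_pos.le (show 0 ≤ rc Θ t r - rc Θ t r' by linarith)
  linarith

theorem guards_eq (h0 : 0 < Θ) (hπ : Θ < Real.pi) (h : IsTunnelArc G Θ α β p l r φ₁ φ₂)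
    (h' : IsTunnelArc G Θ α' β' p' l' r' φ₁' φ₂) (he : p φ₂ = p' φ₂) : l = l' ∧ r = r' := by
  obtain ⟨a1, a2⟩ := h.touches h0 hπ φ₂ (right_mem_Icc.2 h.lt.le)
  obtain ⟨b1, b2⟩ := h'.touches h0 hπ φ₂ (right_mem_Icc.2 h'.lt.le)
  rw [he] at a1 a2
  exact ⟨ext_of_lc_rc h0 hπ (a1.trans b1.symm) (le_antisymm (h'.left_rc_le h0 hπ h he.symm)
      (h.left_rc_le h0 hπ h' he)),
    ext_of_lc_rc h0 hπ (le_antisymm (h'.right_lc_le h0 hπ h he.symm)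
      (h.right_lc_le h0 hπ h' he)) (a2.trans b2.symm)⟩

/-- Suppose the second arc starts earlier. The pair and the direction fix the apex, so the motions
agree at `φ₁`. Just before `φ₁`, the first motion touches a guard outside the pair, by maximality;
this guard would be inside the cone of the second motion. -/
theorem start_le (h0 : 0 < Θ) (hπ : Θ < Real.pi) (h : IsTunnelArc G Θ α β p l r φ₁ φ₂)
    (h' : IsTunnelArc G Θ α' β' p' l r φ₁' φ₂) : φ₁ ≤ φ₁' := by
  by_contra hcon
  have hlt : φ₁' < φ₁ := not_le.1 hcon
  have hs := h.motion.isSweep h0 hπ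
  have hs' := h'.motion.isSweep h0 hπ
  have hφ' : φ₁ ∈ Ioo α' β' := ⟨h'.le_left.trans_lt hlt, h.lt.trans_le h'.le_right⟩
  obtain ⟨a1, a2⟩ := h.touches h0 hπ φ₁ (left_mem_Icc.2 h.lt.le)
  obtain ⟨b1, b2⟩ := h'.touches h0 hπ φ₁ ⟨hlt.le, h.lt.le⟩
  have hp : p φ₁ = p' φ₁ := ext_of_lc_rc h0 hπ (a1.symm.trans b1) (a2.symm.trans b2)
  have hα : α < φ₁ := by
    refine lt_of_le_of_ne h.le_left fun he => hs'.notMem φ₁ hφ' ?_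
    rw [← hp, ← he]
    exact h.motion.clockwise_end
  have hφ : φ₁ ∈ Ioo α β := ⟨hα, h.lt.trans_le h.le_right⟩
  obtain ⟨k, hk, ⟨s, hs1, hs2, hs3⟩, hk1⟩ := hs.exists_touches_left_before hα hφ.2.le
  obtain ⟨q, hq, ⟨t, ht1, ht2, ht3⟩, hq1⟩ := hs.exists_touches_right_before hα hφ.2.le
  have hsI : s ∈ Ioo α β := ⟨hs1.1, hs1.2.trans hφ.2⟩
  have htI : t ∈ Ioo α β := ⟨ht1.1, ht1.2.trans hφ.2⟩
  have hmk : IsSweep.MeetsLeft Θ α p s k := Or.inr ⟨hs2, hs3⟩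
  have hmq : IsSweep.MeetsRight Θ β p t q := Or.inr ⟨ht2, ht3⟩
  have spos : ∀ u ∈ Ioo α φ₁, 0 < Real.sin (φ₁ - u) := fun u hu =>
    Real.sin_pos_of_pos_of_lt_pi (by linarith [hu.2])
      (by linarith [hs.sub_le hu.1.le hφ.2.le hu.2])
  have spos' : ∀ u ∈ Ioo α' φ₁, 0 < Real.sin (φ₁ - u) := fun u hu =>
    Real.sin_pos_of_pos_of_lt_pi (by linarith [hu.2])
      (by linarith [hs'.sub_le hu.1.le hφ'.2.le hu.2])
  by_cases hkl : k = l
  · by_cases hqr : q = r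
    · subst hkl hqr
      have hu1 : max s t < φ₁ := max_lt hs1.2 ht1.2
      have hu2 : max s t ∈ Ioo α β := ⟨hs1.1.trans_le (le_max_left _ _), hu1.trans hφ.2⟩
      have := (h.touches_iff _ hu2).1
        ⟨hs.lc_eq_of_between hk (Ioo_subset_Icc_self hsI) hmk hs1.1 (le_max_left _ _) hu1.le hφ.2
          hs2 hk1,
        hs.rc_eq_of_between hq (Ioo_subset_Icc_self htI) hmq ht1.1 (le_max_right _ _) hu1.le hφ.2
          ht2 hq1⟩
      exact absurd this.1 (not_le.2 hu1)
    · have f := rc_sub_of_rc_eq (hq1.trans a2.symm) t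
      have e1 := h.rc_le h0 hπ (Ioo_subset_Icc_self htI)
      have m1 := mul_nonneg hs.sin_pos.le (show 0 ≤ rc Θ t q - rc Θ t r by linarith)
      rw [f] at m1
      have e2 := nonneg_of_mul_nonneg_left m1 (spos t ht1)
      have e3 : lc Θ φ₁ r < lc Θ φ₁ q := lt_of_le_of_ne (by linarith) fun he =>
        hqr (ext_of_lc_rc h0 hπ he.symm (hq1.trans a2.symm))
      have e4 : lc Θ φ₁ (p' φ₁) < lc Θ φ₁ q := (h'.lc_lt h0 hπ hφ').trans e3
      obtain ⟨c, hc1, hc2, hc3⟩ := exists_forall_Ioc_lt hs'.lcCont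
        (continuous_lc_const Θ q).continuousOn hφ'.1 hφ'.2.le e4
      obtain ⟨u, hu1, hu2⟩ := exists_between (max_lt hc2 hlt)
      have u1 := (le_max_left _ _).trans_lt hu1
      have u2 := (le_max_right _ _).trans_lt hu1
      have e5 := hs'.rc_le ⟨hc1.trans u1.le, (hu2.trans hφ'.2).le⟩ hq (hc3 u ⟨u1, hu2.le⟩)
      have e6 := (h'.touches h0 hπ u ⟨u2.le, (hu2.trans h.lt).le⟩).2
      have g := rc_sub_of_rc_eq (hq1.trans a2.symm) u
      have m2 := mul_pos (sub_pos.2 e3) (spos' u ⟨hc1.trans_lt u1, hu2⟩)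
      have m3 := mul_nonneg hs.sin_pos.le (show 0 ≤ rc Θ u r - rc Θ u q by linarith)
      linarith
  · have f := lc_sub_of_lc_eq (hk1.trans a1.symm) s
    rw [← neg_sub φ₁ s, Real.sin_neg] at f
    have e1 := h.lc_le h0 hπ (Ioo_subset_Icc_self hsI)
    have m1 := mul_nonneg hs.sin_pos.le (show 0 ≤ lc Θ s k - lc Θ s l by linarith)
    have m1' : 0 ≤ (rc Θ φ₁ l - rc Θ φ₁ k) * Real.sin (φ₁ - s) := by linarith
    have e2 := nonneg_of_mul_nonneg_left m1' (spos s hs1)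
    have e3 : rc Θ φ₁ k < rc Θ φ₁ l := lt_of_le_of_ne (by linarith) fun he =>
      hkl (ext_of_lc_rc h0 hπ (hk1.trans a1.symm) he)
    have e4 : rc Θ φ₁ (p' φ₁) < rc Θ φ₁ k :=
      hp ▸ hs.rc_lt_of_meetsLeft hk (Ioo_subset_Icc_self hsI) hmk hφ
    obtain ⟨c, hc1, hc2, hc3⟩ := exists_forall_Ioc_lt hs'.rcCont
      (continuous_rc_const Θ k).continuousOn hφ'.1 hφ'.2.le e4
    obtain ⟨u, hu1, hu2⟩ := exists_between (max_lt hc2 hlt)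
    have u1 := (le_max_left _ _).trans_lt hu1
    have u2 := (le_max_right _ _).trans_lt hu1
    have e5 := hs'.lc_le ⟨hc1.trans u1.le, (hu2.trans hφ'.2).le⟩ hk (hc3 u ⟨u1, hu2.le⟩)
    have e6 := (h'.touches h0 hπ u ⟨u2.le, (hu2.trans h.lt).le⟩).1
    have g := lc_sub_of_lc_eq (hk1.trans a1.symm) u
    rw [← neg_sub φ₁ u, Real.sin_neg] at g
    have m2 := mul_pos (sub_pos.2 e3) (spos' u ⟨hc1.trans_lt u1, hu2⟩)
    have m3 := mul_nonneg hs.sin_pos.le (show 0 ≤ lc Θ u l - lc Θ u k by linarith)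
    linarith

/-- A tunnel arc is determined by its counterclockwise end. -/
theorem image_eq (h0 : 0 < Θ) (hπ : Θ < Real.pi) (h : IsTunnelArc G Θ α β p l r φ₁ φ₂)
    (h' : IsTunnelArc G Θ α' β' p' l' r' φ₁' φ₂) (he : p φ₂ = p' φ₂) :
    p '' Icc φ₁ φ₂ = p' '' Icc φ₁' φ₂ := by
  obtain ⟨rfl, rfl⟩ := h.guards_eq h0 hπ h' he
  obtain rfl : φ₁ = φ₁' := le_antisymm (h.start_le h0 hπ h') (h'.start_le h0 hπ h)
  refine image_congr fun t ht => ?_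
  obtain ⟨a1, a2⟩ := h.touches h0 hπ t ht
  obtain ⟨b1, b2⟩ := h'.touches h0 hπ t ht
  exact ext_of_lc_rc h0 hπ (a1.symm.trans b1) (a2.symm.trans b2)

/-- If the arc ends before `β`, maximality shows that the guards touched just afterwards are not
both `l` and `r`. A new left guard is farther out, so the left ray leaves `l`; a new right guard is
nearer, so the right ray meets it. -/
theorem exists_isEndEvent (h0 : 0 < Θ) (hπ : Θ < Real.pi)
    (h : IsTunnelArc G Θ α β p l r φ₁ φ₂) :
    ∃ i, ∃ g ∈ G, IsEndEvent G Θ φ₂ (p φ₂) i g := by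
  have hs := h.motion.isSweep h0 hπ
  obtain ⟨a1, a2⟩ := h.touches h0 hπ φ₂ (right_mem_Icc.2 h.lt.le)
  rcases eq_or_lt_of_le h.le_right with rfl | hlt
  · exact ⟨0, p φ₂, h.motion.counterclockwise_end, Or.inl ⟨rfl, rfl, l, h.left_mem_guards, a1,
      h.rc_lt_end h0 hπ⟩⟩
  have hφ : φ₂ ∈ Ioo α β := ⟨h.le_left.trans_lt h.lt, hlt⟩
  obtain ⟨k, hk, hfk, hk1, -⟩ := hs.exists_frequently_left_nhdsGT hφ.1.le hφ.2
  obtain ⟨q, hq, hfq, hq1, -⟩ := hs.exists_frequently_right_nhdsGT hφ.1.le hφ.2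
  obtain ⟨s, hs1, hs2, hs3⟩ := hfk.exists
  obtain ⟨t, ht1, ht2, ht3⟩ := hfq.exists
  have hsI : s ∈ Ioo α β := ⟨hφ.1.trans hs1.1, hs1.2⟩
  have htI : t ∈ Ioo α β := ⟨hφ.1.trans ht1.1, ht1.2⟩
  have hmk : IsSweep.MeetsLeft Θ α p s k := Or.inr ⟨hs2, hs3⟩
  have hmq : IsSweep.MeetsRight Θ β p t q := Or.inr ⟨ht2, ht3⟩
  have spos : ∀ u ∈ Ioo φ₂ β, 0 < Real.sin (u - φ₂) := fun u hu =>
    Real.sin_pos_of_pos_of_lt_pi (by linarith [hu.1])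
      (by linarith [hs.sub_le hφ.1.le hu.2.le hu.1])
  by_cases hkl : k = l
  · by_cases hqr : q = r
    · subst hkl hqr
      have hu1 : φ₂ < min s t := lt_min hs1.1 ht1.1
      have hu2 : min s t ∈ Ioo α β := ⟨hφ.1.trans hu1, (min_le_left _ _).trans_lt hs1.2⟩
      have := (h.touches_iff _ hu2).1
        ⟨hs.lc_eq_of_between hk (Ioo_subset_Icc_self hsI) hmk hφ.1 hu1.le (min_le_left _ _) hs1.2
          hk1 hs2,
        hs.rc_eq_of_between hq (Ioo_subset_Icc_self htI) hmq hφ.1 hu1.le (min_le_right _ _) ht1.2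
          hq1 ht2⟩
      exact absurd this.2 (not_le.2 hu1)
    · have f := rc_sub_of_rc_eq (hq1.trans a2.symm) t
      rw [← neg_sub t φ₂, Real.sin_neg] at f
      have e1 := h.rc_le h0 hπ (Ioo_subset_Icc_self htI)
      have m1 := mul_nonneg hs.sin_pos.le (show 0 ≤ rc Θ t q - rc Θ t r by linarith)
      have m1' : 0 ≤ (lc Θ φ₂ r - lc Θ φ₂ q) * Real.sin (t - φ₂) := by linarith
      have e2 := nonneg_of_mul_nonneg_left m1' (spos t ht1)
      have e3 : lc Θ φ₂ q < lc Θ φ₂ r := lt_of_le_of_ne (by linarith) fun he =>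
        hqr (ext_of_lc_rc h0 hπ he (hq1.trans a2.symm))
      exact ⟨2, q, hq, Or.inr (Or.inr ⟨rfl, ⟨hq1, hs.lc_lt_of_meetsRight hq
        (Ioo_subset_Icc_self htI) hmq hφ⟩, ⟨l, h.left_mem_guards, a1, h.rc_lt_end h0 hπ⟩,
        r, h.right_mem_guards, a2.trans hq1.symm, e3⟩)⟩
  · have f := lc_sub_of_lc_eq (hk1.trans a1.symm) s
    have e1 := h.lc_le h0 hπ (Ioo_subset_Icc_self hsI)
    have m1 := mul_nonneg hs.sin_pos.le (show 0 ≤ lc Θ s k - lc Θ s l by linarith)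
    rw [f] at m1
    have e2 := nonneg_of_mul_nonneg_left m1 (spos s hs1)
    have e3 : rc Θ φ₂ l < rc Θ φ₂ k := lt_of_le_of_ne (by linarith) fun he =>
      hkl (ext_of_lc_rc h0 hπ (hk1.trans a1.symm) he.symm)
    exact ⟨1, l, h.left_mem_guards, Or.inr (Or.inl ⟨rfl, ⟨a1, h.rc_lt_end h0 hπ⟩,
      ⟨r, h.right_mem_guards, a2, h.lc_lt h0 hπ hφ⟩, k, hk, hk1.trans a1.symm, e3⟩)⟩

end IsTunnelArc

end GuardedRegion

/-! ### Periodicity in the direction and the number of arcs -/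

namespace GuardedRegion

open Set

theorem dir_sub_int_mul (φ : ℝ) (n : ℤ) : dir (φ - n * (2 * Real.pi)) = dir φ := by
  apply plane_ext
  · simp only [dir_zero]; exact Real.cos_sub_int_mul_two_pi φ n
  · simp only [dir_one]; exact Real.sin_sub_int_mul_two_pi φ n

theorem lc_sub_int_mul (Θ φ : ℝ) (n : ℤ) (x : Plane) :
    lc Θ (φ - n * (2 * Real.pi)) x = lc Θ φ x := by
  rw [lc, show φ - n * (2 * Real.pi) + Θ / 2 = φ + Θ / 2 - n * (2 * Real.pi) by ring,
    dir_sub_int_mul, lc]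

theorem rc_sub_int_mul (Θ φ : ℝ) (n : ℤ) (x : Plane) :
    rc Θ (φ - n * (2 * Real.pi)) x = rc Θ φ x := by
  rw [rc, show φ - n * (2 * Real.pi) - Θ / 2 = φ - Θ / 2 - n * (2 * Real.pi) by ring,
    dir_sub_int_mul, rc]

theorem lc_add_int_mul (Θ φ : ℝ) (n : ℤ) (x : Plane) :
    lc Θ (φ + n * (2 * Real.pi)) x = lc Θ φ x := by
  rw [← lc_sub_int_mul Θ (φ + n * (2 * Real.pi)) n, add_sub_cancel_right]

theorem rc_add_int_mul (Θ φ : ℝ) (n : ℤ) (x : Plane) :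
    rc Θ (φ + n * (2 * Real.pi)) x = rc Θ φ x := by
  rw [← rc_sub_int_mul Θ (φ + n * (2 * Real.pi)) n, add_sub_cancel_right]

variable {G : Finset Plane} {Θ α β : ℝ} {p : ℝ → Plane}

theorem IsSweep.shift (h : IsSweep G Θ α β p) (n : ℤ) :
    IsSweep G Θ (α + n * (2 * Real.pi)) (β + n * (2 * Real.pi))
      (fun φ => p (φ - n * (2 * Real.pi))) := by
  have hI : ∀ {φ}, φ ∈ Icc (α + n * (2 * Real.pi)) (β + n * (2 * Real.pi)) →
      φ - n * (2 * Real.pi) ∈ Icc α β :=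
    fun h => ⟨by linarith [h.1], by linarith [h.2]⟩
  have hO : ∀ {φ}, φ ∈ Ioo (α + n * (2 * Real.pi)) (β + n * (2 * Real.pi)) →
      φ - n * (2 * Real.pi) ∈ Ioo α β :=
    fun h => ⟨by linarith [h.1], by linarith [h.2]⟩
  refine ⟨h.pos, h.lt_pi, h.cont.comp (by fun_prop) fun φ hφ => hI hφ, fun φ hφ => ?_,
    fun φ hφ => ?_, fun φ hφ => ?_, fun φ hφ => h.notMem _ (hO hφ)⟩
  · simpa only [lc_sub_int_mul, rc_sub_int_mul] using h.empty _ (hI hφ)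
  · simpa only [lc_sub_int_mul, rc_sub_int_mul] using h.left _ (hO hφ)
  · simpa only [lc_sub_int_mul, rc_sub_int_mul] using h.right _ (hO hφ)

theorem IsTunnelArc.shift {l r : Plane} {φ₁ φ₂ : ℝ} (h0 : 0 < Θ) (hπ : Θ < Real.pi)
    (h : IsTunnelArc G Θ α β p l r φ₁ φ₂) (n : ℤ) :
    IsTunnelArc G Θ (α + n * (2 * Real.pi)) (β + n * (2 * Real.pi))
      (fun φ => p (φ - n * (2 * Real.pi))) l r (φ₁ + n * (2 * Real.pi))
      (φ₂ + n * (2 * Real.pi)) := by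
  have hαβ := h.motion.lt
  obtain ⟨hl, ψ, hψ, hml⟩ := (mem_leftGuards_iff h0 hπ hαβ.le).1 h.left_mem
  obtain ⟨hr, χ, hχ, hmr⟩ := (mem_rightGuards_iff h0 hπ hαβ.le).1 h.right_mem
  have hlt : α + n * (2 * Real.pi) < β + n * (2 * Real.pi) := by linarith
  refine ⟨((h.motion.isSweep h0 hπ).shift n).isTunnelMotion hlt ?_ ?_, ?_, ?_, ?_, ?_, ?_, ?_⟩
  · simpa using h.motion.clockwise_end
  · simpa using h.motion.counterclockwise_end
  · refine (mem_leftGuards_iff h0 hπ hlt.le).2 ⟨hl, ψ + n * (2 * Real.pi),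
      ⟨by linarith [hψ.1], by linarith [hψ.2]⟩, ?_⟩
    rcases hml with ⟨rfl, rfl⟩ | hm
    · left; simp
    · right
      simpa only [lc_add_int_mul, rc_add_int_mul, add_sub_cancel_right] using hm
  · refine (mem_rightGuards_iff h0 hπ hlt.le).2 ⟨hr, χ + n * (2 * Real.pi),
      ⟨by linarith [hχ.1], by linarith [hχ.2]⟩, ?_⟩
    rcases hmr with ⟨rfl, rfl⟩ | hm
    · left; simp
    · right
      simpa only [lc_add_int_mul, rc_add_int_mul, add_sub_cancel_right] using hm
  · linarith [h.le_left]
  · linarith [h.lt]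
  · linarith [h.le_right]
  · intro φ hφ
    have := h.touches_iff (φ - n * (2 * Real.pi)) ⟨by linarith [hφ.1], by linarith [hφ.2]⟩
    rw [lc_sub_int_mul, lc_sub_int_mul, rc_sub_int_mul, rc_sub_int_mul] at this
    rw [this]
    constructor <;> rintro ⟨h1, h2⟩ <;> constructor <;> linarith

theorem image_Icc_shift (p : ℝ → Plane) (a b c : ℝ) :
    (fun φ => p (φ - c)) '' Icc (a + c) (b + c) = p '' Icc a b := by
  have := image_sub_const_Icc c (a + c) (b + c)
  rw [add_sub_cancel_right, add_sub_cancel_right] at this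
  rw [← this, image_image]

/-- A description of an arc by its counterclockwise end. -/
def IsArcWithEnd (G : Finset Plane) (Θ : ℝ) (a : Set Plane) (i : Fin 3) (g : Plane) (φ : ℝ) :
    Prop :=
  ∃ α β p l r φ₁, IsTunnelArc G Θ α β p l r φ₁ φ ∧ a = p '' Icc φ₁ φ ∧
    IsEndEvent G Θ φ (p φ) i g

theorem exists_isTunnelArc_of_mem_arcs (h0 : 0 < Θ) (hπ : Θ < Real.pi) {a : Set Plane}
    (ha : a ∈ arcs G Θ) :
    ∃ α β p l r φ₁ φ₂, IsTunnelArc G Θ α β p l r φ₁ φ₂ ∧ a = p '' Icc φ₁ φ₂ := by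
  obtain ⟨α, β, p, hm, hab⟩ := ha
  obtain ⟨l, r, φ₁, φ₂, h, he⟩ := hm.exists_isTunnelArc h0 hπ hab
  exact ⟨α, β, p, l, r, φ₁, φ₂, h, he⟩

theorem exists_isArcWithEnd (h0 : 0 < Θ) (hπ : Θ < Real.pi) {a : Set Plane} (ha : a ∈ arcs G Θ) :
    ∃ i, ∃ g ∈ G, ∃ φ ∈ Ico 0 (2 * Real.pi), IsArcWithEnd G Θ a i g φ := by
  obtain ⟨α, β, p, l, r, φ₁, φ₂, h, he⟩ := exists_isTunnelArc_of_mem_arcs h0 hπ ha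
  -- Motions are parametrised by real directions; a shift by full turns brings the end of the arc
  -- into `[0, 2π)`.
  set n : ℤ := -toIcoDiv Real.two_pi_pos 0 φ₂ with hn
  have hmem : φ₂ + n * (2 * Real.pi) ∈ Ico 0 (2 * Real.pi) := by
    have h1 := toIcoMod_mem_Ico Real.two_pi_pos 0 φ₂
    rw [zero_add, ← self_sub_toIcoDiv_zsmul, zsmul_eq_mul] at h1
    rw [hn]
    push_cast
    rw [neg_mul, ← sub_eq_add_neg]
    exact h1
  have h' := h.shift h0 hπ n
  obtain ⟨i, g, hg, hev⟩ := h'.exists_isEndEvent h0 hπ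
  exact ⟨i, g, hg, _, hmem, _, _, _, l, r, _, h', by rw [image_Icc_shift, he], hev⟩

theorem IsArcWithEnd.eq (h0 : 0 < Θ) (hπ : Θ < Real.pi) {a a' : Set Plane} {i : Fin 3} {g : Plane}
    {φ φ' : ℝ} (h : IsArcWithEnd G Θ a i g φ) (h' : IsArcWithEnd G Θ a' i g φ')
    (hd : |φ - φ'| < Θ) : a = a' := by
  obtain ⟨α, β, p, l, r, φ₁, h1, rfl, h2⟩ := h
  obtain ⟨α', β', p', l', r', φ₁', h1', rfl, h2'⟩ := h'
  have e := h1.motion.isEmptyCone φ ⟨h1.le_left.trans h1.lt.le, h1.le_right⟩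
  have e' := h1'.motion.isEmptyCone φ' ⟨h1'.le_left.trans h1'.lt.le, h1'.le_right⟩
  obtain ⟨d1, d2⟩ := abs_lt.1 hd
  obtain rfl : φ = φ' := by
    rcases lt_trichotomy φ φ' with hlt | heq | hgt
    · linarith [h2.add_le h0 hπ h2' e e' hlt]
    · exact heq
    · linarith [h2'.add_le h0 hπ h2 e' e hgt]
  exact h1.image_eq h0 hπ h1' (h2.apex_eq h0 hπ h2' e e')

/-- Label an arc by the kind, the guard and `⌊φ / Θ⌋` of its end event. Equal labels mean directions
less than `Θ` apart, hence equal arcs. -/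
theorem arcs_finite_and_ncard_le (G : Finset Plane) {Θ : ℝ} (h0 : 0 < Θ) (hπ : Θ < Real.pi) :
    (arcs G Θ).Finite ∧ ((arcs G Θ).ncard : ℝ) ≤ 9 * Real.pi * (G.card / Θ) := by
  classical
  have hex : ∀ a : Set Plane, ∃ k : Fin 3 × Plane × ℝ, a ∈ arcs G Θ →
      k.2.1 ∈ G ∧ k.2.2 ∈ Ico 0 (2 * Real.pi) ∧ IsArcWithEnd G Θ a k.1 k.2.1 k.2.2 := by
    intro a
    by_cases ha : a ∈ arcs G Θ
    · obtain ⟨i, g, hg, φ, hφ, h⟩ := exists_isArcWithEnd h0 hπ ha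
      exact ⟨(i, g, φ), fun _ => ⟨hg, hφ, h⟩⟩
    · exact ⟨(0, 0, 0), fun h => absurd h ha⟩
  choose k hk using hex
  set T : Finset (Fin 3 × Plane × ℕ) :=
    Finset.univ ×ˢ G ×ˢ Finset.range (⌊2 * Real.pi / Θ⌋₊ + 1) with hT
  set f : Set Plane → Fin 3 × Plane × ℕ := fun a => ((k a).1, (k a).2.1, ⌊(k a).2.2 / Θ⌋₊) with hf
  have hmaps : MapsTo f (arcs G Θ) T := by
    intro a ha
    obtain ⟨h1, h2, -⟩ := hk a ha
    simp only [hT, hf, Finset.coe_product, mem_prod, Finset.mem_coe, Finset.mem_univ, true_and,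
      Finset.mem_range]
    exact ⟨h1, Nat.lt_succ_of_le (Nat.floor_le_floor (by gcongr; exact h2.2.le))⟩
  have hinj : InjOn f (arcs G Θ) := by
    intro a ha b hb hab
    obtain ⟨-, h2, h3⟩ := hk a ha
    obtain ⟨-, h2', h3'⟩ := hk b hb
    simp only [hf, Prod.mk.injEq] at hab
    obtain ⟨e1, e2, e3⟩ := hab
    rw [e1, e2] at h3
    refine h3.eq h0 hπ h3' ?_
    have a1 := Nat.floor_le (div_nonneg h2.1 h0.le)
    have a2 := Nat.lt_floor_add_one ((k a).2.2 / Θ)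
    have b1 := Nat.floor_le (div_nonneg h2'.1 h0.le)
    have b2 := Nat.lt_floor_add_one ((k b).2.2 / Θ)
    rw [e3] at a1 a2
    have hlt : |(k a).2.2 / Θ - (k b).2.2 / Θ| < 1 := abs_lt.2 ⟨by linarith, by linarith⟩
    rwa [← sub_div, abs_div, abs_of_pos h0, div_lt_one h0] at hlt
  refine ⟨Set.Finite.of_injOn hmaps hinj T.finite_toSet, ?_⟩
  have hcard := Set.ncard_le_ncard_of_injOn f hmaps hinj T.finite_toSet
  rw [Set.ncard_coe_finset] at hcard
  have hTc : T.card = 3 * (G.card * (⌊2 * Real.pi / Θ⌋₊ + 1)) := by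
    simp [hT, Finset.card_product]
  rw [hTc] at hcard
  have hfl : (⌊2 * Real.pi / Θ⌋₊ : ℝ) ≤ 2 * Real.pi / Θ :=
    Nat.floor_le (by have := Real.pi_pos; positivity)
  -- This absorbs the additional unit of the range; three kinds times `3π` gives `9π`.
  have h1 : 1 ≤ Real.pi / Θ := (one_le_div h0).2 hπ.le
  calc ((arcs G Θ).ncard : ℝ) ≤ ((3 * (G.card * (⌊2 * Real.pi / Θ⌋₊ + 1)) : ℕ) : ℝ) := by
        exact_mod_cast hcard
    _ = 3 * (G.card * (⌊2 * Real.pi / Θ⌋₊ + 1)) := by push_cast; ring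
    _ ≤ 3 * (G.card * (3 * (Real.pi / Θ))) := by
        gcongr
        have h2 : 2 * Real.pi / Θ = 2 * (Real.pi / Θ) := by ring
        linarith
    _ = 9 * Real.pi * (G.card / Θ) := by ring

end GuardedRegion

/-! ### Every cone touching guards on both rays belongs to a tunnel -/

namespace GuardedRegion

open Set

section Existence

variable {G : Finset Plane} {Θ : ℝ}

/-- The cone with apex `x` in direction `φ` is empty and touches a guard on each bounding ray. -/
structure Touches (G : Finset Plane) (Θ φ : ℝ) (x : Plane) : Prop where
  empty : ∀ g ∈ G, lc Θ φ g ≤ lc Θ φ x ∨ rc Θ φ g ≤ rc Θ φ x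
  left : ∃ g ∈ G, lc Θ φ g = lc Θ φ x ∧ rc Θ φ x < rc Θ φ g
  right : ∃ g ∈ G, rc Θ φ g = rc Θ φ x ∧ lc Θ φ x < lc Θ φ g

theorem Touches.mirror {φ : ℝ} {x : Plane} (h : Touches G Θ φ x) :
    Touches (G.image mirror) Θ (-φ) (GuardedRegion.mirror x) where
  empty g hg := by
    obtain ⟨y, hy, rfl⟩ := Finset.mem_image.1 hg
    simpa [lc_mirror, rc_mirror] using (h.empty y hy).symm
  left := by
    obtain ⟨g, hg, h1, h2⟩ := h.right
    exact ⟨_, mem_image_mirror.2 hg, by simpa [lc_mirror] using h1, by simpa [rc_mirror] using h2⟩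
  right := by
    obtain ⟨g, hg, h1, h2⟩ := h.left
    exact ⟨_, mem_image_mirror.2 hg, by simpa [rc_mirror] using h1, by simpa [lc_mirror] using h2⟩

theorem image_mirror_image_mirror (G : Finset Plane) : (G.image mirror).image mirror = G := by
  ext x
  conv_lhs => rw [← mirror_mirror x, mem_image_mirror, mem_image_mirror]

/-- At the direction `t`, no line through two guards is parallel to a bounding ray. -/
def IsRegularDirection (G : Finset Plane) (Θ t : ℝ) : Prop :=
  ∀ g ∈ G, ∀ g' ∈ G, g ≠ g' → lc Θ t g ≠ lc Θ t g' ∧ rc Θ t g ≠ rc Θ t g'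

theorem lt_on_Ioo_of_ne {f g : ℝ → ℝ} {a b s t : ℝ} (hf : Continuous f) (hg : Continuous g)
    (hne : ∀ t ∈ Ioo a b, f t ≠ g t) (hs : s ∈ Icc a b) (h : f s < g s) (ht : t ∈ Ioo a b) :
    f t < g t := by
  by_contra hcon
  have hc : ContinuousOn (fun u => g u - f u) (uIcc s t) := (hg.sub hf).continuousOn
  have h0 : (0 : ℝ) ∈ uIcc (g s - f s) (g t - f t) := by
    rw [mem_uIcc]; right; constructor <;> linarith
  obtain ⟨z, hz, hz0⟩ := intermediate_value_uIcc hc h0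
  have hz1 : f z = g z := by simp only at hz0; linarith
  have hzs : z ≠ s := by rintro rfl; exact h.ne hz1
  refine hne z ⟨?_, ?_⟩ hz1
  · rcases mem_uIcc.1 hz with ⟨h1, -⟩ | ⟨h1, -⟩
    · exact hs.1.trans_lt (lt_of_le_of_ne h1 hzs.symm)
    · exact ht.1.trans_le h1
  · rcases mem_uIcc.1 hz with ⟨-, h1⟩ | ⟨-, h1⟩
    · exact h1.trans_lt ht.2
    · exact (lt_of_le_of_ne h1 hzs).trans_le hs.2

/-- The point at which the left ray through `l` and the right ray through `r` meet. -/
noncomputable def rayPoint (Θ : ℝ) (l r : Plane) (φ : ℝ) : Plane :=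
  (Real.sin Θ)⁻¹ • (rc Θ φ r • dir (φ + Θ / 2) + lc Θ φ l • dir (φ - Θ / 2))

theorem lc_rayPoint (h0 : 0 < Θ) (hπ : Θ < Real.pi) (l r : Plane) (φ : ℝ) :
    lc Θ φ (rayPoint Θ l r φ) = lc Θ φ l := by
  have hs := Real.sin_pos_of_pos_of_lt_pi h0 hπ
  have e : φ + Θ / 2 - (φ - Θ / 2) = Θ := by ring
  rw [rayPoint, lc_smul, lc_add, lc_smul, lc_smul, lc_dir, lc_dir, e, sub_self, Real.sin_zero]
  field_simp
  ring

theorem rc_rayPoint (h0 : 0 < Θ) (hπ : Θ < Real.pi) (l r : Plane) (φ : ℝ) :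
    rc Θ φ (rayPoint Θ l r φ) = rc Θ φ r := by
  have hs := Real.sin_pos_of_pos_of_lt_pi h0 hπ
  have e : φ + Θ / 2 - (φ - Θ / 2) = Θ := by ring
  rw [rayPoint, rc_smul, rc_add, rc_smul, rc_smul, rc_dir, rc_dir, e, sub_self, Real.sin_zero]
  field_simp
  ring

theorem continuous_dir : Continuous dir := by
  refine (PiLp.continuous_toLp 2 _).comp (continuous_pi fun i => ?_)
  fin_cases i
  · simp; fun_prop
  · simp; fun_prop

theorem continuous_rayPoint (Θ : ℝ) (l r : Plane) : Continuous (rayPoint Θ l r) := by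
  have h1 := continuous_rc_const Θ r
  have h2 := continuous_lc_const Θ l
  have h3 : Continuous fun φ : ℝ => dir (φ + Θ / 2) := continuous_dir.comp (by fun_prop)
  have h4 : Continuous fun φ : ℝ => dir (φ - Θ / 2) := continuous_dir.comp (by fun_prop)
  have h5 := (h1.smul h3).add (h2.smul h4)
  exact (continuous_const (y := (Real.sin Θ)⁻¹)).smul h5

/-- Between irregular directions the order of the guards by `lc` and by `rc` is constant, so one
pair stays in contact and the apex is its `rayPoint`. -/
theorem Touches.exists_isSweep_of_isRegularDirection (h0 : 0 < Θ) (hπ : Θ < Real.pi) {φ₀ φ₁ : ℝ}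
    (h01 : φ₀ < φ₁) {x : Plane} (hx : Touches G Θ φ₀ x) (hxG : x ∉ G)
    (hreg : ∀ t ∈ Ioo φ₀ φ₁, IsRegularDirection G Θ t) :
    ∃ q, IsSweep G Θ φ₀ φ₁ q ∧ q φ₀ = x := by
  classical
  have hlne : ∀ {g g'}, g ∈ G → g' ∈ G → ∀ {s}, s ∈ Icc φ₀ φ₁ → lc Θ s g < lc Θ s g' →
      ∀ {t}, t ∈ Ioo φ₀ φ₁ → lc Θ t g < lc Θ t g' := fun {g g'} hg hg' {s} hs hlt {t} ht =>
    lt_on_Ioo_of_ne (continuous_lc_const Θ g) (continuous_lc_const Θ g')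
      (fun t ht => (hreg t ht g hg g' hg' (by rintro rfl; exact hlt.ne rfl)).1) hs hlt ht
  have hrne : ∀ {g g'}, g ∈ G → g' ∈ G → ∀ {s}, s ∈ Icc φ₀ φ₁ → rc Θ s g < rc Θ s g' →
      ∀ {t}, t ∈ Ioo φ₀ φ₁ → rc Θ t g < rc Θ t g' := fun {g g'} hg hg' {s} hs hlt {t} ht =>
    lt_on_Ioo_of_ne (continuous_rc_const Θ g) (continuous_rc_const Θ g')
      (fun t ht => (hreg t ht g hg g' hg' (by rintro rfl; exact hlt.ne rfl)).2) hs hlt ht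
  obtain ⟨m, hm⟩ := nonempty_Ioo.2 h01
  have hm' := Ioo_subset_Icc_self hm
  have hφ₀ : φ₀ ∈ Icc φ₀ φ₁ := left_mem_Icc.2 h01.le
  -- Several guards may be on a ray at `φ₀`; the order at the interior direction `m` tells which one
  -- the ray keeps.
  obtain ⟨l, hlS, hlmax⟩ := (G.filter fun g => lc Θ φ₀ g = lc Θ φ₀ x ∧ rc Θ φ₀ x < rc Θ φ₀ g
    ).exists_max_image (lc Θ m) (by
      obtain ⟨g, hg, h⟩ := hx.left; exact ⟨g, Finset.mem_filter.2 ⟨hg, h⟩⟩)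
  obtain ⟨r, hrS, hrmax⟩ := (G.filter fun g => rc Θ φ₀ g = rc Θ φ₀ x ∧ lc Θ φ₀ x < lc Θ φ₀ g
    ).exists_max_image (rc Θ m) (by
      obtain ⟨g, hg, h⟩ := hx.right; exact ⟨g, Finset.mem_filter.2 ⟨hg, h⟩⟩)
  obtain ⟨hl, hl1, hl2⟩ := Finset.mem_filter.1 hlS
  obtain ⟨hr, hr1, hr2⟩ := Finset.mem_filter.1 hrS
  have hql := lc_rayPoint h0 hπ l r
  have hqr := rc_rayPoint h0 hπ l r
  have hqx : rayPoint Θ l r φ₀ = x := ext_of_lc_rc h0 hπ (φ := φ₀) (by rw [hql, hl1])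
    (by rw [hqr, hr1])
  -- By constancy of the order, a guard inside the cone would already be in the closed cone at `φ₀`,
  -- hence on one of its rays, against the extremal choice of `l` or `r`.
  have hin : ∀ t ∈ Ioo φ₀ φ₁, ∀ g ∈ G, lc Θ t g ≤ lc Θ t l ∨ rc Θ t g ≤ rc Θ t r := by
    intro t ht g hg
    by_contra! hcon
    have ht' := Ioo_subset_Icc_self ht
    have e1 : lc Θ φ₀ l ≤ lc Θ φ₀ g := le_of_forall_Ioo_right
      (continuous_lc_const Θ l).continuousOn (continuous_lc_const Θ g).continuousOn le_rfl h01
      le_rfl fun s hs => (hlne hl hg ht' hcon.1 hs).le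
    have e2 : rc Θ φ₀ r ≤ rc Θ φ₀ g := le_of_forall_Ioo_right
      (continuous_rc_const Θ r).continuousOn (continuous_rc_const Θ g).continuousOn le_rfl h01
      le_rfl fun s hs => (hrne hr hg ht' hcon.2 hs).le
    rw [hl1] at e1
    rw [hr1] at e2
    rcases hx.empty g hg with h | h
    · have e3 := le_antisymm h e1
      have e4 : rc Θ φ₀ x < rc Θ φ₀ g := lt_of_le_of_ne e2 fun he =>
        hxG (by rw [← ext_of_lc_rc h0 hπ e3 he.symm]; exact hg)
      exact absurd (hlmax g (Finset.mem_filter.2 ⟨hg, e3, e4⟩))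
        (not_le.2 (hlne hl hg ht' hcon.1 hm))
    · have e3 := le_antisymm h e2
      have e4 : lc Θ φ₀ x < lc Θ φ₀ g := lt_of_le_of_ne e1 fun he =>
        hxG (by rw [← ext_of_lc_rc h0 hπ he.symm e3]; exact hg)
      exact absurd (hrmax g (Finset.mem_filter.2 ⟨hg, e3, e4⟩))
        (not_le.2 (hrne hr hg ht' hcon.2 hm))
  have hrl : ∀ t ∈ Ioo φ₀ φ₁, rc Θ t r < rc Θ t l := fun t ht =>
    hrne hr hl hφ₀ (by rwa [hr1]) ht
  have hlr : ∀ t ∈ Ioo φ₀ φ₁, lc Θ t l < lc Θ t r := fun t ht =>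
    hlne hl hr hφ₀ (by rwa [hl1]) ht
  refine ⟨rayPoint Θ l r, ⟨h0, hπ, (continuous_rayPoint Θ l r).continuousOn, ?_, ?_, ?_, ?_⟩, hqx⟩
  · intro t ht g hg
    rcases eq_or_lt_of_le ht.1 with rfl | h1
    · rw [hqx]; exact hx.empty g hg
    rw [hql, hqr]
    rcases eq_or_lt_of_le ht.2 with rfl | h2
    · by_contra! hcon
      rcases hin m hm g hg with h | h
      · exact absurd (hlne hl hg ht hcon.1 hm) (not_lt.2 h)
      · exact absurd (hrne hr hg ht hcon.2 hm) (not_lt.2 h)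
    · exact hin t ⟨h1, h2⟩ g hg
  · intro t ht
    exact ⟨l, hl, (hql t).symm, by rw [hqr]; exact hrl t ht⟩
  · intro t ht
    exact ⟨r, hr, (hqr t).symm, by rw [hql]; exact hlr t ht⟩
  · intro t ht hG
    have e1 : rayPoint Θ l r t = l := by
      by_contra hne; exact (hreg t ht _ hG l hl hne).1 (hql t)
    have e2 := hqr t
    rw [e1] at e2
    exact (hrl t ht).ne' e2

theorem IsSweep.touches_end {α β : ℝ} {p : ℝ → Plane} (h : IsSweep G Θ α β p) (hαβ : α < β)
    (hβ : p β ∉ G) : Touches G Θ β (p β) where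
  empty := h.empty β (right_mem_Icc.2 hαβ.le)
  left := by
    obtain ⟨g', hg', -, e1, e2⟩ :=
      h.mirror.exists_frequently_right_nhdsGT le_rfl (neg_lt_neg hαβ)
    obtain ⟨g, hg, rfl⟩ := Finset.mem_image.1 hg'
    simp only [rc_mirror, lc_mirror, neg_neg] at e1 e2
    exact ⟨g, hg, e1, lt_of_le_of_ne e2 fun he =>
      hβ (by rw [← ext_of_lc_rc h.pos h.lt_pi e1 he.symm]; exact hg)⟩
  right := by
    obtain ⟨g', hg', -, e1, e2⟩ :=
      h.mirror.exists_frequently_left_nhdsGT le_rfl (neg_lt_neg hαβ)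
    obtain ⟨g, hg, rfl⟩ := Finset.mem_image.1 hg'
    simp only [rc_mirror, lc_mirror, neg_neg] at e1 e2
    exact ⟨g, hg, e1, lt_of_le_of_ne e2 fun he =>
      hβ (by rw [← ext_of_lc_rc h.pos h.lt_pi he.symm e1]; exact hg)⟩

theorem IsSweep.append {α β γ : ℝ} {p q : ℝ → Plane} (hp : IsSweep G Θ α β p)
    (hq : IsSweep G Θ β γ q) (hαβ : α < β) (hβγ : β < γ) (hpq : p β = q β) (hβ : q β ∉ G)
    (ht : Touches G Θ β (q β)) :
    IsSweep G Θ α γ (fun t => if t ≤ β then p t else q t) := by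
  set w : ℝ → Plane := fun t => if t ≤ β then p t else q t
  have w1 : ∀ t, t ≤ β → w t = p t := fun t h => if_pos h
  have w2 : ∀ t, β ≤ t → w t = q t := by
    intro t h
    rcases eq_or_lt_of_le h with rfl | h
    · rw [w1 _ le_rfl, hpq]
    · exact if_neg (not_le.2 h)
  have key : ∀ t ∈ Ioo α γ, t ∈ Ioo α β ∨ t = β ∨ t ∈ Ioo β γ := by
    intro t ht
    rcases lt_trichotomy t β with h | h | h
    · exact Or.inl ⟨ht.1, h⟩
    · exact Or.inr (Or.inl h)
    · exact Or.inr (Or.inr ⟨h, ht.2⟩)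
  refine ⟨hp.pos, hp.lt_pi, ?_, ?_, ?_, ?_, ?_⟩
  · rw [← Icc_union_Icc_eq_Icc hαβ.le hβγ.le]
    exact (hp.cont.congr fun t ht => w1 t ht.2).union_of_isClosed
      (hq.cont.congr fun t ht => w2 t ht.1) isClosed_Icc isClosed_Icc
  · intro t ht
    rcases le_total t β with h | h
    · rw [w1 t h]; exact hp.empty t ⟨ht.1, h⟩
    · rw [w2 t h]; exact hq.empty t ⟨h, ht.2⟩
  · intro t ht'
    rcases key t ht' with h | rfl | h
    · rw [w1 t h.2.le]; exact hp.left t h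
    · rw [w2 _ le_rfl]; exact ht.left
    · rw [w2 t h.1.le]; exact hq.left t h
  · intro t ht'
    rcases key t ht' with h | rfl | h
    · rw [w1 t h.2.le]; exact hp.right t h
    · rw [w2 _ le_rfl]; exact ht.right
    · rw [w2 t h.1.le]; exact hq.right t h
  · intro t ht'
    rcases key t ht' with h | rfl | h
    · rw [w1 t h.2.le]; exact hp.notMem t h
    · rw [w2 _ le_rfl]; exact hβ
    · rw [w2 t h.1.le]; exact hq.notMem t h

/-- Induction on the irregular directions ahead: sweep to the nearest one and, unless the apex has
reached a guard, continue with a new pair. -/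
theorem Touches.exists_isSweep_of_finset (h0 : 0 < Θ) (hπ : Θ < Real.pi) {T : ℝ} :
    ∀ (S : Finset ℝ) {φ₀ : ℝ} {x : Plane}, φ₀ < T → Touches G Θ φ₀ x → x ∉ G →
      (∀ t ∈ Ioo φ₀ T, t ∉ S → IsRegularDirection G Θ t) →
      ∃ b ∈ Ioc φ₀ T, ∃ q, IsSweep G Θ φ₀ b q ∧ q φ₀ = x ∧ (q b ∈ G ∨ b = T) := by
  classical
  intro S
  induction S using Finset.strongInduction with
  | H S ih =>
  intro φ₀ x hT hx hxG hreg
  rcases (S.filter fun t => t ∈ Ioo φ₀ T).eq_empty_or_nonempty with hS | hS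
  · obtain ⟨q, hq, hqx⟩ := hx.exists_isSweep_of_isRegularDirection h0 hπ hT hxG fun t ht =>
      hreg t ht fun htS => Finset.notMem_empty t (hS ▸ Finset.mem_filter.2 ⟨htS, ht⟩)
    exact ⟨T, ⟨hT, le_rfl⟩, q, hq, hqx, Or.inr rfl⟩
  · obtain ⟨hcS, hc⟩ := Finset.mem_filter.1 (Finset.min'_mem _ hS)
    have hmin := fun t ht => Finset.min'_le (S.filter fun t => t ∈ Ioo φ₀ T) t ht
    set c := (S.filter fun t => t ∈ Ioo φ₀ T).min' hS
    obtain ⟨q, hq, hqx⟩ := hx.exists_isSweep_of_isRegularDirection h0 hπ hc.1 hxG fun t ht =>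
      hreg t ⟨ht.1, ht.2.trans hc.2⟩ fun htS =>
        absurd (hmin t (Finset.mem_filter.2 ⟨htS, ht.1, ht.2.trans hc.2⟩)) (not_le.2 ht.2)
    by_cases hqc : q c ∈ G
    · exact ⟨c, ⟨hc.1, hc.2.le⟩, q, hq, hqx, Or.inl hqc⟩
    have htc := hq.touches_end hc.1 hqc
    obtain ⟨b, hb, q', hq', hqx', hend⟩ := ih (S.erase c) (Finset.erase_ssubset hcS) hc.2 htc hqc
      fun t ht htS => hreg t ⟨hc.1.trans ht.1, ht.2⟩ fun h =>
        htS (Finset.mem_erase.2 ⟨ht.1.ne', h⟩)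
    refine ⟨b, ⟨hc.1.trans hb.1, hb.2⟩, _, hq.append hq' hc.1 hb.1 hqx'.symm
      (by rwa [hqx']) (by rwa [hqx']), ?_, ?_⟩
    · simp only [if_pos hc.1.le, hqx]
    · simpa only [if_neg (not_le.2 hb.1)] using hend

theorem subsingleton_lc_eq (h0 : 0 < Θ) (hπ : Θ < Real.pi) (Φ : ℝ) {x y : Plane} (hxy : x ≠ y) :
    {t ∈ Ioo Φ (Φ + Real.pi) | lc Θ t x = lc Θ t y}.Subsingleton := by
  rintro t ⟨ht, h1⟩ s ⟨hs, h2⟩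
  have e := lc_sub_of_lc_eq h1 s
  rw [h2, sub_self, mul_zero, eq_comm, mul_eq_zero] at e
  rcases e with e | e
  · exact absurd (ext_of_lc_rc h0 hπ h1 (sub_eq_zero.1 e)) hxy
  · rw [Real.sin_eq_zero_iff_of_lt_of_lt (by linarith [ht.2, hs.1]) (by linarith [ht.1, hs.2])] at e
    linarith

theorem subsingleton_rc_eq (h0 : 0 < Θ) (hπ : Θ < Real.pi) (Φ : ℝ) {x y : Plane} (hxy : x ≠ y) :
    {t ∈ Ioo Φ (Φ + Real.pi) | rc Θ t x = rc Θ t y}.Subsingleton := by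
  rintro t ⟨ht, h1⟩ s ⟨hs, h2⟩
  have e := rc_sub_of_rc_eq h1 s
  rw [h2, sub_self, mul_zero, eq_comm, mul_eq_zero] at e
  rcases e with e | e
  · exact absurd (ext_of_lc_rc h0 hπ (sub_eq_zero.1 e) h1) hxy
  · rw [Real.sin_eq_zero_iff_of_lt_of_lt (by linarith [hs.2, ht.1]) (by linarith [hs.1, ht.2])] at e
    linarith

theorem finite_not_isRegularDirection (G : Finset Plane) (h0 : 0 < Θ) (hπ : Θ < Real.pi) (Φ : ℝ) :
    {t ∈ Ioo Φ (Φ + Real.pi) | ¬ IsRegularDirection G Θ t}.Finite := by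
  refine Finite.subset (s := ⋃ x ∈ G, ⋃ y ∈ G, ⋃ (_ : x ≠ y),
    {t ∈ Ioo Φ (Φ + Real.pi) | lc Θ t x = lc Θ t y} ∪
      {t ∈ Ioo Φ (Φ + Real.pi) | rc Θ t x = rc Θ t y}) ?_ ?_
  · exact G.finite_toSet.biUnion fun x _ => G.finite_toSet.biUnion fun y _ =>
      finite_iUnion fun hxy => (subsingleton_lc_eq h0 hπ Φ hxy).finite.union
        (subsingleton_rc_eq h0 hπ Φ hxy).finite
  · rintro t ⟨ht, h⟩
    simp only [IsRegularDirection, not_forall] at h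
    obtain ⟨x, hx, y, hy, hxy, h⟩ := h
    simp only [mem_iUnion]
    refine ⟨x, hx, y, hy, hxy, ?_⟩
    by_cases h1 : lc Θ t x = lc Θ t y
    · exact Or.inl ⟨ht, h1⟩
    · exact Or.inr ⟨ht, by_contra fun h2 => h ⟨h1, h2⟩⟩

/-- A sweep turns by at most `π - Θ`, so one planned for an angle of `π` must stop at a guard. -/
theorem Touches.exists_isSweep (h0 : 0 < Θ) (hπ : Θ < Real.pi) {φ : ℝ} {x : Plane}
    (hx : Touches G Θ φ x) (hxG : x ∉ G) :
    ∃ b q, φ < b ∧ IsSweep G Θ φ b q ∧ q φ = x ∧ q b ∈ G := by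
  have hfin := finite_not_isRegularDirection G h0 hπ φ
  obtain ⟨b, hb, q, hq, hqx, hend⟩ := hx.exists_isSweep_of_finset h0 hπ (T := φ + Real.pi)
    hfin.toFinset (by linarith [Real.pi_pos]) hxG fun t ht htS => by
      by_contra h; exact htS (hfin.mem_toFinset.2 ⟨ht, h⟩)
  refine ⟨b, q, hb.1, hq, hqx, hend.resolve_right ?_⟩
  rintro rfl
  linarith [hq.sub_le le_rfl le_rfl hb.1]

theorem Touches.exists_isTunnelMotion (h0 : 0 < Θ) (hπ : Θ < Real.pi) {φ : ℝ} {x : Plane}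
    (hx : Touches G Θ φ x) (hxG : x ∉ G) :
    ∃ α β p, IsTunnelMotion G Θ α β p ∧ φ ∈ Ioo α β ∧ p φ = x := by
  obtain ⟨b, q, hb, hq, hqx, hqb⟩ := hx.exists_isSweep h0 hπ hxG
  obtain ⟨c, w, hc, hw, hwx, hwc⟩ := hx.mirror.exists_isSweep h0 hπ
    (fun h => hxG (mem_image_mirror.1 h))
  have hw' := hw.mirror
  rw [image_mirror_image_mirror, neg_neg] at hw'
  have hwc' : GuardedRegion.mirror (w c) ∈ G := by
    rwa [← mem_image_mirror, mirror_mirror]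
  have hcφ : -c < φ := by linarith
  refine ⟨-c, b, _, (hw'.append hq hcφ hb ?_ ?_ ?_).isTunnelMotion (hcφ.trans hb) ?_ ?_,
    ⟨hcφ, hb⟩, ?_⟩
  · simp only [hwx, mirror_mirror, hqx]
  · rwa [hqx]
  · rwa [hqx]
  · simpa only [if_pos hcφ.le, neg_neg] using hwc'
  · simpa only [if_neg (not_le.2 hb)] using hqb
  · simp only [if_pos le_rfl, hwx, mirror_mirror]

theorem Touches.mem_sUnion_arcs (h0 : 0 < Θ) (hπ : Θ < Real.pi) {φ : ℝ} {x : Plane}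
    (hx : Touches G Θ φ x) (hxG : x ∉ G) : x ∈ ⋃₀ arcs G Θ := by
  obtain ⟨α, β, p, hp, hφ, rfl⟩ := hx.exists_isTunnelMotion h0 hπ hxG
  obtain ⟨a, ha, hpa⟩ := hp.exists_mem_boundaryArcs h0 hπ hφ
  exact ⟨a, ⟨α, β, p, hp, ha⟩, hpa⟩

end Existence

end GuardedRegion

/-! ### The boundary of the region is covered by the arcs -/

namespace GuardedRegion

open Set

section Frontier

variable {G : Finset Plane} {Θ : ℝ}

theorem norm_dir (t : ℝ) : ‖dir t‖ = 1 := by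
  have := norm_sq_eq (dir t)
  rw [dir_zero, dir_one, Real.cos_sq_add_sin_sq] at this
  exact (pow_eq_one_iff_of_nonneg (norm_nonneg _) two_ne_zero).1 this

theorem continuous_lc_prod (Θ : ℝ) : Continuous fun q : ℝ × Plane => lc Θ q.1 q.2 := by
  have h0 : Continuous fun q : ℝ × Plane => q.2 0 := by fun_prop
  have h1 : Continuous fun q : ℝ × Plane => q.2 1 := by fun_prop
  simp only [lc, cross, dir_zero, dir_one]
  exact (h0.mul (by fun_prop)).sub (h1.mul (by fun_prop))

theorem continuous_rc_prod (Θ : ℝ) : Continuous fun q : ℝ × Plane => rc Θ q.1 q.2 := by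
  have h0 : Continuous fun q : ℝ × Plane => q.2 0 := by fun_prop
  have h1 : Continuous fun q : ℝ × Plane => q.2 1 := by fun_prop
  simp only [rc, cross, dir_zero, dir_one]
  exact (Continuous.mul (by fun_prop) h1).sub (Continuous.mul (by fun_prop) h0)

theorem continuous_lc_right (Θ φ : ℝ) : Continuous fun x => lc Θ φ x :=
  (continuous_lc_prod Θ).comp (Continuous.prodMk_right φ)

theorem continuous_rc_right (Θ φ : ℝ) : Continuous fun x => rc Θ φ x :=
  (continuous_rc_prod Θ).comp (f := fun x : Plane => (φ, x)) (Continuous.prodMk_right φ)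

theorem notMem_region_iff (h0 : 0 < Θ) (hπ : Θ < Real.pi) {x : Plane} :
    x ∉ region G Θ ↔ ∃ φ, ∀ g ∈ G, lc Θ φ g ≤ lc Θ φ x ∨ rc Θ φ g ≤ rc Θ φ x := by
  rw [region, mem_ofPred_eq, not_forall]
  simp only [not_not, isEmptyCone_iff h0 hπ]

/-- The complement is the projection of a closed set of pairs along the compact interval of
directions. -/
theorem isOpen_region (G : Finset Plane) (h0 : 0 < Θ) (hπ : Θ < Real.pi) :
    IsOpen (region G Θ) := by
  rw [← isClosed_compl_iff]
  have hF : IsClosed {q : Icc 0 (2 * Real.pi) × Plane |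
      ∀ g ∈ G, lc Θ q.1 g ≤ lc Θ q.1 q.2 ∨ rc Θ q.1 g ≤ rc Θ q.1 q.2} := by
    have hv : Continuous fun q : Icc 0 (2 * Real.pi) × Plane => ((q.1 : ℝ), q.2) := by fun_prop
    have hl := (continuous_lc_prod Θ).comp hv
    have hr := (continuous_rc_prod Θ).comp hv
    have hc : Continuous fun q : Icc 0 (2 * Real.pi) × Plane => (q.1 : ℝ) := by fun_prop
    simp only [ofPred_forall, ofPred_or]
    exact isClosed_biInter fun g _ =>
      (isClosed_le ((continuous_lc_const Θ g).comp hc) hl).union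
        (isClosed_le ((continuous_rc_const Θ g).comp hc) hr)
  convert isClosedMap_snd_of_compactSpace _ hF using 1
  ext x
  rw [mem_compl_iff, notMem_region_iff h0 hπ]
  constructor
  · rintro ⟨φ, hφ⟩
    have h1 := toIcoMod_mem_Ico Real.two_pi_pos 0 φ
    rw [zero_add] at h1
    refine ⟨(⟨toIcoMod Real.two_pi_pos 0 φ, Ico_subset_Icc_self h1⟩, x), fun g hg => ?_, rfl⟩
    have e : toIcoMod Real.two_pi_pos 0 φ = φ - toIcoDiv Real.two_pi_pos 0 φ * (2 * Real.pi) := by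
      rw [toIcoMod, zsmul_eq_mul]
    simp only [e, lc_sub_int_mul, rc_sub_int_mul]
    exact hφ g hg
  · rintro ⟨⟨φ, y⟩, hφ, rfl⟩
    exact ⟨φ, hφ⟩

theorem mem_interior_compl_region (h0 : 0 < Θ) (hπ : Θ < Real.pi) {φ : ℝ} {x : Plane}
    (h : ∀ g ∈ G, lc Θ φ g < lc Θ φ x ∨ rc Θ φ g < rc Θ φ x) : x ∈ interior (region G Θ)ᶜ := by
  rw [mem_interior]
  refine ⟨{y | ∀ g ∈ G, lc Θ φ g < lc Θ φ y ∨ rc Θ φ g < rc Θ φ y}, fun y hy => ?_, ?_, h⟩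
  · exact (notMem_region_iff h0 hπ).2 ⟨φ, fun g hg => (hy g hg).imp le_of_lt le_of_lt⟩
  · have : {y | ∀ g ∈ G, lc Θ φ g < lc Θ φ y ∨ rc Θ φ g < rc Θ φ y} =
        ⋂ g ∈ G, ({y | lc Θ φ g < lc Θ φ y} ∪ {y | rc Θ φ g < rc Θ φ y}) := by
      ext y; simp
    rw [this]
    exact isOpen_biInter_finset fun g _ =>
      (isOpen_lt continuous_const (continuous_lc_right Θ φ)).union
        (isOpen_lt continuous_const (continuous_rc_right Θ φ))

/-- If an empty cone touches no guard with its right ray, then it can be rotated clockwise such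
that its closure contains no guard. -/
theorem exists_forall_lt_of_not_touches_right (h0 : 0 < Θ) (hπ : Θ < Real.pi) {φ : ℝ} {x : Plane}
    (hx : ∀ g ∈ G, lc Θ φ g ≤ lc Θ φ x ∨ rc Θ φ g ≤ rc Θ φ x) (hxG : x ∉ G)
    (hr : ∀ g ∈ G, rc Θ φ g = rc Θ φ x → lc Θ φ g ≤ lc Θ φ x) :
    ∃ t, ∀ g ∈ G, lc Θ t g < lc Θ t x ∨ rc Θ t g < rc Θ t x := by
  have hs := Real.sin_pos_of_pos_of_lt_pi h0 hπ
  have key : ∀ g ∈ G, ∀ᶠ t in 𝓝[<] φ, lc Θ t g < lc Θ t x ∨ rc Θ t g < rc Θ t x := by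
    intro g hg
    by_cases h1 : lc Θ φ g < lc Θ φ x
    · exact (((continuous_lc_const Θ g).continuousAt.eventually_lt
        (continuous_lc_const Θ x).continuousAt h1).filter_mono nhdsWithin_le_nhds).mono
          fun t => Or.inl
    by_cases h2 : rc Θ φ g < rc Θ φ x
    · exact (((continuous_rc_const Θ g).continuousAt.eventually_lt
        (continuous_rc_const Θ x).continuousAt h2).filter_mono nhdsWithin_le_nhds).mono
          fun t => Or.inr
    rw [not_lt] at h1 h2
    have hne : x ≠ g := by rintro rfl; exact hxG hg
    have e1 : lc Θ φ g = lc Θ φ x := by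
      rcases hx g hg with h | h
      · exact le_antisymm h h1
      · exact le_antisymm (hr g hg (le_antisymm h h2)) h1
    have e2 : rc Θ φ x < rc Θ φ g := lt_of_le_of_ne h2 fun he =>
      hne (ext_of_lc_rc h0 hπ e1.symm he)
    filter_upwards [Ioo_mem_nhdsLT (show φ - Real.pi < φ by linarith [Real.pi_pos])] with t ht
    -- The remaining guards are on the left ray; a clockwise turn leaves them strictly outside.
    left
    have e3 := lc_sub_of_lc_eq e1 t
    have e4 : Real.sin (t - φ) < 0 :=
      Real.sin_neg_of_neg_of_neg_pi_lt (by linarith [ht.2]) (by linarith [ht.1])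
    have e5 := mul_neg_of_pos_of_neg (sub_pos.2 e2) e4
    rw [← e3] at e5
    linarith [neg_of_mul_neg_right e5 hs.le]
  exact ((Filter.eventually_all_finset G).2 key).exists

/-- Turn an empty cone counterclockwise to its last empty position before pointing at a guard: a
guard blocks the left ray. If the right ray were free, a small clockwise turn would clear the closed
cone, and `x` would be interior to the complement. -/
theorem exists_touches_of_mem_frontier (h0 : 0 < Θ) (hπ : Θ < Real.pi) {x : Plane}
    (hx : x ∈ frontier (region G Θ)) (hxG : x ∉ G) : ∃ φ, Touches G Θ φ x := by
  have hs := Real.sin_pos_of_pos_of_lt_pi h0 hπ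
  have hxR : x ∉ region G Θ := by
    rw [(isOpen_region G h0 hπ).frontier_eq] at hx; exact hx.2
  have hxI : x ∉ interior (region G Θ)ᶜ := by
    rw [← frontier_compl] at hx; exact hx.2
  have hint : ∀ t, ∃ g ∈ G, lc Θ t x ≤ lc Θ t g ∧ rc Θ t x ≤ rc Θ t g := by
    intro t
    by_contra! hcon
    exact hxI (mem_interior_compl_region h0 hπ (φ := t) fun g hg => by
      by_cases h : lc Θ t g < lc Θ t x
      · exact Or.inl h
      · exact Or.inr (hcon g hg (not_lt.1 h)))
  obtain ⟨φ₀, hφ₀⟩ := (notMem_region_iff h0 hπ).1 hxR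
  obtain ⟨g₀, hg₀, -⟩ := hint 0
  have hne : g₀ - x ≠ 0 := fun h => hxG (by rw [← sub_eq_zero.1 h]; exact hg₀)
  obtain ⟨s, hs0, ψ, hψ, hv⟩ := exists_eq_smul_dir_of_ne hne φ₀
  have hhalf : 0 < Real.sin (Θ / 2) :=
    Real.sin_pos_of_pos_of_lt_pi (by linarith) (by linarith)
  have hψl : lc Θ ψ x < lc Θ ψ g₀ := by
    have e : lc Θ ψ (g₀ - x) = s * Real.sin (Θ / 2) := by
      rw [hv, lc_smul, lc_dir]; congr 2; ring
    rw [lc_sub] at e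
    linarith [mul_pos hs0 hhalf]
  have hψr : rc Θ ψ x < rc Θ ψ g₀ := by
    have e : rc Θ ψ (g₀ - x) = s * Real.sin (Θ / 2) := by
      rw [hv, rc_smul, rc_dir]; congr 2; ring
    rw [rc_sub] at e
    linarith [mul_pos hs0 hhalf]
  have hcl : IsClosed {t : ℝ | ∀ g ∈ G, lc Θ t g ≤ lc Θ t x ∨ rc Θ t g ≤ rc Θ t x} := by
    simp only [ofPred_forall, ofPred_or]
    exact isClosed_biInter fun g _ =>
      (isClosed_le (continuous_lc_const Θ g) (continuous_lc_const Θ x)).union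
        (isClosed_le (continuous_rc_const Θ g) (continuous_rc_const Θ x))
  obtain ⟨φ, ⟨⟨h1, h2⟩, hemp⟩, hmax⟩ := (isCompact_Icc.inter_right hcl).exists_isGreatest
    ⟨φ₀, left_mem_Icc.2 hψ.1.le, hφ₀⟩
  have hφψ : φ < ψ := lt_of_le_of_ne h2 fun he => by
    subst he
    rcases hemp g₀ hg₀ with h | h
    · exact absurd hψl (not_lt.2 h)
    · exact absurd hψr (not_lt.2 h)
  refine ⟨φ, hemp, ?_, ?_⟩
  · obtain ⟨g, hg, hf⟩ : ∃ g ∈ G, ∃ᶠ t in 𝓝[>] φ, lc Θ t x < lc Θ t g ∧ rc Θ t x < rc Θ t g := by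
      by_contra! hcon
      have hall := (Filter.eventually_all_finset G).2 hcon
      obtain ⟨t, ht, ht'⟩ := (hall.and (Ioo_mem_nhdsGT hφψ)).exists
      refine absurd (hmax ⟨⟨h1.trans ht'.1.le, ht'.2.le⟩, fun g hg => ?_⟩) (not_le.2 ht'.1)
      rw [← not_lt, or_iff_not_imp_left, not_not]
      exact ht g hg
    have e1 : lc Θ φ x ≤ lc Θ φ g := by
      by_contra! h
      obtain ⟨t, ht, ht'⟩ := (hf.and_eventually ((continuous_lc_const Θ g).continuousAt.eventually_lt
        (continuous_lc_const Θ x).continuousAt h |>.filter_mono nhdsWithin_le_nhds)).exists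
      exact ht.1.not_gt ht'
    have e2 : rc Θ φ x ≤ rc Θ φ g := by
      by_contra! h
      obtain ⟨t, ht, ht'⟩ := (hf.and_eventually ((continuous_rc_const Θ g).continuousAt.eventually_lt
        (continuous_rc_const Θ x).continuousAt h |>.filter_mono nhdsWithin_le_nhds)).exists
      exact ht.2.not_gt ht'
    have hne : x ≠ g := by rintro rfl; exact hxG hg
    rcases hemp g hg with h | h
    · have e3 := le_antisymm h e1
      exact ⟨g, hg, e3, lt_of_le_of_ne e2 fun he => hne (ext_of_lc_rc h0 hπ e3.symm he)⟩
    -- A guard on the right ray leaves the cone under a counterclockwise turn, so it is not one that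
    -- enters.
    · exfalso
      have e3 := le_antisymm h e2
      have e4 : lc Θ φ x < lc Θ φ g :=
        lt_of_le_of_ne e1 fun he => hne (ext_of_lc_rc h0 hπ he e3.symm)
      obtain ⟨t, ht, ht'⟩ := (hf.and_eventually
        (Ioo_mem_nhdsGT (show φ < φ + Real.pi by linarith [Real.pi_pos]))).exists
      have e5 := rc_sub_of_rc_eq e3 t
      have e6 : Real.sin (φ - t) < 0 :=
        Real.sin_neg_of_neg_of_neg_pi_lt (by linarith [ht'.1]) (by linarith [ht'.2])
      have e7 := mul_neg_of_pos_of_neg (sub_pos.2 e4) e6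
      rw [← e5] at e7
      linarith [neg_of_mul_neg_right e7 hs.le, ht.2]
  · by_contra! hcon
    obtain ⟨t, ht⟩ := exists_forall_lt_of_not_touches_right h0 hπ hemp hxG hcon
    exact hxI (mem_interior_compl_region h0 hπ ht)

theorem isCompact_of_mem_arcs (h0 : 0 < Θ) (hπ : Θ < Real.pi) {a : Set Plane}
    (ha : a ∈ arcs G Θ) : IsCompact a := by
  obtain ⟨α, β, p, l, r, φ₁, φ₂, h, rfl⟩ := exists_isTunnelArc_of_mem_arcs h0 hπ ha
  exact isCompact_Icc.image_of_continuousOn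
    (h.motion.continuousOn.mono (Icc_subset_Icc h.le_left h.le_right))

/-- Only guards remain. A guard off the closed union of arcs would be an isolated boundary point, so
small circles around it are either inside the region or disjoint from it. -/
theorem frontier_region_subset (G : Finset Plane) (h0 : 0 < Θ) (hπ : Θ < Real.pi) :
    frontier (region G Θ) ⊆ ⋃₀ arcs G Θ := by
  intro x hx
  by_contra hxA
  have hopen := isOpen_region G h0 hπ
  have hA : IsClosed (⋃₀ arcs G Θ) := by
    rw [sUnion_eq_biUnion]
    exact (arcs_finite_and_ncard_le G h0 hπ).1.isClosed_biUnion
      fun a ha => (isCompact_of_mem_arcs h0 hπ ha).isClosed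
  have hsub : ∀ y ∈ frontier (region G Θ), y ∈ G ∨ y ∈ ⋃₀ arcs G Θ := fun y hy => by
    by_cases hyG : y ∈ G
    · exact Or.inl hyG
    · obtain ⟨φ, hφ⟩ := exists_touches_of_mem_frontier h0 hπ hy hyG
      exact Or.inr (hφ.mem_sUnion_arcs h0 hπ hyG)
  have hG : IsClosed ((G : Set Plane) \ {x}) := (G.finite_toSet.sdiff).isClosed
  obtain ⟨ε, hε, hball⟩ := Metric.isOpen_iff.1 (hA.union hG).isOpen_compl x
    (fun h => h.elim hxA fun h => h.2 rfl)
  have hfr : ∀ y ∈ Metric.ball x ε, y ≠ x → y ∉ frontier (region G Θ) := fun y hy hyx hyf =>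
    hball hy ((hsub y hyf).elim (fun h => Or.inr ⟨h, hyx⟩) Or.inl)
  rw [hopen.frontier_eq] at hx
  obtain ⟨z, hz, hzR⟩ := mem_closure_iff.1 hx.1 _ Metric.isOpen_ball (Metric.mem_ball_self hε)
  have hzx : z - x ≠ 0 := fun h => hx.2 (by rw [← sub_eq_zero.1 h]; exact hzR)
  obtain ⟨ρ, hρ, t₀, -, hz'⟩ := exists_eq_smul_dir_of_ne hzx 0
  have hγ : Continuous fun t => x + ρ • dir t := by
    have := continuous_dir
    exact continuous_const.add ((continuous_const (y := ρ)).smul this)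
  have hρε : ρ < ε := by
    rw [Metric.mem_ball, dist_eq_norm, hz', norm_smul, norm_dir, mul_one, Real.norm_of_nonneg hρ.le]
      at hz
    exact hz
  have hγf : ∀ t, x + ρ • dir t ∉ frontier (region G Θ) := fun t => by
    have e : ‖ρ • dir t‖ = ρ := by rw [norm_smul, norm_dir, mul_one, Real.norm_of_nonneg hρ.le]
    refine hfr _ ?_ fun h => ?_
    · rw [Metric.mem_ball, dist_eq_norm, add_sub_cancel_left, e]; exact hρε
    · rw [add_eq_left] at h
      rw [h, norm_zero] at e
      exact hρ.ne e
  have hclopen : IsClopen ((fun t => x + ρ • dir t) ⁻¹' region G Θ) := by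
    refine ⟨?_, hopen.preimage hγ⟩
    convert (isClosed_closure (s := region G Θ)).preimage hγ using 1
    ext t
    refine ⟨fun h => subset_closure h, fun h => by_contra fun h' => hγf t ?_⟩
    rw [hopen.frontier_eq]
    exact ⟨h, h'⟩
  rcases isClopen_iff.1 hclopen with h | h
  · have : t₀ ∈ (fun t => x + ρ • dir t) ⁻¹' region G Θ := by
      rw [mem_preimage, ← hz', add_sub_cancel]; exact hzR
    rw [h] at this
    exact this
  -- Moving the apex forward along the axis of an empty cone keeps it empty, so the circle also
  -- leaves the region.
  · obtain ⟨φ, hφ⟩ := (notMem_region_iff h0 hπ).1 hx.2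
    have hmem : φ ∈ (fun t => x + ρ • dir t) ⁻¹' region G Θ := by rw [h]; trivial
    have hhalf : 0 < Real.sin (Θ / 2) :=
      Real.sin_pos_of_pos_of_lt_pi (by linarith) (by linarith)
    refine (notMem_region_iff h0 hπ).2 ⟨φ, fun g hg => ?_⟩ hmem
    have e1 : φ + Θ / 2 - φ = Θ / 2 := by ring
    have e2 : φ - (φ - Θ / 2) = Θ / 2 := by ring
    rw [lc_add, rc_add, lc_smul, rc_smul, lc_dir, rc_dir, e1, e2]
    have := mul_pos hρ hhalf
    exact (hφ g hg).imp (fun h => by linarith) (fun h => by linarith)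

end Frontier

end GuardedRegion

/-! ### Polar coordinates and the local structure at a circle -/

namespace GuardedRegion

open Set

section Polar

/-- The point with polar coordinates `q` with respect to the center `c`. -/
noncomputable def polar (c : Plane) (q : ℝ × ℝ) : Plane := c + q.1 • dir q.2

theorem dir_injOn {a b : ℝ} (h1 : -(2 * Real.pi) < a - b) (h2 : a - b < 2 * Real.pi)
    (h : dir a = dir b) : a = b := by
  have e0 := congrArg (fun x : Plane => x 0) h
  have e1 := congrArg (fun x : Plane => x 1) h
  simp only [dir_zero, dir_one] at e0 e1
  have : Real.cos (a - b) = 1 := by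
    rw [Real.cos_sub, e0, e1, ← sq, ← sq, Real.cos_sq_add_sin_sq]
  linarith [(Real.cos_eq_one_iff_of_lt_of_lt h1 h2).1 this]

theorem continuous_polar (c : Plane) : Continuous (polar c) := by
  have h : Continuous fun q : ℝ × ℝ => dir q.2 := continuous_dir.comp continuous_snd
  exact continuous_const.add (continuous_fst.smul h)

theorem dist_polar (c : Plane) {ρ : ℝ} (hρ : 0 ≤ ρ) (t : ℝ) : dist (polar c (ρ, t)) c = ρ := by
  rw [polar, dist_eq_norm, add_sub_cancel_left, norm_smul, norm_dir, mul_one,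
    Real.norm_of_nonneg hρ]

theorem exists_polar_eq {c x : Plane} (h : x ≠ c) (a : ℝ) :
    ∃ t ∈ Ioc a (a + 2 * Real.pi), x = polar c (dist x c, t) := by
  obtain ⟨s, hs, t, ht, he⟩ := exists_eq_smul_dir_of_ne (sub_ne_zero.2 h) a
  have hx : x = polar c (s, t) := by rw [polar, ← he, add_sub_cancel]
  refine ⟨t, ht, ?_⟩
  conv_rhs => rw [hx, dist_polar c hs.le]
  exact hx

theorem polar_inj {c : Plane} {ρ a b : ℝ} (hρ : 0 < ρ) (h1 : -(2 * Real.pi) < a - b)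
    (h2 : a - b < 2 * Real.pi) (h : polar c (ρ, a) = polar c (ρ, b)) : a = b := by
  rw [polar, polar, add_right_inj] at h
  exact dir_injOn h1 h2 (smul_right_injective _ hρ.ne' h)

/-- The rest of the annulus is the image of a compact set that misses the point, so nearby points
have coordinates in the box. -/
theorem polar_image_mem_nhds (c : Plane) {ρ t η : ℝ} (hηρ : η < ρ) (hη : 0 < η) :
    polar c '' (Ioo (ρ - η) (ρ + η) ×ˢ Ioo (t - η) (t + η)) ∈ 𝓝 (polar c (ρ, t)) := by
  have hρ := hη.trans hηρ
  have hπ := Real.pi_pos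
  have hK : IsCompact (polar c '' (Icc (ρ - η) (ρ + η) ×ˢ
      (Icc (t - Real.pi) (t - η) ∪ Icc (t + η) (t + Real.pi)))) :=
    (isCompact_Icc.prod (isCompact_Icc.union isCompact_Icc)).image (continuous_polar c)
  have hxK : polar c (ρ, t) ∉ polar c '' (Icc (ρ - η) (ρ + η) ×ˢ
      (Icc (t - Real.pi) (t - η) ∪ Icc (t + η) (t + Real.pi))) := by
    rintro ⟨⟨σ, θ⟩, ⟨hσ, hθ⟩, he⟩
    have hσ0 : 0 < σ := by linarith [hσ.1]
    have e1 : σ = ρ := by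
      rw [← dist_polar c hσ0.le θ, he, dist_polar c hρ.le]
    subst e1
    rcases hθ with hθ | hθ
    · have := polar_inj hσ0 (by linarith [hθ.1]) (by linarith [hθ.2]) he
      linarith [hθ.2]
    · have := polar_inj hσ0 (by linarith [hθ.1]) (by linarith [hθ.2]) he
      linarith [hθ.1]
  have hd : ∀ᶠ y in 𝓝 (polar c (ρ, t)), dist y c ∈ Ioo (ρ - η) (ρ + η) :=
    (continuous_id.dist continuous_const).continuousAt.eventually_mem (by
      rw [id, dist_polar c hρ.le]
      exact Ioo_mem_nhds (by linarith) (by linarith))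
  filter_upwards [hd, hK.isClosed.isOpen_compl.mem_nhds hxK] with y hy hyK
  have hyc : y ≠ c := by
    rintro rfl
    rw [dist_self] at hy
    linarith [hy.1]
  obtain ⟨θ, hθ, he⟩ := exists_polar_eq hyc (t - Real.pi)
  refine ⟨(dist y c, θ), ⟨hy, ?_⟩, he.symm⟩
  by_contra hcon
  refine hyK ⟨(dist y c, θ), ⟨Ioo_subset_Icc_self hy, ?_⟩, he.symm⟩
  by_cases h : t - η < θ
  · exact Or.inr ⟨not_lt.1 fun h' => hcon ⟨h, h'⟩, by linarith [hθ.2]⟩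
  · exact Or.inl ⟨hθ.1.le, not_lt.1 h⟩

end Polar

theorem _root_.IsPreconnected.subset_of_disjoint_frontier {X : Type*} [TopologicalSpace X]
    {s R : Set X} (hs : IsPreconnected s) (hR : IsOpen R) (hf : Disjoint s (frontier R))
    (hne : (s ∩ R).Nonempty) : s ⊆ R := by
  refine hs.subset_left_of_subset_union hR isClosed_closure.isOpen_compl
    (disjoint_compl_right.mono_left subset_closure) (fun x hx => ?_) hne
  by_cases h : x ∈ R
  · exact Or.inl h
  · exact Or.inr fun hc => disjoint_left.1 hf hx (by rw [hR.frontier_eq]; exact ⟨hc, h⟩)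

/-- If the frontier of an open set `R` is near some point contained in a circle that is disjoint
from `R`, then it coincides with the circle near this point. -/
theorem exists_frontier_inter_eq {R W : Set Plane} (hR : IsOpen R) {c : Plane} {ρ t ε : ℝ}
    (hρ : 0 < ρ) (hε : 0 < ε) (hW : W ∈ 𝓝 (polar c (ρ, t)))
    (hx : polar c (ρ, t) ∈ frontier R) (hfW : frontier R ∩ W ⊆ Metric.sphere c ρ)
    (hdis : ∀ s ∈ Ioo (t - ε) (t + ε), polar c (ρ, s) ∉ R) :
    ∃ V ∈ 𝓝 (polar c (ρ, t)), frontier R ∩ V = Metric.sphere c ρ ∩ V := by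
  obtain ⟨U, hU, U', hU', hUU⟩ := mem_nhds_prod_iff.1 ((continuous_polar c).continuousAt hW)
  obtain ⟨η₁, hη₁, hB₁⟩ := Metric.mem_nhds_iff.1 hU
  obtain ⟨η₂, hη₂, hB₂⟩ := Metric.mem_nhds_iff.1 hU'
  obtain ⟨η, hη, hηm⟩ := exists_between
    (lt_min (lt_min hη₁ hη₂) (lt_min hρ hε) : (0 : ℝ) < min (min η₁ η₂) (min ρ ε))
  simp only [lt_min_iff] at hηm
  obtain ⟨⟨k1, k2⟩, k3, k4⟩ := hηm
  have hsubW : ∀ σ ∈ Ioo (ρ - η) (ρ + η), ∀ θ ∈ Ioo (t - η) (t + η), polar c (σ, θ) ∈ W := by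
    intro σ hσ θ hθ
    refine hUU (mk_mem_prod (hB₁ ?_) (hB₂ ?_))
    · rw [Real.ball_eq_Ioo]; exact ⟨by linarith [hσ.1], by linarith [hσ.2]⟩
    · rw [Real.ball_eq_Ioo]; exact ⟨by linarith [hθ.1], by linarith [hθ.2]⟩
  have hVn := polar_image_mem_nhds c (t := t) k3 hη
  have hdis' : ∀ θ ∈ Ioo (t - η) (t + η), polar c (ρ, θ) ∉ R := fun θ hθ =>
    hdis θ ⟨by linarith [hθ.1], by linarith [hθ.2]⟩
  -- One side of the circle within the box is connected and avoids the frontier. If it meets `R`, it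
  -- lies in `R`, and the whole piece of the circle is in the closure of `R` but outside `R`.
  have hhalf : ∀ J : Set ℝ, J.OrdConnected → J ⊆ Ioo (ρ - η) (ρ + η) → ρ ∉ J → ρ ∈ closure J →
      (polar c '' (J ×ˢ Ioo (t - η) (t + η)) ∩ R).Nonempty →
      ∀ θ ∈ Ioo (t - η) (t + η), polar c (ρ, θ) ∈ frontier R := by
    intro J hJ hJs hρJ hρc hne θ hθ
    have hsub : polar c '' (J ×ˢ Ioo (t - η) (t + η)) ⊆ R := by
      refine IsPreconnected.subset_of_disjoint_frontier ?_ hR ?_ hne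
      · exact (hJ.isPreconnected.prod isPreconnected_Ioo).image _
          (continuous_polar c).continuousOn
      · rw [disjoint_left]
        rintro _ ⟨⟨σ, s⟩, ⟨hσ, hs⟩, rfl⟩ hf
        have e := hfW ⟨hf, hsubW σ (hJs hσ) s hs⟩
        have hσ0 : 0 ≤ σ := by linarith [(hJs hσ).1]
        rw [Metric.mem_sphere, dist_polar c hσ0] at e
        exact hρJ (e ▸ hσ)
    rw [hR.frontier_eq]
    refine ⟨?_, hdis' θ hθ⟩
    have hc : Continuous fun σ => polar c (σ, θ) :=
      (continuous_polar c).comp (Continuous.prodMk_left θ)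
    have h1 := image_closure_subset_closure_image hc (mem_image_of_mem _ hρc)
    exact closure_mono (by
      rintro _ ⟨σ, hσ, rfl⟩
      exact hsub ⟨(σ, θ), ⟨hσ, hθ⟩, rfl⟩) h1
  have hall : ∀ θ ∈ Ioo (t - η) (t + η), polar c (ρ, θ) ∈ frontier R := by
    rw [hR.frontier_eq] at hx
    obtain ⟨z, ⟨⟨σ, θ⟩, ⟨hσ, hθ⟩, rfl⟩, hzR⟩ := mem_closure_iff_nhds.1 hx.1 _ hVn
    rcases lt_trichotomy σ ρ with h | rfl | h
    · refine hhalf (Ioo (ρ - η) ρ) ordConnected_Ioo (Ioo_subset_Ioo_right (by linarith))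
        right_notMem_Ioo ?_ ⟨_, ⟨(σ, θ), ⟨⟨hσ.1, h⟩, hθ⟩, rfl⟩, hzR⟩
      rw [closure_Ioo (by linarith)]
      exact right_mem_Icc.2 (by linarith)
    · exact absurd hzR (hdis' θ hθ)
    · refine hhalf (Ioo ρ (ρ + η)) ordConnected_Ioo (Ioo_subset_Ioo_left (by linarith))
        left_notMem_Ioo ?_ ⟨_, ⟨(σ, θ), ⟨⟨h, hσ.2⟩, hθ⟩, rfl⟩, hzR⟩
      rw [closure_Ioo (by linarith)]
      exact left_mem_Icc.2 (by linarith)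
  refine ⟨_, hVn, Subset.antisymm ?_ ?_⟩
  · rintro _ ⟨hf, ⟨σ, θ⟩, ⟨hσ, hθ⟩, rfl⟩
    exact ⟨hfW ⟨hf, hsubW σ hσ θ hθ⟩, ⟨(σ, θ), ⟨hσ, hθ⟩, rfl⟩⟩
  · rintro _ ⟨hf, ⟨σ, θ⟩, ⟨hσ, hθ⟩, rfl⟩
    refine ⟨?_, ⟨(σ, θ), ⟨hσ, hθ⟩, rfl⟩⟩
    have hσ0 : 0 ≤ σ := by linarith [hσ.1]
    rw [Metric.mem_sphere, dist_polar c hσ0] at hf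
    subst hf
    exact hall θ hθ

/-- A circular arc, given by a circle and an interval of directions. -/
structure CircularArc where
  center : Plane
  radius : ℝ
  first : ℝ
  last : ℝ
  pos : 0 < radius
  le : first ≤ last
  lt_two_pi : last - first < 2 * Real.pi

namespace CircularArc

/-- The point of the circle in direction `t`. -/
noncomputable def point (a : CircularArc) (t : ℝ) : Plane := polar a.center (a.radius, t)

/-- The set of points of an arc. -/
noncomputable def carrier (a : CircularArc) : Set Plane := a.point '' Icc a.first a.last

/-- The circle that contains an arc. -/
noncomputable def circle (a : CircularArc) : EuclideanGeometry.Sphere Plane :=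
  ⟨a.center, a.radius⟩

theorem continuous_point (a : CircularArc) : Continuous a.point :=
  (continuous_polar a.center).comp (Continuous.prodMk_right a.radius)

theorem point_injOn (a : CircularArc) : InjOn a.point (Icc a.first a.last) := fun s hs t ht h =>
  polar_inj a.pos (by linarith [a.lt_two_pi, hs.1, ht.2]) (by linarith [a.lt_two_pi, hs.2, ht.1]) h

theorem isClosed_carrier (a : CircularArc) : IsClosed a.carrier :=
  (isCompact_Icc.image a.continuous_point).isClosed

theorem carrier_subset_sphere (a : CircularArc) :
    a.carrier ⊆ Metric.sphere a.center a.radius := by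
  rintro _ ⟨t, -, rfl⟩
  exact dist_polar a.center a.pos.le t

theorem finite_inter_and_ncard_le {a b : CircularArc} (h : a.circle ≠ b.circle) :
    (a.carrier ∩ b.carrier).Finite ∧ (a.carrier ∩ b.carrier).ncard ≤ 2 := by
  classical
  suffices h' : ∃ p q, a.carrier ∩ b.carrier ⊆ {p, q} by
    obtain ⟨p, q, hpq⟩ := h'
    exact ⟨(toFinite _).subset hpq, (ncard_le_ncard hpq (toFinite _)).trans (by simpa using ncard_insert_le p {q})⟩
  rcases (a.carrier ∩ b.carrier).subsingleton_or_nontrivial with hs | ⟨p, hp, q, hq, hpq⟩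
  · rcases hs.eq_empty_or_singleton with he | ⟨p, he⟩
    · exact ⟨0, 0, by rw [he]; exact empty_subset _⟩
    · exact ⟨p, p, by rw [he]; simp⟩
  · refine ⟨p, q, fun z hz => ?_⟩
    have key : ∀ {c : CircularArc} {y}, y ∈ c.carrier → y ∈ c.circle := fun {c y} hy =>
      c.carrier_subset_sphere hy
    exact EuclideanGeometry.eq_of_mem_sphere_of_mem_sphere_of_finrank_eq_two (by simp) h hpq
      (key hp.1) (key hq.1) (key hz.1) (key hp.2) (key hq.2) (key hz.2)

end CircularArc

end GuardedRegion

/-! ### Complexity of an open set bounded by circular arcs -/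

namespace GuardedRegion

open Set

theorem finite_biUnion_and_ncard_le {ι β : Type*} {I : Set ι} (hI : I.Finite) {f : ι → Set β}
    {k : ℕ} (hf : ∀ i ∈ I, (f i).Finite ∧ (f i).ncard ≤ k) :
    (⋃ i ∈ I, f i).Finite ∧ (⋃ i ∈ I, f i).ncard ≤ I.ncard * k := by
  refine ⟨hI.biUnion fun i hi => (hf i hi).1, ?_⟩
  have h1 := hI.toFinset.set_ncard_biUnion_le f
  simp only [Finite.mem_toFinset] at h1
  refine h1.trans ?_
  rw [ncard_eq_toFinset_card I hI, ← smul_eq_mul]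
  exact Finset.sum_le_card_nsmul _ _ _ fun i hi => (hf i (hI.mem_toFinset.1 hi)).2

theorem _root_.Set.Subsingleton.finite_and_ncard_le_one {β : Type*} {s : Set β}
    (hs : s.Subsingleton) : s.Finite ∧ s.ncard ≤ 1 :=
  ⟨hs.finite, (ncard_le_one hs.finite).2 fun _ ha _ hb => hs ha hb⟩

section Counting

/-- The end points of the arcs of a family. -/
noncomputable def endPoints (𝒞 : Finset CircularArc) : Set Plane :=
  ⋃ a ∈ (𝒞 : Set CircularArc), {a.point a.first, a.point a.last}

/-- The points of an arc that are end points of arcs of the family or that also belong to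
an arc on another circle. -/
noncomputable def specialPoints (𝒞 : Finset CircularArc) (a : CircularArc) : Set Plane :=
  a.carrier ∩ (endPoints 𝒞 ∪ ⋃ b ∈ {b | b ∈ 𝒞 ∧ a.circle ≠ b.circle}, b.carrier)

/-- The special points of all arcs of a family. -/
noncomputable def allSpecialPoints (𝒞 : Finset CircularArc) : Set Plane :=
  ⋃ a ∈ (𝒞 : Set CircularArc), specialPoints 𝒞 a

variable {𝒞 : Finset CircularArc} {R : Set Plane}

/-- Being special does not depend on the arc: if `x` is special on `b` because of `d`, then `d` or
`b` itself lies on a circle other than that of `a`. -/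
theorem mem_specialPoints {a : CircularArc} {x : Plane} (hxa : x ∈ a.carrier)
    (hx : x ∈ allSpecialPoints 𝒞) : x ∈ specialPoints 𝒞 a := by
  obtain ⟨b, hb, hxb, h⟩ := mem_iUnion₂.1 hx
  refine ⟨hxa, h.imp id fun h => ?_⟩
  obtain ⟨d, ⟨hd, hbd⟩, hxd⟩ := mem_iUnion₂.1 h
  by_cases hab : a.circle = b.circle
  · exact mem_iUnion₂.2 ⟨d, ⟨hd, hab ▸ hbd⟩, hxd⟩
  · exact mem_iUnion₂.2 ⟨b, ⟨hb, hab⟩, hxb⟩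

theorem finite_specialPoints_and_ncard_le (𝒞 : Finset CircularArc) (a : CircularArc) :
    (specialPoints 𝒞 a).Finite ∧ (specialPoints 𝒞 a).ncard ≤ 4 * 𝒞.card := by
  have h1 : (endPoints 𝒞).Finite ∧ (endPoints 𝒞).ncard ≤ (𝒞 : Set CircularArc).ncard * 2 :=
    finite_biUnion_and_ncard_le 𝒞.finite_toSet fun a _ =>
      ⟨toFinite _, by simpa using ncard_insert_le (a.point a.first) {a.point a.last}⟩
  have hsub : {b | b ∈ 𝒞 ∧ a.circle ≠ b.circle} ⊆ (𝒞 : Set CircularArc) := fun b hb => hb.1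
  have h2 := finite_biUnion_and_ncard_le (𝒞.finite_toSet.subset hsub)
    (f := fun b => a.carrier ∩ b.carrier) fun b hb => CircularArc.finite_inter_and_ncard_le hb.2
  have h3 := ncard_le_ncard hsub 𝒞.finite_toSet
  have hs : specialPoints 𝒞 a ⊆
      endPoints 𝒞 ∪ ⋃ b ∈ {b | b ∈ 𝒞 ∧ a.circle ≠ b.circle}, a.carrier ∩ b.carrier := by
    rw [← inter_iUnion₂]
    exact fun x hx => hx.2.imp id fun h => ⟨hx.1, h⟩
  rw [ncard_coe_finset] at h1 h3
  refine ⟨(h1.1.union h2.1).subset hs, (ncard_le_ncard hs (h1.1.union h2.1)).trans ?_⟩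
  have h4 := ncard_union_le (endPoints 𝒞)
    (⋃ b ∈ {b | b ∈ 𝒞 ∧ a.circle ≠ b.circle}, a.carrier ∩ b.carrier)
  linarith [h1.2, h2.2]

theorem finite_allSpecialPoints_and_ncard_le (𝒞 : Finset CircularArc) :
    (allSpecialPoints 𝒞).Finite ∧ (allSpecialPoints 𝒞).ncard ≤ 𝒞.card * (4 * 𝒞.card) := by
  have := finite_biUnion_and_ncard_le 𝒞.finite_toSet
    fun a _ => finite_specialPoints_and_ncard_le 𝒞 a
  rwa [ncard_coe_finset] at this

/-- Arcs that miss `x` stay away from a neighbourhood, and all arcs through `x` share one circle. As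
`x` is no end point, `a` extends to both sides of it. -/
theorem exists_frontier_inter_eq_of_notMem (hR : IsOpen R)
    (hfr : frontier R ⊆ ⋃ a ∈ 𝒞, a.carrier) (hdis : ∀ a ∈ 𝒞, Disjoint a.carrier R)
    {a : CircularArc} (ha : a ∈ 𝒞) {x : Plane} (hx : x ∈ frontier R) (hxa : x ∈ a.carrier)
    (hxP : x ∉ allSpecialPoints 𝒞) :
    ∃ V ∈ 𝓝 x, frontier R ∩ V = Metric.sphere a.center a.radius ∩ V := by
  have hxs : x ∉ specialPoints 𝒞 a := fun h => hxP (mem_iUnion₂.2 ⟨a, ha, h⟩)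
  have hcl : IsClosed (⋃ b ∈ {b | b ∈ 𝒞 ∧ x ∉ b.carrier}, b.carrier) :=
    (𝒞.finite_toSet.subset fun b hb => hb.1).isClosed_biUnion fun b _ => b.isClosed_carrier
  have hW : (⋃ b ∈ {b | b ∈ 𝒞 ∧ x ∉ b.carrier}, b.carrier)ᶜ ∈ 𝓝 x :=
    hcl.isOpen_compl.mem_nhds fun h => by
      obtain ⟨b, hb, hxb⟩ := mem_iUnion₂.1 h
      exact hb.2 hxb
  have hfW : frontier R ∩ (⋃ b ∈ {b | b ∈ 𝒞 ∧ x ∉ b.carrier}, b.carrier)ᶜ ⊆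
      Metric.sphere a.center a.radius := by
    rintro y ⟨hy, hyW⟩
    obtain ⟨b, hb, hyb⟩ := mem_iUnion₂.1 (hfr hy)
    have hxb : x ∈ b.carrier := by
      by_contra h
      exact hyW (mem_iUnion₂.2 ⟨b, ⟨hb, h⟩, hyb⟩)
    have hab : a.circle = b.circle := by
      by_contra h
      exact hxs ⟨hxa, Or.inr (mem_iUnion₂.2 ⟨b, ⟨hb, h⟩, hxb⟩)⟩
    have h1 : a.center = b.center := congrArg EuclideanGeometry.Sphere.center hab
    have h2 : a.radius = b.radius := congrArg EuclideanGeometry.Sphere.radius hab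
    rw [h1, h2]
    exact b.carrier_subset_sphere hyb
  obtain ⟨t, ht, rfl⟩ := hxa
  have hend : ∀ s, s = a.first ∨ s = a.last → t ≠ s := by
    rintro s hs rfl
    refine hxs ⟨⟨t, ht, rfl⟩, Or.inl (mem_iUnion₂.2 ⟨a, ha, ?_⟩)⟩
    rcases hs with h | h
    · exact Or.inl (by rw [← h])
    · exact Or.inr (by rw [← h]; rfl)
  have ht1 : a.first < t := lt_of_le_of_ne ht.1 (hend _ (Or.inl rfl)).symm
  have ht2 : t < a.last := lt_of_le_of_ne ht.2 (hend _ (Or.inr rfl))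
  refine exists_frontier_inter_eq hR a.pos
    (lt_min (sub_pos.2 ht1) (sub_pos.2 ht2)) hW hx hfW fun s hs => ?_
  refine disjoint_left.1 (hdis a ha) ⟨s, ⟨?_, ?_⟩, rfl⟩
  · linarith [hs.1, min_le_left (t - a.first) (a.last - t)]
  · linarith [hs.2, min_le_right (t - a.first) (a.last - t)]

theorem vertices_subset_allSpecialPoints (hR : IsOpen R)
    (hfr : frontier R ⊆ ⋃ a ∈ 𝒞, a.carrier) (hdis : ∀ a ∈ 𝒞, Disjoint a.carrier R) :
    vertices R ⊆ allSpecialPoints 𝒞 := by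
  rintro x ⟨hx, hv⟩
  by_contra hxP
  obtain ⟨a, ha, hxa⟩ := mem_iUnion₂.1 (hfr hx)
  exact hv ⟨a.center, a.radius, a.pos,
    exists_frontier_inter_eq_of_notMem hR hfr hdis ha hx hxa hxP⟩

/-- Away from special points, the parameters at which the arc is in the frontier form an open and
closed set. -/
theorem connectedComponentIn_point_eq (hR : IsOpen R)
    (hfr : frontier R ⊆ ⋃ a ∈ 𝒞, a.carrier) (hdis : ∀ a ∈ 𝒞, Disjoint a.carrier R)
    {a : CircularArc} (ha : a ∈ 𝒞) {t t' : ℝ} (h1 : a.first ≤ t) (htt : t ≤ t')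
    (h2 : t' ≤ a.last) (hP : ∀ u ∈ Icc t t', a.point u ∉ allSpecialPoints 𝒞)
    (ht : a.point t ∈ frontier R) :
    connectedComponentIn (frontier R \ vertices R) (a.point t) =
      connectedComponentIn (frontier R \ vertices R) (a.point t') := by
  have hsub : Icc t t' ⊆ a.point ⁻¹' frontier R := by
    refine IsClosed.Icc_subset_of_forall_mem_nhdsWithin
      ((isClosed_frontier.preimage a.continuous_point).inter isClosed_Icc) ht ?_
    rintro u ⟨hu, hu'⟩
    obtain ⟨V, hV, he⟩ := exists_frontier_inter_eq_of_notMem hR hfr hdis ha hu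
      ⟨u, ⟨h1.trans hu'.1, hu'.2.le.trans h2⟩, rfl⟩ (hP u (Ico_subset_Icc_self hu'))
    filter_upwards [mem_nhdsWithin_of_mem_nhds
      (a.continuous_point.continuousAt.preimage_mem_nhds hV)] with w hw
    have : a.point w ∈ Metric.sphere a.center a.radius ∩ V :=
      ⟨dist_polar a.center a.pos.le w, hw⟩
    rw [← he] at this
    exact this.1
  have hF : a.point '' Icc t t' ⊆ frontier R \ vertices R := by
    rintro _ ⟨u, hu, rfl⟩
    exact ⟨hsub hu, fun hv => hP u hu (vertices_subset_allSpecialPoints hR hfr hdis hv)⟩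
  have hpc : IsPreconnected (a.point '' Icc t t') :=
    isPreconnected_Icc.image _ a.continuous_point.continuousOn
  exact connectedComponentIn_eq (hpc.subset_connectedComponentIn
    (mem_image_of_mem _ (left_mem_Icc.2 htt)) hF (mem_image_of_mem _ (right_mem_Icc.2 htt)))

/-- The edges that contain a point of the arc `a` behind the special point `z`. -/
noncomputable def edgesBehind (𝒞 : Finset CircularArc) (R : Set Plane) (a : CircularArc)
    (z : Plane) : Set (Set Plane) :=
  {e | ∃ s t, a.first ≤ s ∧ s < t ∧ t ≤ a.last ∧ a.point s = z ∧
    (∀ u ∈ Ioc s t, a.point u ∉ allSpecialPoints 𝒞) ∧ a.point t ∈ frontier R ∧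
    e = connectedComponentIn (frontier R \ vertices R) (a.point t)}

theorem subsingleton_edgesBehind (hR : IsOpen R)
    (hfr : frontier R ⊆ ⋃ a ∈ 𝒞, a.carrier) (hdis : ∀ a ∈ 𝒞, Disjoint a.carrier R)
    {a : CircularArc} (ha : a ∈ 𝒞) (z : Plane) : (edgesBehind 𝒞 R a z).Subsingleton := by
  rintro e ⟨s, t, h1, h2, h3, h4, h5, h6, rfl⟩ e' ⟨s', t', h1', h2', h3', h4', h5', h6', rfl⟩
  obtain rfl : s = s' := a.point_injOn ⟨h1, h2.le.trans h3⟩ ⟨h1', h2'.le.trans h3'⟩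
    (h4.trans h4'.symm)
  rcases le_total t t' with h | h
  · exact connectedComponentIn_point_eq hR hfr hdis ha (h1.trans h2.le) h h3'
      (fun u hu => h5' u ⟨h2.trans_le hu.1, hu.2⟩) h6
  · exact (connectedComponentIn_point_eq hR hfr hdis ha (h1.trans h2'.le) h h3
      (fun u hu => h5 u ⟨h2'.trans_le hu.1, hu.2⟩) h6').symm

/-- From a point of the edge, go back along an arc to the last special point; it exists since the
first end point is special. -/
theorem edges_subset (hfr : frontier R ⊆ ⋃ a ∈ 𝒞, a.carrier) :
    edges R ⊆ (⋃ x ∈ allSpecialPoints 𝒞, {connectedComponentIn (frontier R \ vertices R) x}) ∪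
      ⋃ a ∈ (𝒞 : Set CircularArc), ⋃ z ∈ specialPoints 𝒞 a, edgesBehind 𝒞 R a z := by
  rintro e ⟨x, hx, rfl⟩
  by_cases hxP : x ∈ allSpecialPoints 𝒞
  · exact Or.inl (mem_iUnion₂.2 ⟨x, hxP, rfl⟩)
  right
  obtain ⟨a, ha, t, ht, rfl⟩ := mem_iUnion₂.1 (hfr hx.1)
  have hPc : IsClosed (a.point ⁻¹' allSpecialPoints 𝒞) :=
    (finite_allSpecialPoints_and_ncard_le 𝒞).1.isClosed.preimage a.continuous_point
  have hfirst : a.point a.first ∈ allSpecialPoints 𝒞 := mem_iUnion₂.2 ⟨a, ha,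
    ⟨a.first, left_mem_Icc.2 a.le, rfl⟩, Or.inl (mem_iUnion₂.2 ⟨a, ha, Or.inl rfl⟩)⟩
  obtain ⟨s, ⟨hs, hsP⟩, hmax⟩ := (isCompact_Icc.inter_right hPc).exists_isGreatest
    ⟨a.first, left_mem_Icc.2 ht.1, hfirst⟩
  have hst : s < t := lt_of_le_of_ne hs.2 fun h => hxP (h ▸ hsP)
  refine mem_iUnion₂.2 ⟨a, ha, mem_iUnion₂.2 ⟨a.point s,
    mem_specialPoints ⟨s, ⟨hs.1, hs.2.trans ht.2⟩, rfl⟩ hsP, s, t, hs.1, hst, ht.2, rfl,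
    fun u hu huP => ?_, hx.1, rfl⟩⟩
  exact absurd (hmax ⟨⟨hs.1.trans hu.1.le, hu.2⟩, huP⟩) (not_le.2 hu.1)

/-- An open set whose frontier is covered by `N` circular arcs that are disjoint from the set has
complexity `O(N ^ 2)`. -/
theorem finite_vertices_edges_and_ncard_le (hR : IsOpen R)
    (hfr : frontier R ⊆ ⋃ a ∈ 𝒞, a.carrier) (hdis : ∀ a ∈ 𝒞, Disjoint a.carrier R) :
    (vertices R).Finite ∧ (edges R).Finite ∧
      (vertices R).ncard + (edges R).ncard ≤ 12 * 𝒞.card ^ 2 := by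
  obtain ⟨hPf, hPn⟩ := finite_allSpecialPoints_and_ncard_le 𝒞
  have hv := vertices_subset_allSpecialPoints hR hfr hdis
  have he := edges_subset (R := R) hfr
  obtain ⟨h1, h1'⟩ := finite_biUnion_and_ncard_le hPf
    (f := fun x => {connectedComponentIn (frontier R \ vertices R) x}) (k := 1)
    fun x _ => subsingleton_singleton.finite_and_ncard_le_one
  obtain ⟨h2, h2'⟩ := finite_biUnion_and_ncard_le 𝒞.finite_toSet
    (f := fun a => ⋃ z ∈ specialPoints 𝒞 a, edgesBehind 𝒞 R a z) (k := 4 * 𝒞.card)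
    fun a ha => by
      obtain ⟨h3, h4⟩ := finite_specialPoints_and_ncard_le 𝒞 a
      have h5 := finite_biUnion_and_ncard_le h3 (f := edgesBehind 𝒞 R a) (k := 1)
        fun z _ => (subsingleton_edgesBehind hR hfr hdis ha z).finite_and_ncard_le_one
      exact ⟨h5.1, h5.2.trans (by linarith)⟩
  rw [ncard_coe_finset] at h2'
  refine ⟨hPf.subset hv, (h1.union h2).subset he, ?_⟩
  have e1 := ncard_le_ncard hv hPf
  have e2 := ncard_le_ncard he (h1.union h2)
  have e3 := ncard_union_le
    (⋃ x ∈ allSpecialPoints 𝒞, {connectedComponentIn (frontier R \ vertices R) x})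
    (⋃ a ∈ (𝒞 : Set CircularArc), ⋃ z ∈ specialPoints 𝒞 a, edgesBehind 𝒞 R a z)
  -- Vertices, edges through special points, and edges behind special points contribute `4 N²` each.
  nlinarith

end Counting

end GuardedRegion

/-! ### The arcs of tunnels are circular arcs -/

namespace GuardedRegion

open Set

section Circularity

variable {G : Finset Plane} {Θ : ℝ}

/-- If a cone rotates with two points on its bounding rays, then its apex moves on a circle. -/
theorem exists_rayPoint_eq_polar (h0 : 0 < Θ) (hπ : Θ < Real.pi) {l r : Plane} (hlr : l ≠ r) :
    ∃ c ρ κ, 0 < ρ ∧ ∀ φ, rayPoint Θ l r φ = polar c (ρ, 2 * φ + κ) := by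
  have hs := Real.sin_pos_of_pos_of_lt_pi h0 hπ
  -- The radius vector at direction zero, of length `‖r - l‖ / (2 sin Θ)` as in the law of sines.
  -- Turning the cone by `φ` turns it by `2φ` about `c`.
  set v : Plane := !₂[(r 1 - l 1) / (2 * Real.sin Θ), (r 0 - l 0) / (2 * Real.sin Θ)] with hv
  have v0 : v 0 = (r 1 - l 1) / (2 * Real.sin Θ) := by simp [hv]
  have v1 : v 1 = (r 0 - l 0) / (2 * Real.sin Θ) := by simp [hv]
  have hv' : v ≠ 0 := by
    intro h
    rw [h] at v0 v1
    have e : (2 * Real.sin Θ) ≠ 0 := by positivity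
    simp only [PiLp.zero_apply, eq_comm (a := (0 : ℝ)), div_eq_zero_iff, e, or_false,
      sub_eq_zero] at v0 v1
    exact hlr (plane_ext v1.symm v0.symm)
  obtain ⟨ρ, hρ, κ, -, he⟩ := exists_eq_smul_dir_of_ne hv' 0
  rw [he] at v0 v1
  simp only [PiLp.smul_apply, smul_eq_mul, dir_zero, dir_one] at v0 v1
  set c : Plane := !₂[(l 0 + r 0) / 2 + (r 1 - l 1) * Real.cos Θ / (2 * Real.sin Θ),
    (l 1 + r 1) / 2 + (l 0 - r 0) * Real.cos Θ / (2 * Real.sin Θ)] with hc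
  have c0 : c 0 = (l 0 + r 0) / 2 + (r 1 - l 1) * Real.cos Θ / (2 * Real.sin Θ) := by simp [hc]
  have c1 : c 1 = (l 1 + r 1) / 2 + (l 0 - r 0) * Real.cos Θ / (2 * Real.sin Θ) := by simp [hc]
  refine ⟨c, ρ, κ, hρ, fun φ => ?_⟩
  have hsΘ : Real.sin Θ = Real.sin (φ + Θ / 2) * Real.cos (φ - Θ / 2)
      - Real.cos (φ + Θ / 2) * Real.sin (φ - Θ / 2) := by
    rw [← Real.sin_sub]; congr 1; ring
  have hcΘ : Real.cos Θ = Real.cos (φ + Θ / 2) * Real.cos (φ - Θ / 2)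
      + Real.sin (φ + Θ / 2) * Real.sin (φ - Θ / 2) := by
    rw [← Real.cos_sub]; congr 1; ring
  have hs2 : Real.sin (2 * φ) = Real.sin (φ + Θ / 2) * Real.cos (φ - Θ / 2)
      + Real.cos (φ + Θ / 2) * Real.sin (φ - Θ / 2) := by
    rw [← Real.sin_add]; congr 1; ring
  have hc2 : Real.cos (2 * φ) = Real.cos (φ + Θ / 2) * Real.cos (φ - Θ / 2)
      - Real.sin (φ + Θ / 2) * Real.sin (φ - Θ / 2) := by
    rw [← Real.cos_add]; congr 1; ring
  have e0 : ρ * Real.cos (2 * φ + κ) =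
      (Real.cos (2 * φ) * (r 1 - l 1) - Real.sin (2 * φ) * (r 0 - l 0)) / (2 * Real.sin Θ) := by
    rw [Real.cos_add]; linear_combination Real.cos (2 * φ) * v0 - Real.sin (2 * φ) * v1
  have e1 : ρ * Real.sin (2 * φ + κ) =
      (Real.sin (2 * φ) * (r 1 - l 1) + Real.cos (2 * φ) * (r 0 - l 0)) / (2 * Real.sin Θ) := by
    rw [Real.sin_add]; linear_combination Real.sin (2 * φ) * v0 + Real.cos (2 * φ) * v1
  apply plane_ext
  · simp only [rayPoint, polar, PiLp.add_apply, PiLp.smul_apply, smul_eq_mul, dir_zero, dir_one, e0,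
      lc, rc, cross, c0]
    rw [hc2, hs2, hcΘ]
    field_simp
    rw [hsΘ]
    ring_nf
  · simp only [rayPoint, polar, PiLp.add_apply, PiLp.smul_apply, smul_eq_mul, dir_zero, dir_one, e1,
      lc, rc, cross, c1]
    rw [hc2, hs2, hcΘ]
    field_simp
    rw [hsΘ]
    ring_nf

/-- The angle on the circle is twice the turn of the cone, hence at most `2(π - Θ)`, less than a
full turn. Each apex carries an empty cone, so the arc misses the region. -/
theorem exists_circularArc_of_mem_arcs (h0 : 0 < Θ) (hπ : Θ < Real.pi) {a : Set Plane}
    (ha : a ∈ arcs G Θ) : ∃ b : CircularArc, b.carrier = a ∧ Disjoint a (region G Θ) := by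
  obtain ⟨α, β, p, l, r, φ₁, φ₂, h, rfl⟩ := exists_isTunnelArc_of_mem_arcs h0 hπ ha
  have hsw := h.motion.isSweep h0 hπ
  have hp : ∀ t ∈ Icc φ₁ φ₂, p t = rayPoint Θ l r t := fun t ht =>
    ext_of_lc_rc h0 hπ (by rw [lc_rayPoint h0 hπ, (h.touches h0 hπ t ht).1])
      (by rw [rc_rayPoint h0 hπ, (h.touches h0 hπ t ht).2])
  have hlr : l ≠ r := by
    rintro rfl
    obtain ⟨m, hm⟩ := nonempty_Ioo.2 h.lt
    have h1 := h.touches h0 hπ m (Ioo_subset_Icc_self hm)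
    have h2 := h.rc_lt h0 hπ ⟨h.le_left.trans_lt hm.1, hm.2.trans_le h.le_right⟩
    exact h2.ne' h1.2
  obtain ⟨c, ρ, κ, hρ, hq⟩ := exists_rayPoint_eq_polar h0 hπ hlr
  have hle := hsw.sub_le h.le_left h.le_right h.lt
  refine ⟨⟨c, ρ, 2 * φ₁ + κ, 2 * φ₂ + κ, hρ, by linarith [h.lt], by linarith⟩, ?_, ?_⟩
  · refine Subset.antisymm ?_ ?_
    · rintro _ ⟨t, ⟨ht1, ht2⟩, rfl⟩
      simp only at ht1 ht2
      have ht : (t - κ) / 2 ∈ Icc φ₁ φ₂ := ⟨by linarith, by linarith⟩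
      refine ⟨(t - κ) / 2, ht, ?_⟩
      rw [hp _ ht, hq, CircularArc.point]
      congr 2
      ring
    · rintro _ ⟨t, ht, rfl⟩
      exact ⟨2 * t + κ, ⟨by simp only; linarith [ht.1], by simp only; linarith [ht.2]⟩,
        by rw [hp t ht, hq, CircularArc.point]⟩
  · rw [disjoint_left]
    rintro _ ⟨t, ht, rfl⟩ hR
    exact hR t (h.motion.isEmptyCone t (Icc_subset_Icc h.le_left h.le_right ht))

theorem finite_vertices_edges_region (G : Finset Plane) (h0 : 0 < Θ) (hπ : Θ < Real.pi) :
    (vertices (region G Θ)).Finite ∧ (edges (region G Θ)).Finite ∧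
      (vertices (region G Θ)).ncard + (edges (region G Θ)).ncard ≤ 12 * (arcs G Θ).ncard ^ 2 := by
  classical
  have hfin := (arcs_finite_and_ncard_le G h0 hπ).1
  choose f hf using fun a : arcs G Θ => exists_circularArc_of_mem_arcs h0 hπ a.2
  have := hfin.fintype
  have h := finite_vertices_edges_and_ncard_le (𝒞 := Finset.univ.image f)
    (isOpen_region G h0 hπ) (fun x hx => by
      obtain ⟨a, ha, hxa⟩ := frontier_region_subset G h0 hπ hx
      exact mem_iUnion₂.2 ⟨f ⟨a, ha⟩, Finset.mem_image_of_mem _ (Finset.mem_univ _),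
        by rwa [(hf ⟨a, ha⟩).1]⟩) (fun b hb => by
      obtain ⟨a, -, rfl⟩ := Finset.mem_image.1 hb
      rw [(hf a).1]
      exact (hf a).2)
  refine ⟨h.1, h.2.1, h.2.2.trans (Nat.mul_le_mul_left _ (Nat.pow_le_pow_left ?_ _))⟩
  refine Finset.card_image_le.trans ?_
  rw [Finset.card_univ, ← Nat.card_eq_fintype_card, Nat.card_coe_set_eq]

end Circularity

end GuardedRegion

theorem mainTheorem1 :
    ∃ C : ℝ, 0 < C ∧
      ∀ (G : Finset Plane) (Θ : ℝ), 0 < Θ → Θ < Real.pi →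
        ((GuardedRegion.arcs G Θ).Finite ∧
          ((GuardedRegion.arcs G Θ).ncard : ℝ) ≤ C * ((G.card : ℝ) / Θ)) ∧
        frontier (GuardedRegion.region G Θ) ⊆ ⋃₀ GuardedRegion.arcs G Θ ∧
        ((GuardedRegion.vertices (GuardedRegion.region G Θ)).Finite ∧
          (GuardedRegion.edges (GuardedRegion.region G Θ)).Finite ∧
          ((GuardedRegion.vertices (GuardedRegion.region G Θ)).ncard : ℝ) +
              ((GuardedRegion.edges (GuardedRegion.region G Θ)).ncard : ℝ) ≤
            C * ((G.card : ℝ) ^ 2 / Θ ^ 2)) := by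
  have hπ3 := Real.pi_gt_three
  -- The complexity bound `12 N²` with `N ≤ 9π n / Θ` dictates the constant, which also exceeds
  -- `9π`.
  refine ⟨12 * (9 * Real.pi) ^ 2, by positivity, fun G Θ h0 hπ => ?_⟩
  obtain ⟨h1, h2⟩ := GuardedRegion.arcs_finite_and_ncard_le G h0 hπ
  obtain ⟨h3, h4, h5⟩ := GuardedRegion.finite_vertices_edges_region G h0 hπ
  refine ⟨⟨h1, h2.trans ?_⟩, GuardedRegion.frontier_region_subset G h0 hπ, h3, h4, ?_⟩
  · exact mul_le_mul_of_nonneg_right (by nlinarith) (by positivity)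
  · have h5' : ((GuardedRegion.vertices (GuardedRegion.region G Θ)).ncard : ℝ) +
        ((GuardedRegion.edges (GuardedRegion.region G Θ)).ncard : ℝ) ≤
        12 * ((GuardedRegion.arcs G Θ).ncard : ℝ) ^ 2 := by exact_mod_cast h5
    calc _ ≤ 12 * ((GuardedRegion.arcs G Θ).ncard : ℝ) ^ 2 := h5'
      _ ≤ 12 * (9 * Real.pi * ((G.card : ℝ) / Θ)) ^ 2 := by gcongr
      _ = _ := by rw [mul_pow, div_pow]; ring
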